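/- Let $d\ge 2$ and let $k\ge p\ge q\ge 1$, $k\ge 2$, be integers. Let $\Omega\subset\mathbb R^d$ be open and bounded with Lipschitz boundary and let $\mathcal T_h$ be a finite partition of $\overline\Omega$ into closed, not necessarily convex, polytopes $T$ with flat edges/faces $e$. For each face $e$ a unit normal $\mathbf n_e$ is fixed; $\mathbf n$ is the unit outward normal on $\partial T$, and $h_T$, $h_e$ are the diameters of $T$, $e$. The partition is *shape regular* with constants $\rho_v,\rho_e,\kappa,\sigma>0$ if $\rho_v h_T^d\le |T|$ for every element, $\rho_e h_e^{d-1}\le |e|$ for every face, and for every face $e$ of an element $T$ one has $\kappa h_T\le h_e$ and there is a point $A\in T$ such that the pyramid with base $e$ and apex $A$ lies in $T$ and $(x-A)\cdot\mathbf n\ge \sigma h_T$ for $x\in e$. Assume moreover that every element has at most $N$ faces. Let $V_h$ be the space of $v=\{v_0,v_b,v_n\mathbf n_e\}$ with $v_0|_T\in P_k(T)$ on every element and single-valued $v_b|_e\in P_p(e)$, $v_n|_e\in P_q(e)$ on every face. For an integer $r\ge 0$ the discrete weak Laplacian $\Delta_w v$ is, on each $T$, the unique polynomial in $P_r(T)$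 with $$(\Delta_w v,\varphi)_T=(v_0,\Delta\varphi)_T-\langle v_b,\nabla\varphi\cdot\mathbf n\rangle_{\partial T}+\langle v_n\mathbf n_e\cdot\mathbf n,\varphi\rangle_{\partial T}\qquad\forall\varphi\in P_r(T).$$ Put $|||v|||=\big(\sum_T\|\Delta_w v\|_T^2\big)^{1/2}$ and $$\|v\|_{2,h}=\Big(\sum_{T}\|\Delta v_0\|_T^2+h_T^{-3}\|v_0-v_b\|_{\partial T}^2+h_T^{-1}\|(\nabla v_0-v_n\mathbf n_e)\cdot\mathbf n\|_{\partial T}^2\Big)^{1/2}.$$ Then the following hold. 1. There is $C>0$, depending only on $d,k,p,q,N,\rho_v,\rho_e,\kappa,\sigma$, such that for every $r\ge 2N+k-2$, every such $\Omega$ and $\mathcal T_h$, every $v\in V_h$ and every $T\in\mathcal T_h$: $\|\Delta v_0\|_T\le C\|\Delta_w v\|_T$. 2. For every $\delta>0$ and $r\ge 2N+k-1$ there are $C_1,C_2>0$, depending only on $\delta,r$ and the constants listed in 1, such that $$C_1\|v\|_{2,h}\le|||v|||\le C_2\|v\|_{2,h}\qquad\forall v\in V_h$$ for all such $\Omega$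 and $\mathcal T_h$ in which, for any two faces $e\ne e'$ of an element $T$, some point of $e$ has distance at least $\delta h_T$ from the hyperplane containing $e'$. 3. For every such $\Omega$ and every $\tau>0$ there is $r_0$, depending only on $\Omega$, $\tau$ and the constants listed in 1, such that for every $r\ge r_0$ there are $C_1,C_2>0$, depending only on $r$ and the same data, for which the two inequalities in 2 hold for all $v\in V_h$ and all such partitions $\mathcal T_h$ of this $\Omega$ in which each face of an element $T$ contains a $(d-1)$-dimensional ball of radius $\tau h_T$ (two faces of an element may here lie in the same hyperplane, or in nearly equal ones). -/

import Mathlib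

open MeasureTheory Filter Topology

noncomputable section

namespace WGBiharmonic

/-- The Euclidean space `ℝ^d`. -/
abbrev E (d : ℕ) : Type := EuclideanSpace ℝ (Fin d)

/-- Real polynomials in `d` variables. -/
abbrev Poly (d : ℕ) : Type := MvPolynomial (Fin d) ℝ

/-! ### Domains and polytopal meshes -/

/-- `Ω` is an open bounded set with Lipschitz boundary: near each boundary point `x`, in some
orthogonal coordinate system with vertical unit vector `u`, the set `Ω` is the set of the points
below the graph of a Lipschitz function of the horizontal component `y - x - ⟪u, y - x⟫ u`. -/
structure IsBoundedLipschitz {d : ℕ} (Ω : Set (E d)) : Prop where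
  isOpen : IsOpen Ω
  isBounded : Bornology.IsBounded Ω
  chart : ∀ x ∈ frontier Ω, ∃ u : E d, ‖u‖ = 1 ∧ ∃ (L : NNReal) (γ : E d → ℝ) (ε : ℝ),
    LipschitzWith L γ ∧ 0 < ε ∧ ∀ y ∈ Metric.ball x ε,
      (y ∈ Ω ↔ inner ℝ u (y - x) < γ (y - x - inner ℝ u (y - x) • u))

/-- An `m`-dimensional (not necessarily convex) polytope: a finite union of `m`-dimensional convex
polytopes lying in one `m`-dimensional affine subspace, with connected relative interior. -/
structure IsPolytope {d : ℕ} (m : ℕ) (P : Set (E d)) : Prop where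
  exists_pieces : ∃ S : Finset (Finset (E d)),
    (∀ s ∈ S, Module.finrank ℝ (vectorSpan ℝ (s : Set (E d))) = m) ∧
      P = ⋃ s ∈ S, convexHull ℝ (s : Set (E d))
  finrank_eq : Module.finrank ℝ (vectorSpan ℝ P) = m
  connected : IsConnected (intrinsicInterior ℝ P)

/-- The surface measure on the flat face `e`: the (normalised) `(d-1)`-dimensional Hausdorff
measure restricted to `e`. -/
def surf {d : ℕ} (e : Set (E d)) : Measure (E d) := (μHE[d - 1]).restrict e

/-- At the point `x`, the set `T` lies behind `x` and not in front of `x` in the direction `ν`. -/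
def LiesBehind {d : ℕ} (T : Set (E d)) (ν x : E d) : Prop :=
  ∀ᶠ t in 𝓝[>] (0 : ℝ), x - t • ν ∈ T ∧ x + t • ν ∉ T

/-- A finite partition of `Ω` into closed polytopes (the elements), with the set of all its flat
edges/faces and a unit normal `n_e` chosen for each face `e`. Hanging nodes are allowed: each flat
piece which is shared by two elements, or by an element and the boundary of `Ω`, is a face. -/
structure PolytopalMesh (d : ℕ) (Ω : Set (E d)) where
  elems : Finset (Set (E d))
  faces : Finset (Set (E d))
  normal : Set (E d) → E d
  elem_polytope : ∀ T ∈ elems, IsPolytope d T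
  cover : ⋃ T ∈ elems, T = closure Ω
  elem_disjoint : ∀ T ∈ elems, ∀ T' ∈ elems, T ≠ T' → Disjoint (interior T) (interior T')
  face_polytope : ∀ e ∈ faces, IsPolytope (d - 1) e
  normal_unit : ∀ e ∈ faces, ‖normal e‖ = 1
  normal_orth : ∀ e ∈ faces, ∀ x ∈ e, ∀ y ∈ e, inner ℝ (normal e) (x - y) = 0
  face_bdry : ∀ e ∈ faces, ∃ T ∈ elems, e ⊆ frontier T
  face_disjoint : ∀ e ∈ faces, ∀ e' ∈ faces, e ≠ e' → surf e e' = 0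
  bdry_faces : ∀ T ∈ elems, ∀ x ∈ frontier T, ∃ e ∈ faces, e ⊆ frontier T ∧ x ∈ e
  /-- an element lies on one and the same side of each of its faces -/
  one_sided : ∀ T ∈ elems, ∀ e ∈ faces, e ⊆ frontier T →
    (∀ᵐ x ∂(surf e), LiesBehind T (normal e) x) ∨ (∀ᵐ x ∂(surf e), LiesBehind T (-normal e) x)

namespace PolytopalMesh

variable {d : ℕ} {Ω : Set (E d)}

open Classical in
/-- The faces of the element `T`. -/
def facesOf (M : PolytopalMesh d Ω) (T : Set (E d)) : Finset (Set (E d)) :=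
  M.faces.filter fun e => e ⊆ frontier T

open Classical in
/-- The unit normal `n` to the face `e` of `T` that points out of `T`; it is `n_e` or `-n_e`. -/
def outward (M : PolytopalMesh d Ω) (T e : Set (E d)) : E d :=
  if ∀ᵐ x ∂(surf e), LiesBehind T (M.normal e) x then M.normal e else -M.normal e

/-- Shape regularity, with constants `ρv, ρe, κ, σ`: volume of elements and area of faces
comparable with powers of their diameters; diameters of the faces of `T` comparable with `h_T`; each
face `e` of `T` is the base of a pyramid inside `T`, of height at least `σ h_T`, that stands up above
`e` (as its height is at least `σ h_T` and its edges are not longer than `h_T`, the angle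
between `x - A` and the outward normal is at most `arccos σ` for all `x` in `e`). -/
structure ShapeRegular (M : PolytopalMesh d Ω) (ρv ρe κ σ : ℝ) : Prop where
  volume_elem : ∀ T ∈ M.elems, ρv * Metric.diam T ^ d ≤ volume.real T
  area_face : ∀ e ∈ M.faces, ρe * Metric.diam e ^ (d - 1) ≤ (surf e).real e
  diam_face : ∀ T ∈ M.elems, ∀ e ∈ M.facesOf T, κ * Metric.diam T ≤ Metric.diam e
  pyramid : ∀ T ∈ M.elems, ∀ e ∈ M.facesOf T, ∃ A ∈ T, ∀ x ∈ e,
    segment ℝ A x ⊆ T ∧ σ * Metric.diam T ≤ inner ℝ (x - A) (M.outward T e)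

/-- No element has more than `N` faces. -/
def FacesLE (M : PolytopalMesh d Ω) (N : ℕ) : Prop :=
  ∀ T ∈ M.elems, (M.facesOf T).card ≤ N

/-- For any two faces `e ≠ e'` of an element `T`, some point of `e` has distance at least `δ h_T`
from the hyperplane that contains `e'`; in particular these hyperplanes are distinct. -/
def FacesSeparated (M : PolytopalMesh d Ω) (δ : ℝ) : Prop :=
  ∀ T ∈ M.elems, ∀ e ∈ M.facesOf T, ∀ e' ∈ M.facesOf T, e ≠ e' →
    ∃ x ∈ e, ∀ y ∈ e', δ * Metric.diam T ≤ |inner ℝ (M.normal e') (x - y)|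

/-- Each face of an element `T` contains a `(d-1)`-dimensional ball of radius `τ h_T`. -/
def FacesContainBall (M : PolytopalMesh d Ω) (τ : ℝ) : Prop :=
  ∀ T ∈ M.elems, ∀ e ∈ M.facesOf T, ∃ x ∈ e, ∀ y : E d,
    inner ℝ (M.normal e) (y - x) = 0 → ‖y - x‖ ≤ τ * Metric.diam T → y ∈ e

end PolytopalMesh

/-! ### Polynomials -/

/-- Value of the polynomial `P` at the point `x`. -/
def val {d : ℕ} (P : Poly d) (x : E d) : ℝ := MvPolynomial.eval (fun i => x i) P

/-- Gradient of the polynomial `P` at the point `x`. -/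
def grad {d : ℕ} (P : Poly d) (x : E d) : E d :=
  WithLp.toLp 2 fun i => val (MvPolynomial.pderiv i P) x

/-- Laplacian of the polynomial `P`. -/
def lap {d : ℕ} (P : Poly d) : Poly d :=
  ∑ i, MvPolynomial.pderiv i (MvPolynomial.pderiv i P)

/-- The norm of `L²(μ)`. -/
def normL2 {d : ℕ} (μ : Measure (E d)) (f : E d → ℝ) : ℝ := Real.sqrt (∫ x, f x ^ 2 ∂μ)

/-! ### Weak functions and the discrete weak Laplacian -/

/-- The weak finite element space `V_h` of weak functions `v = {v_0, v_b, v_n n_e}` with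
`v_0 ∈ P_k(T)` on each element `T` and single-valued `v_b ∈ P_p(e)`, `v_n ∈ P_q(e)` on each face `e`.
Polynomials on `e` are given as restrictions of polynomials in `d` variables; only the restrictions
of `vb e` and `vn e` to `e` enter the definitions below. -/
structure WeakSpace {d : ℕ} {Ω : Set (E d)} (M : PolytopalMesh d Ω) (k p q : ℕ) where
  v0 : Set (E d) → Poly d
  vb : Set (E d) → Poly d
  vn : Set (E d) → Poly d
  degree_v0 : ∀ T ∈ M.elems, (v0 T).totalDegree ≤ k
  degree_vb : ∀ e ∈ M.faces, (vb e).totalDegree ≤ p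
  degree_vn : ∀ e ∈ M.faces, (vn e).totalDegree ≤ q

namespace WeakSpace

variable {d : ℕ} {Ω : Set (E d)} {M : PolytopalMesh d Ω} {k p q : ℕ}

/-- `(v_0, Δφ)_T - ⟨v_b, ∇φ·n⟩_{∂T} + ⟨v_n n_e·n, φ⟩_{∂T}`. -/
def lapForm (v : WeakSpace M k p q) (T : Set (E d)) (φ : Poly d) : ℝ :=
  (∫ x in T, val (v.v0 T) x * val (lap φ) x)
    - (∑ e ∈ M.facesOf T, ∫ x, val (v.vb e) x * inner ℝ (grad φ x) (M.outward T e) ∂(surf e))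
    + ∑ e ∈ M.facesOf T,
        ∫ x, val (v.vn e) x * inner ℝ (M.normal e) (M.outward T e) * val φ x ∂(surf e)

/-- `g ∈ P_r(T)` and `(g, φ)_T = (v_0, Δφ)_T - ⟨v_b, ∇φ·n⟩_{∂T} + ⟨v_n n_e·n, φ⟩_{∂T}` for all
`φ ∈ P_r(T)`. -/
def IsWeakLap (v : WeakSpace M k p q) (r : ℕ) (T : Set (E d)) (g : Poly d) : Prop :=
  g.totalDegree ≤ r ∧
    ∀ φ : Poly d, φ.totalDegree ≤ r → ∫ x in T, val g x * val φ x = v.lapForm T φ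

/-- The discrete weak Laplacian `Δ_{w,r,T} v`: the unique polynomial with the property `IsWeakLap`
(see `existsUnique_isWeakLap`). -/
def weakLap (v : WeakSpace M k p q) (r : ℕ) (T : Set (E d)) : Poly d :=
  Classical.epsilon fun g => v.IsWeakLap r T g

/-- The energy norm `|||v||| = (Δ_w v, Δ_w v)^{1/2}`. -/
def energyNorm (v : WeakSpace M k p q) (r : ℕ) : ℝ :=
  Real.sqrt (∑ T ∈ M.elems, ∫ x in T, val (v.weakLap r T) x ^ 2)

/-- The discrete `H²` seminorm `‖v‖_{2,h}`. -/
def h2Norm (v : WeakSpace M k p q) : ℝ :=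
  Real.sqrt (∑ T ∈ M.elems,
    ((∫ x in T, val (lap (v.v0 T)) x ^ 2)
      + (Metric.diam T ^ 3)⁻¹ *
          ∑ e ∈ M.facesOf T, ∫ x, (val (v.v0 T) x - val (v.vb e) x) ^ 2 ∂(surf e)
      + (Metric.diam T)⁻¹ *
          ∑ e ∈ M.facesOf T, ∫ x,
            (inner ℝ (grad (v.v0 T) x - val (v.vn e) x • M.normal e) (M.outward T e)) ^ 2
              ∂(surf e)))

end WeakSpace

/-! ### Elementary facts: the discrete weak Laplacian is well defined -/

section WellDefined

variable {d : ℕ}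

lemma continuous_val (P : Poly d) : Continuous (val P) := by
  unfold val
  exact (MvPolynomial.continuous_eval P).comp (by fun_prop)

lemma continuous_grad (P : Poly d) : Continuous (grad P) := by
  unfold grad
  exact (PiLp.continuous_toLp 2 _).comp (continuous_pi fun i => continuous_val _)

lemma IsPolytope.isCompact {m : ℕ} {P : Set (E d)} (hP : IsPolytope m P) : IsCompact P := by
  obtain ⟨S, -, rfl⟩ := hP.exists_pieces
  exact S.isCompact_biUnion fun s _ => s.finite_toSet.isCompact_convexHull (𝕜 := ℝ)

lemma IsPolytope.interior_nonempty {P : Set (E d)} (hP : IsPolytope d P) :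
    (interior P).Nonempty := by
  have hne : P.Nonempty := hP.connected.nonempty.mono intrinsicInterior_subset
  obtain ⟨S, hS, hPS⟩ := hP.exists_pieces
  obtain ⟨x, hx⟩ := hne
  have hx' := hx
  rw [hPS] at hx'
  simp only [Set.mem_iUnion] at hx'
  obtain ⟨s, hs, hxs⟩ := hx'
  have hsub : convexHull ℝ (s : Set (E d)) ⊆ P := by
    rw [hPS]
    exact Set.subset_biUnion_of_mem (u := fun s : Finset (E d) =>
      (convexHull ℝ (s : Set (E d)) : Set (E d))) hs
  refine Set.Nonempty.mono (interior_mono hsub) ?_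
  rw [interior_convexHull_nonempty_iff_affineSpan_eq_top]
  have hsne : (s : Set (E d)).Nonempty := convexHull_nonempty_iff.1 ⟨x, hxs⟩
  rw [← AffineSubspace.direction_eq_top_iff_of_nonempty
    ((affineSpan_nonempty ℝ).2 hsne), direction_affineSpan]
  exact Submodule.eq_top_of_finrank_eq (by rw [hS s hs]; simp)

/-- A polynomial that vanishes on a nonempty open set is zero. -/
lemma eq_zero_of_val_eq_zero {P : Poly d} {U : Set (E d)} (hU : IsOpen U) (hne : U.Nonempty)
    (h : ∀ x ∈ U, val P x = 0) : P = 0 := by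
  obtain ⟨x, hx⟩ := hne
  have hV : IsOpen ((fun y : Fin d → ℝ => (WithLp.toLp 2 y : E d)) ⁻¹' U) :=
    hU.preimage (PiLp.continuous_toLp 2 _)
  obtain ⟨ε, hε, hball⟩ := Metric.isOpen_iff.1 hV (fun i => x i) (by simpa using hx)
  refine MvPolynomial.funext_set (fun i => Metric.ball (x i) ε) (fun i => ?_) fun y hy => ?_
  · rw [Real.ball_eq_Ioo]
    exact Set.Ioo_infinite (by linarith)
  · have hy' : y ∈ Metric.ball (fun i => x i) ε := by
      rw [ball_pi _ hε]; exact hy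
    simpa [val] using h _ (hball hy')

lemma integrableOn_of_continuous {f : E d → ℝ} (hf : Continuous f) {T : Set (E d)}
    (hT : IsCompact T) : IntegrableOn f T := hf.continuousOn.integrableOn_compact hT

/-- Bounded parts of hyperplanes have finite surface measure. -/
lemma IsPolytope.surf_lt_top {m : ℕ} {P : Set (E d)} (hP : IsPolytope m P) :
    μHE[m] P < ⊤ := by
  obtain ⟨x, hx⟩ := hP.connected.nonempty.mono intrinsicInterior_subset
  have hsub : P ⊆ (affineSpan ℝ P : Set (E d)) := subset_affineSpan ℝ P
  set s := affineSpan ℝ P with hs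
  have hxs : x ∈ s := hsub hx
  have : Nonempty s := ⟨⟨x, hxs⟩⟩
  have himg : ((Subtype.val : s → E d) '' ((Subtype.val : s → E d) ⁻¹' P)) = P := by
    rw [Set.image_preimage_eq_inter_range]
    refine Set.inter_eq_left.2 fun y hy => ⟨⟨y, hsub hy⟩, rfl⟩
  have hcl : IsClosed (s : Set (E d)) := s.closed_of_finiteDimensional
  have hcomp : IsCompact ((Subtype.val : s → E d) ⁻¹' P) :=
    hcl.isClosedEmbedding_subtypeVal.isCompact_preimage hP.isCompact
  have hm : m = Module.finrank ℝ s.direction := by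
    rw [hs, direction_affineSpan, hP.finrank_eq]
  rw [← himg, AffineSubspace.euclideanHausdorffMeasure_coe_image, hm,
    EuclideanGeometry.euclideanHausdorffMeasure_eq (⟨x, hxs⟩ : s)]
  rw [show (Measure.map (IsometryEquiv.vaddConst (⟨x, hxs⟩ : s)) volume : Measure s)
    = Measure.map (IsometryEquiv.vaddConst (⟨x, hxs⟩ : s)).toHomeomorph.toMeasurableEquiv volume
    from rfl, MeasurableEquiv.map_apply]
  exact ((IsometryEquiv.vaddConst (⟨x, hxs⟩ : s)).toHomeomorph.isCompact_preimage.2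
    hcomp).measure_lt_top

lemma integrable_surf {e : Set (E d)} (he : IsPolytope (d - 1) e) {f : E d → ℝ}
    (hf : Continuous f) : Integrable f (surf e) := by
  obtain ⟨B, hB⟩ := he.isCompact.exists_bound_of_continuousOn hf.continuousOn
  exact Measure.integrableOn_of_bounded he.surf_lt_top.ne hf.aestronglyMeasurable
    (ae_restrict_of_forall_mem he.isCompact.measurableSet hB)

lemma eq_zero_of_integral_sq {T : Set (E d)} (hT : IsPolytope d T) {P : Poly d}
    (h : ∫ x in T, val P x * val P x = 0) : P = 0 := by
  refine eq_zero_of_val_eq_zero isOpen_interior hT.interior_nonempty fun x hx => ?_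
  have hc : Continuous fun x => val P x * val P x := (continuous_val P).mul (continuous_val P)
  have h0 := (setIntegral_eq_zero_iff_of_nonneg_ae
    (Eventually.of_forall fun x => mul_self_nonneg (val P x))
    (integrableOn_of_continuous hc hT.isCompact)).1 h
  have h1 : (fun x => val P x * val P x) =ᵐ[volume.restrict (interior T)] fun _ => 0 :=
    ae_restrict_of_ae_restrict_of_subset interior_subset h0
  have h2 := Measure.eqOn_open_of_ae_eq h1 isOpen_interior hc.continuousOn continuousOn_const
  exact mul_self_eq_zero.1 (h2 hx)

lemma val_add (P Q : Poly d) (x : E d) : val (P + Q) x = val P x + val Q x := by simp [val]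

lemma val_smul (c : ℝ) (P : Poly d) (x : E d) : val (c • P) x = c * val P x := by
  simp [val, MvPolynomial.smul_eval]

lemma grad_add (P Q : Poly d) (x : E d) : grad (P + Q) x = grad P x + grad Q x := by
  ext i; simp [grad, val_add]

lemma grad_smul (c : ℝ) (P : Poly d) (x : E d) : grad (c • P) x = c • grad P x := by
  ext i; simp [grad, val_smul]

lemma lap_add (P Q : Poly d) : lap (P + Q) = lap P + lap Q := by
  simp [lap, Finset.sum_add_distrib]

lemma lap_smul (c : ℝ) (P : Poly d) : lap (c • P) = c • lap P := by
  simp [lap, Finset.smul_sum]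

variable {Ω : Set (E d)} {M : PolytopalMesh d Ω} {k p q : ℕ}

lemma lapForm_add (v : WeakSpace M k p q) {T : Set (E d)} (hT : T ∈ M.elems) (φ ψ : Poly d) :
    v.lapForm T (φ + ψ) = v.lapForm T φ + v.lapForm T ψ := by
  have hc := (M.elem_polytope T hT).isCompact
  have hf : ∀ e ∈ M.facesOf T, IsPolytope (d - 1) e := fun e he =>
    M.face_polytope e (by
      classical
      exact (Finset.mem_filter.1 he).1)
  have h1 : ∀ χ : Poly d, IntegrableOn (fun x => val (v.v0 T) x * val (lap χ) x) T := fun χ =>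
    integrableOn_of_continuous ((continuous_val _).mul (continuous_val _)) hc
  have h2 : ∀ χ : Poly d, ∀ e ∈ M.facesOf T, Integrable
      (fun x => val (v.vb e) x * inner ℝ (grad χ x) (M.outward T e)) (surf e) := fun χ e he =>
    integrable_surf (hf e he)
      ((continuous_val _).mul ((continuous_grad χ).inner continuous_const))
  have h3 : ∀ χ : Poly d, ∀ e ∈ M.facesOf T, Integrable
      (fun x => val (v.vn e) x * inner ℝ (M.normal e) (M.outward T e) * val χ x) (surf e) :=
    fun χ e he => integrable_surf (hf e he)
      (((continuous_val _).mul continuous_const).mul (continuous_val _))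
  have e1 : ∫ x in T, val (v.v0 T) x * val (lap (φ + ψ)) x
      = (∫ x in T, val (v.v0 T) x * val (lap φ) x)
        + ∫ x in T, val (v.v0 T) x * val (lap ψ) x := by
    rw [← integral_add (h1 φ) (h1 ψ)]
    simp only [lap_add, val_add, mul_add]
  have e2 : ∑ e ∈ M.facesOf T,
        ∫ x, val (v.vb e) x * inner ℝ (grad (φ + ψ) x) (M.outward T e) ∂(surf e)
      = (∑ e ∈ M.facesOf T, ∫ x, val (v.vb e) x * inner ℝ (grad φ x) (M.outward T e) ∂(surf e))
        + ∑ e ∈ M.facesOf T,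
            ∫ x, val (v.vb e) x * inner ℝ (grad ψ x) (M.outward T e) ∂(surf e) := by
    rw [← Finset.sum_add_distrib]
    refine Finset.sum_congr rfl fun e he => ?_
    rw [← integral_add (h2 φ e he) (h2 ψ e he)]
    simp only [grad_add, inner_add_left, mul_add]
  have e3 : ∑ e ∈ M.facesOf T, ∫ x, val (v.vn e) x * inner ℝ (M.normal e) (M.outward T e)
          * val (φ + ψ) x ∂(surf e)
      = (∑ e ∈ M.facesOf T, ∫ x, val (v.vn e) x * inner ℝ (M.normal e) (M.outward T e)
          * val φ x ∂(surf e))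
        + ∑ e ∈ M.facesOf T, ∫ x, val (v.vn e) x * inner ℝ (M.normal e) (M.outward T e)
          * val ψ x ∂(surf e) := by
    rw [← Finset.sum_add_distrib]
    refine Finset.sum_congr rfl fun e he => ?_
    rw [← integral_add (h3 φ e he) (h3 ψ e he)]
    simp only [val_add, mul_add]
  simp only [WeakSpace.lapForm]
  rw [e1, e2, e3]
  ring

lemma lapForm_smul (v : WeakSpace M k p q) (T : Set (E d)) (c : ℝ) (φ : Poly d) :
    v.lapForm T (c • φ) = c * v.lapForm T φ := by
  have e1 : ∫ x in T, val (v.v0 T) x * val (lap (c • φ)) x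
      = c * ∫ x in T, val (v.v0 T) x * val (lap φ) x := by
    rw [← integral_const_mul]
    simp only [lap_smul, val_smul, mul_left_comm]
  have e2 : ∑ e ∈ M.facesOf T,
        ∫ x, val (v.vb e) x * inner ℝ (grad (c • φ) x) (M.outward T e) ∂(surf e)
      = c * ∑ e ∈ M.facesOf T,
          ∫ x, val (v.vb e) x * inner ℝ (grad φ x) (M.outward T e) ∂(surf e) := by
    rw [Finset.mul_sum]
    refine Finset.sum_congr rfl fun e _ => ?_
    rw [← integral_const_mul]
    simp only [grad_smul, real_inner_smul_left, mul_left_comm]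
  have e3 : ∑ e ∈ M.facesOf T, ∫ x, val (v.vn e) x * inner ℝ (M.normal e) (M.outward T e)
          * val (c • φ) x ∂(surf e)
      = c * ∑ e ∈ M.facesOf T, ∫ x, val (v.vn e) x * inner ℝ (M.normal e) (M.outward T e)
          * val φ x ∂(surf e) := by
    rw [Finset.mul_sum]
    refine Finset.sum_congr rfl fun e _ => ?_
    rw [← integral_const_mul]
    simp only [val_smul, mul_left_comm]
  simp only [WeakSpace.lapForm]
  rw [e1, e2, e3]
  ring

/-- The discrete weak Laplacian exists and is unique. -/
theorem existsUnique_isWeakLap (v : WeakSpace M k p q) (r : ℕ) {T : Set (E d)}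
    (hT : T ∈ M.elems) : ∃! g : Poly d, v.IsWeakLap r T g := by
  have hP := M.elem_polytope T hT
  have hint : ∀ f g : Poly d, IntegrableOn (fun x => val f x * val g x) T := fun f g =>
    integrableOn_of_continuous ((continuous_val f).mul (continuous_val g)) hP.isCompact
  let W := MvPolynomial.restrictTotalDegree (Fin d) ℝ r
  let B : W →ₗ[ℝ] Module.Dual ℝ W := LinearMap.mk₂ ℝ
    (fun f g => ∫ x in T, val (f : Poly d) x * val (g : Poly d) x)
    (fun f f' g => by
      rw [← integral_add (hint _ _) (hint _ _)]
      simp only [Submodule.coe_add, val_add, add_mul])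
    (fun c f g => by
      rw [smul_eq_mul, ← integral_const_mul]
      simp only [Submodule.coe_smul, val_smul, mul_assoc])
    (fun f g g' => by
      rw [← integral_add (hint _ _) (hint _ _)]
      simp only [Submodule.coe_add, val_add, mul_add])
    (fun c f g => by
      rw [smul_eq_mul, ← integral_const_mul]
      simp only [Submodule.coe_smul, val_smul, mul_left_comm])
  have hB : ∀ f g : W, B f g = ∫ x in T, val (f : Poly d) x * val (g : Poly d) x :=
    fun f g => rfl
  have hinj : Function.Injective B := by
    rw [← LinearMap.ker_eq_bot, LinearMap.ker_eq_bot']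
    intro f hf
    exact Subtype.ext (eq_zero_of_integral_sq hP (by rw [← hB, hf]; rfl))
  have hsurj : Function.Surjective B :=
    (LinearMap.injective_iff_surjective_of_finrank_eq_finrank
      (Subspace.dual_finrank_eq (K := ℝ) (V := W)).symm).1 hinj
  let L : Module.Dual ℝ W :=
    { toFun := fun φ => v.lapForm T (φ : Poly d)
      map_add' := fun φ ψ => lapForm_add v hT _ _
      map_smul' := fun c φ => lapForm_smul v T c _ }
  obtain ⟨g, hg⟩ := hsurj L
  refine ⟨g, ⟨(MvPolynomial.mem_restrictTotalDegree _ _ _).1 g.2, fun φ hφ => ?_⟩, ?_⟩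
  · exact DFunLike.congr_fun hg
      (⟨φ, (MvPolynomial.mem_restrictTotalDegree _ _ _).2 hφ⟩ : W)
  · rintro g' ⟨hg'd, hg'⟩
    let g'' : W := ⟨g', (MvPolynomial.mem_restrictTotalDegree _ _ _).2 hg'd⟩
    have : g'' = g := hinj (by
      rw [hg]
      ext φ
      exact hg' φ ((MvPolynomial.mem_restrictTotalDegree _ _ _).1 φ.2))
    exact congrArg Subtype.val this

/-- `weakLap` has the defining property of the discrete weak Laplacian. -/
theorem weakLap_spec (v : WeakSpace M k p q) (r : ℕ) {T : Set (E d)} (hT : T ∈ M.elems) :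
    v.IsWeakLap r T (v.weakLap r T) :=
  Classical.epsilon_spec (existsUnique_isWeakLap v r hT).exists

end WellDefined

end WGBiharmonic

end

open WGBiharmonic

noncomputable section

namespace WGBiharmonic

/-! ### Calculus of polynomials -/

section PolynomialCalculus

variable {d m : ℕ}

/-! Green's formula on one element `T` turns the definition of the weak Laplacian `w = Δ_w v` into
`(w, φ)_T = (Δv₀, φ)_T + ⟨v₀ - v_b, ∇φ·n⟩_∂T - ⟨(∇v₀ - v_n n_e)·n, φ⟩_∂T` for all `φ` of degree at
most `r` (`WeakSpace.lapForm_eq`, `WeakSpace.represents`). Thus `w` encodes `Δv₀` and the two jumps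
on every face, and the task is to recover each of them by a suitable test function. The whole
question is local; the global norms are sums over elements (`WeakSpace.norms_equiv`).

Part 1: take `φ = (∏ λ_e²) Δv₀`, where `λ_e = 0` is the hyperplane of the face `e`. Both `φ` and
`∇φ` vanish on the boundary, so only `(w, φ) = (Δv₀, φ)` remains (`exists_volume_bound`).

Jumps: suppose that a polynomial `ψ` is substantial on `e` and is, with its gradient, small on the
other faces (`IsLocalizer`). The test function `λ_e a ψ` vanishes on `e` but has normal derivative
`a ψ / h` there, hence isolates the jump `a` of the values; then `b ψ` isolates the jump `b` of the
fluxes. The jumps on other faces enter with the small factor `η` and are absorbed after summation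
over the faces (`exists_localizer_bound`). In part 2, `ψ` is the product of the `λ_{e'}²` over the
other faces (`exists_separated_localizer`), which is exactly zero on them. In part 3 hyperplanes may
coincide, so `ψ` is instead a high power of a quadratic polynomial that peaks at the centre of a
disc in `e` (`exists_peak_localizer`); its degree makes `r₀` large. It works because the other faces
stay away from that centre by a fixed fraction of `h_T` (`exists_flat_radius`): behind the disc lies
the pyramid inside `T`, and in front of it lies either the pyramid of a neighbour or, by the
Lipschitz property, the exterior of `Ω`.

The upper bound follows from the test function `w` itself (`exists_upper_bound`).

Constants must not depend on the shapes of the elements. This rests on a compactness argument in the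
space of coefficients (`volume_sublevel_le`): a polynomial of bounded degree is small only on a
small part of a ball. Hence every subset of the ball with a fixed share of its volume controls all
values in the ball (`integral_prod_sq_ge`), and only diameters and measures of elements and faces
matter. The divergence theorem for nonconvex polytopes is obtained by writing the indicator of `T`
as a signed sum of indicators of shadows of its faces (`IsFlatBoundary.ae_indicator_eq`). -/

lemma val_mul (P Q : Poly d) (x : E d) : val (P * Q) x = val P x * val Q x := by simp [val]

lemma val_sub (P Q : Poly d) (x : E d) : val (P - Q) x = val P x - val Q x := by simp [val]

lemma val_pow (P : Poly d) (n : ℕ) (x : E d) : val (P ^ n) x = val P x ^ n := by simp [val]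

lemma val_C (c : ℝ) (x : E d) : val (MvPolynomial.C c : Poly d) x = c := by simp [val]

lemma val_sum {ι : Type*} (s : Finset ι) (P : ι → Poly d) (x : E d) :
    val (∑ i ∈ s, P i) x = ∑ i ∈ s, val (P i) x := by simp [val]

lemma val_prod {ι : Type*} (s : Finset ι) (P : ι → Poly d) (x : E d) :
    val (∏ i ∈ s, P i) x = ∏ i ∈ s, val (P i) x := by simp [val, map_prod]

lemma grad_apply (P : Poly d) (x : E d) (i : Fin d) :
    grad P x i = val (MvPolynomial.pderiv i P) x := rfl

lemma grad_mul (P Q : Poly d) (x : E d) :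
    grad (P * Q) x = val Q x • grad P x + val P x • grad Q x := by
  ext i
  simp only [grad_apply, PiLp.add_apply, PiLp.smul_apply, smul_eq_mul, MvPolynomial.pderiv_mul,
    val_add, val_mul]
  ring

lemma grad_sub (P Q : Poly d) (x : E d) : grad (P - Q) x = grad P x - grad Q x := by
  ext i; simp [grad_apply, val_sub]

lemma grad_C (c : ℝ) (x : E d) : grad (MvPolynomial.C c : Poly d) x = 0 := by
  ext i; simp [grad_apply, val]

lemma grad_pow (P : Poly d) (n : ℕ) (x : E d) :
    grad (P ^ n) x = (n * val P x ^ (n - 1)) • grad P x := by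
  ext i
  simp only [grad_apply, PiLp.smul_apply, smul_eq_mul, MvPolynomial.pderiv_pow, val_mul, val_pow]
  simp [val]

lemma inner_grad (P : Poly d) (x u : E d) :
    inner ℝ (grad P x) u = ∑ i, val (MvPolynomial.pderiv i P) x * u i := by
  simp [PiLp.inner_apply, grad_apply, mul_comm]

/-- The bridge between formal partial derivatives and analysis; it supplies the chain rule for
`compAffine` and the derivative in the divergence theorem. -/
lemma hasFDerivAt_val (P : Poly d) (x : E d) :
    HasFDerivAt (val P) (innerSL ℝ (grad P x)) x := by
  induction P using MvPolynomial.induction_on with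
  | C a =>
    have h : val (MvPolynomial.C a : Poly d) = fun _ => a := funext (val_C a)
    rw [h, grad_C]
    simpa using hasFDerivAt_const a x
  | add p q hp hq =>
    have h : val (p + q) = val p + val q := funext (val_add p q)
    rw [h, grad_add, map_add]
    exact hp.add hq
  | mul_X p i hp =>
    have hX : HasFDerivAt (val (MvPolynomial.X i : Poly d))
        (innerSL ℝ (grad (MvPolynomial.X i : Poly d) x)) x := by
      have h1 : val (MvPolynomial.X i : Poly d) = fun y : E d => (EuclideanSpace.proj i : E d →L[ℝ] ℝ) y := by
        ext y; simp [val]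
      have h2 : innerSL ℝ (grad (MvPolynomial.X i : Poly d) x) = (EuclideanSpace.proj i : E d →L[ℝ] ℝ) := by
        ext y
        simp [inner_grad, val, MvPolynomial.pderiv_X, Pi.single_apply, apply_ite]
      rw [h1, h2]
      exact (EuclideanSpace.proj i : E d →L[ℝ] ℝ).hasFDerivAt
    have h : val (p * MvPolynomial.X i) = val p * val (MvPolynomial.X i) := funext (val_mul p _)
    rw [h, grad_mul, map_add, map_smul, map_smul, add_comm]
    exact hp.mul hX

lemma totalDegree_pderiv_le (P : Poly d) (i : Fin d) :
    (MvPolynomial.pderiv i P).totalDegree ≤ P.totalDegree - 1 := by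
  refine Finset.sup_le fun s hs => ?_
  have h : MvPolynomial.coeff (s + Finsupp.single i 1) P ≠ 0 := by
    intro h0
    rw [MvPolynomial.mem_support_iff, MvPolynomial.coeff_pderiv, h0] at hs
    simp at hs
  have h1 := MvPolynomial.le_totalDegree (MvPolynomial.mem_support_iff.2 h)
  rw [Finsupp.sum_add_index' (by simp) (by simp), Finsupp.sum_single_index rfl] at h1
  omega

lemma totalDegree_lap_le (P : Poly d) : (lap P).totalDegree ≤ P.totalDegree - 2 := by
  refine MvPolynomial.totalDegree_finsetSum_le fun i _ => ?_
  have h1 := totalDegree_pderiv_le (MvPolynomial.pderiv i P) i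
  have h2 := totalDegree_pderiv_le P i
  omega

/-- The polynomial `y ↦ P (z + J y)`. -/
def compAffine (P : Poly d) (z : E d) (J : E m →L[ℝ] E d) : Poly m :=
  MvPolynomial.aeval (fun i => MvPolynomial.C (z i) +
    ∑ j, MvPolynomial.C (J (EuclideanSpace.single j 1) i) * MvPolynomial.X j) P

lemma val_compAffine (P : Poly d) (z : E d) (J : E m →L[ℝ] E d) (y : E m) :
    val (compAffine P z J) y = val P (z + J y) := by
  have hJ : J y = ∑ j, y j • J (EuclideanSpace.single j 1) := by
    conv_lhs => rw [← (EuclideanSpace.basisFun (Fin m) ℝ).sum_repr y]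
    simp
  unfold val compAffine
  rw [MvPolynomial.map_aeval, MvPolynomial.eval, MvPolynomial.coe_eval₂Hom,
    MvPolynomial.coe_eval₂Hom]
  congr 1
  · ext; simp
  · ext i
    simp [hJ, mul_comm]

lemma totalDegree_compAffine_le (P : Poly d) (z : E d) (J : E m →L[ℝ] E d) :
    (compAffine P z J).totalDegree ≤ P.totalDegree := by
  unfold compAffine
  rw [MvPolynomial.aeval_def, MvPolynomial.eval₂_eq]
  refine MvPolynomial.totalDegree_finsetSum_le fun s hs => ?_
  refine (MvPolynomial.totalDegree_mul _ _).trans ?_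
  rw [MvPolynomial.algebraMap_eq, MvPolynomial.totalDegree_C, zero_add]
  refine (MvPolynomial.totalDegree_finsetProd _ _).trans ?_
  refine le_trans (Finset.sum_le_sum fun i _ => ?_) (MvPolynomial.le_totalDegree hs)
  refine (MvPolynomial.totalDegree_pow _ _).trans ?_
  refine (Nat.mul_le_mul_left _ (?_ : _ ≤ 1)).trans (by simp)
  refine (MvPolynomial.totalDegree_add _ _).trans (max_le (by simp) ?_)
  refine MvPolynomial.totalDegree_finsetSum_le fun j _ => ?_
  refine (MvPolynomial.totalDegree_mul _ _).trans ?_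
  simp [MvPolynomial.totalDegree_X]

lemma inner_grad_compAffine (P : Poly d) (z : E d) (J : E m →L[ℝ] E d) (y u : E m) :
    inner ℝ (grad (compAffine P z J) y) u = inner ℝ (grad P (z + J y)) (J u) := by
  have h1 := hasFDerivAt_val (compAffine P z J) y
  have h2 : HasFDerivAt (fun y => val P (z + J y)) ((innerSL ℝ (grad P (z + J y))).comp J) y :=
    HasFDerivAt.comp y (hasFDerivAt_val P _) (J.hasFDerivAt.const_add z)
  have h3 : val (compAffine P z J) = fun y => val P (z + J y) :=
    funext fun y => val_compAffine P z J y
  rw [h3] at h1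
  simpa using DFunLike.congr_fun (h1.unique h2) u

/-- The affine function `x ↦ ⟪n, x⟫ + c`. -/
def affPoly (n : E d) (c : ℝ) : Poly d :=
  MvPolynomial.C c + ∑ i, MvPolynomial.C (n i) * MvPolynomial.X i

lemma val_affPoly (n : E d) (c : ℝ) (x : E d) : val (affPoly n c) x = inner ℝ n x + c := by
  simp [affPoly, val, PiLp.inner_apply, add_comm, mul_comm]

lemma grad_affPoly (n : E d) (c : ℝ) (x : E d) : grad (affPoly n c) x = n := by
  ext i
  simp [affPoly, grad_apply, val, MvPolynomial.pderiv_X, Pi.single_apply, apply_ite]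

lemma totalDegree_affPoly_le (n : E d) (c : ℝ) : (affPoly n c).totalDegree ≤ 1 := by
  refine (MvPolynomial.totalDegree_add _ _).trans (max_le (by simp) ?_)
  refine MvPolynomial.totalDegree_finsetSum_le fun j _ => ?_
  refine (MvPolynomial.totalDegree_mul _ _).trans ?_
  simp [MvPolynomial.totalDegree_X]

/-- The polynomial `x ↦ ‖x - z‖ ^ 2`. -/
def distSqPoly (z : E d) : Poly d := ∑ i, (MvPolynomial.X i - MvPolynomial.C (z i)) ^ 2

lemma val_distSqPoly (z x : E d) : val (distSqPoly z) x = ‖x - z‖ ^ 2 := by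
  simp [distSqPoly, val, EuclideanSpace.norm_sq_eq]

lemma grad_distSqPoly (z x : E d) : grad (distSqPoly z) x = (2 : ℝ) • (x - z) := by
  ext i
  simp [distSqPoly, grad_apply, val, MvPolynomial.pderiv_X,
    Pi.single_apply, apply_ite]

lemma totalDegree_distSqPoly_le (z : E d) : (distSqPoly z).totalDegree ≤ 2 := by
  refine MvPolynomial.totalDegree_finsetSum_le fun i _ => ?_
  refine (MvPolynomial.totalDegree_pow _ _).trans ?_
  have h : (MvPolynomial.X i - MvPolynomial.C (z i) : Poly d).totalDegree ≤ 1 :=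
    (MvPolynomial.totalDegree_sub _ _).trans (by simp)
  omega

/-- Fix `y` with `P y ≠ 0`. On each line through `y` the polynomial is a nonzero polynomial in one
variable and has finitely many roots, so the pairs `(t, x)` with `P (y + t x) = 0` form a null set
by Fubini. A single `t ≠ 0` with a null slice suffices, since that slice is an affine image of the
zero set. -/
lemma volume_zeros_eq_zero {P : Poly d} (hP : P ≠ 0) : volume {x : E d | val P x = 0} = 0 := by
  obtain ⟨y, hy⟩ : ∃ y : E d, val P y ≠ 0 := by
    by_contra! h
    exact hP (eq_zero_of_val_eq_zero isOpen_univ Set.univ_nonempty fun x _ => h x)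
  set Z : Set (ℝ × E d) := {z | val P (y + z.1 • z.2) = 0} with hZ
  have hZm : MeasurableSet Z := by
    refine IsClosed.measurableSet (isClosed_eq ((continuous_val P).comp ?_) continuous_const)
    fun_prop
  have h1 : (volume : Measure (ℝ × E d)) Z = 0 := by
    rw [Measure.volume_eq_prod, Measure.prod_apply_symm hZm]
    refine (lintegral_eq_zero_iff (measurable_measure_prodMk_right hZm)).2
      (Eventually.of_forall fun x => ?_)
    refine Set.Finite.measure_zero ?_ _
    let q : Polynomial ℝ := MvPolynomial.aeval
      (fun i => Polynomial.C (y i) + Polynomial.C (x i) * Polynomial.X) P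
    have hq : ∀ t, q.eval t = val P (y + t • x) := fun t => by
      have := MvPolynomial.map_aeval (fun i => Polynomial.C (y i) + Polynomial.C (x i) * Polynomial.X)
        (Polynomial.evalRingHom t) P
      simp only [Polynomial.coe_evalRingHom] at this
      rw [this, val, MvPolynomial.eval, MvPolynomial.coe_eval₂Hom, MvPolynomial.coe_eval₂Hom]
      congr 1
      · ext; simp
      · ext i
        simp only [Polynomial.eval_add, Polynomial.eval_mul, Polynomial.eval_C,
          Polynomial.eval_X, PiLp.add_apply, PiLp.smul_apply, smul_eq_mul]
        ring
    have hq0 : q ≠ 0 := fun h => hy (by simpa [h] using (hq 0).symm)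
    refine (Polynomial.finite_setOfPred_isRoot hq0).subset fun t ht => ?_
    exact (hq t).trans ht
  rw [Measure.volume_eq_prod, Measure.measure_prod_null hZm] at h1
  obtain ⟨t, ht, ht0⟩ := (h1.and (Measure.ae_ne volume (0 : ℝ))).exists
  have h2 : Prod.mk t ⁻¹' Z = (fun x => t • x) ⁻¹' ((fun x => y + x) ⁻¹' {x | val P x = 0}) := rfl
  simp only [h2, Pi.zero_apply] at ht
  rw [Measure.addHaar_preimage_smul _ ht0, measure_preimage_add] at ht
  exact (mul_eq_zero.1 ht).resolve_left (ENNReal.ofReal_pos.2 (by positivity)).ne'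

end PolynomialCalculus

/-! ### Uniform estimates for polynomials of bounded degree -/

section UniformEstimates

variable {m : ℕ}

/-- Coordinates on the polynomials of degree at most `k`; the sup norm of the coefficients has a
compact unit sphere, which is the source of all uniform constants. -/
lemma exists_poly_basis (m k : ℕ) : ∃ (n : ℕ) (b : Fin n → Poly m),
    (∀ c : Fin n → ℝ, ∑ i, c i • b i = 0 → c = 0) ∧
    ∀ P : Poly m, P.totalDegree ≤ k → ∃ c : Fin n → ℝ, P = ∑ i, c i • b i := by
  let W := MvPolynomial.restrictTotalDegree (Fin m) ℝ k
  let B := Module.finBasis ℝ W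
  refine ⟨Module.finrank ℝ W, fun i => (B i : Poly m), fun c hc => ?_, fun P hP => ?_⟩
  · have h : ∑ i, c i • B i = 0 := Subtype.ext (by simpa using hc)
    exact funext (Fintype.linearIndependent_iff.1 B.linearIndependent c h)
  · let w : W := ⟨P, (MvPolynomial.mem_restrictTotalDegree _ _ _).2 hP⟩
    refine ⟨B.repr w, ?_⟩
    have h : ((∑ i, B.repr w i • B i : W) : Poly m) = P := congrArg Subtype.val (B.sum_repr w)
    rw [← h]
    push_cast
    rfl

lemma abs_val_sum_smul_le {n : ℕ} (b : Fin n → Poly m) : ∃ K : ℝ, 0 < K ∧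
    ∀ c : Fin n → ℝ, ∀ x ∈ Metric.closedBall (0 : E m) 1,
      |val (∑ i, c i • b i) x| ≤ K * ‖c‖ ∧ ‖grad (∑ i, c i • b i) x‖ ≤ K * ‖c‖ := by
  have hcomp := isCompact_closedBall (0 : E m) 1
  choose K1 hK1 using fun i => hcomp.exists_bound_of_continuousOn (continuous_val (b i)).continuousOn
  choose K2 hK2 using fun i => hcomp.exists_bound_of_continuousOn (continuous_grad (b i)).continuousOn
  have hgrad : ∀ (c : Fin n → ℝ) x, grad (∑ i, c i • b i) x = ∑ i, c i • grad (b i) x := by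
    intro c x
    ext j
    simp [grad_apply, val]
  refine ⟨1 + ∑ i, (|K1 i| + |K2 i|), by positivity, fun c x hx => ?_⟩
  have hle : ∀ i, |K1 i| + |K2 i| ≤ 1 + ∑ i, (|K1 i| + |K2 i|) := fun i => by
    have := Finset.single_le_sum (f := fun i => |K1 i| + |K2 i|) (fun i _ => by positivity)
      (Finset.mem_univ i)
    linarith
  have hs : (∑ i, (|K1 i| + |K2 i|)) * ‖c‖ ≤ (1 + ∑ i, (|K1 i| + |K2 i|)) * ‖c‖ := by
    gcongr
    linarith
  constructor
  · refine le_trans ?_ hs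
    rw [val_sum, Finset.sum_mul]
    refine (Finset.abs_sum_le_sum_abs _ _).trans (Finset.sum_le_sum fun i _ => ?_)
    rw [val_smul, abs_mul, mul_comm]
    have h1 := hK1 i x hx
    rw [Real.norm_eq_abs] at h1
    exact mul_le_mul (by linarith [le_abs_self (K1 i), abs_nonneg (K2 i)]) (norm_le_pi_norm c i)
      (abs_nonneg _) (by positivity)
  · refine le_trans ?_ hs
    rw [hgrad, Finset.sum_mul]
    refine (norm_sum_le _ _).trans (Finset.sum_le_sum fun i _ => ?_)
    rw [norm_smul, mul_comm]
    have h1 := hK2 i x hx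
    exact mul_le_mul (by linarith [le_abs_self (K2 i), abs_nonneg (K1 i)]) (norm_le_pi_norm c i)
      (norm_nonneg _) (by positivity)

/-- By homogeneity it is enough to treat coefficient vectors of norm one. For one such vector the
sets `|P| ≤ 1/(j+1)` decrease to the zero set, which is null; a threshold that works for it works,
halved, for all nearby vectors, and the sphere is compact. -/
lemma volume_sublevel_unit_le {n : ℕ} (b : Fin n → Poly m)
    (hb : ∀ c : Fin n → ℝ, ∑ i, c i • b i = 0 → c = 0) {μ : ℝ} (hμ : 0 < μ) :
    ∃ η : ℝ, 0 < η ∧ ∀ c : Fin n → ℝ, volume {x | x ∈ Metric.closedBall (0 : E m) 1 ∧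
      |val (∑ i, c i • b i) x| < η * ‖c‖} ≤ ENNReal.ofReal μ := by
  obtain ⟨K, hK, hbound⟩ := abs_val_sum_smul_le b
  have key : ∃ η : ℝ, 0 < η ∧ ∀ c ∈ Metric.sphere (0 : Fin n → ℝ) 1,
      volume {x | x ∈ Metric.closedBall (0 : E m) 1 ∧ |val (∑ i, c i • b i) x| < η}
        ≤ ENNReal.ofReal μ := by
    refine (isCompact_sphere (0 : Fin n → ℝ) 1).induction_on
      (p := fun S => ∃ η : ℝ, 0 < η ∧ ∀ c ∈ S,
        volume {x | x ∈ Metric.closedBall (0 : E m) 1 ∧ |val (∑ i, c i • b i) x| < η}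
          ≤ ENNReal.ofReal μ) ⟨1, one_pos, by simp⟩ ?_ ?_ ?_
    · rintro s t hst ⟨η, hη, h⟩
      exact ⟨η, hη, fun c hc => h c (hst hc)⟩
    · rintro s t ⟨η, hη, h⟩ ⟨η', hη', h'⟩
      refine ⟨min η η', lt_min hη hη', fun c hc => ?_⟩
      rcases hc with hc | hc
      · exact (h c hc).trans' (measure_mono fun x hx => ⟨hx.1, hx.2.trans_le (min_le_left _ _)⟩)
      · exact (h' c hc).trans' (measure_mono fun x hx => ⟨hx.1, hx.2.trans_le (min_le_right _ _)⟩)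
    · intro c hc
      have hc0 : ∑ i, c i • b i ≠ 0 := fun h => by
        have := hb c h
        rw [this] at hc
        simp at hc
      set P := ∑ i, c i • b i with hP
      let s : ℕ → Set (E m) := fun j =>
        {x | x ∈ Metric.closedBall (0 : E m) 1 ∧ |val P x| ≤ 1 / ((j : ℝ) + 1)}
      have hlim : Tendsto (fun j => volume (s j)) atTop (𝓝 (volume (⋂ j, s j))) := by
        refine tendsto_measure_iInter_atTop (fun j => ?_) (fun i j hij x hx => ⟨hx.1, hx.2.trans ?_⟩)
          ⟨0, ?_⟩
        · exact (Metric.isClosed_closedBall.inter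
            (isClosed_le (continuous_val P).abs continuous_const)).measurableSet.nullMeasurableSet
        · exact Nat.one_div_le_one_div hij
        · exact ((measure_mono fun x hx => hx.1).trans_lt measure_closedBall_lt_top).ne
      have hzero : volume (⋂ j, s j) = 0 := by
        refine measure_mono_null (fun x hx => ?_) (volume_zeros_eq_zero hc0)
        have h1 : ∀ j : ℕ, |val P x| ≤ 1 / ((j : ℝ) + 1) := fun j => (Set.mem_iInter.1 hx j).2
        have h2 : |val P x| ≤ 0 := ge_of_tendsto' tendsto_one_div_add_atTop_nhds_zero_nat h1
        exact abs_eq_zero.1 (le_antisymm h2 (abs_nonneg _))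
      rw [hzero] at hlim
      obtain ⟨j, hj⟩ := (hlim.eventually (gt_mem_nhds (ENNReal.ofReal_pos.2 hμ))).exists
      set θ : ℝ := 1 / ((j : ℝ) + 1) with hθ
      have hθ0 : 0 < θ := by positivity
      -- Moving the coefficients by less than `θ / (2 K)` changes the values on the unit ball by at
      -- most `θ / 2`.
      refine ⟨_, mem_nhdsWithin_of_mem_nhds (Metric.ball_mem_nhds c (ε := θ / (2 * K)) (by positivity)),
        θ / 2, by positivity, fun c' hc' => ?_⟩
      refine hj.le.trans' (measure_mono fun x hx => ⟨hx.1, ?_⟩)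
      have h1 := (hbound (c - c') x hx.1).1
      have h2 : val (∑ i, (c - c') i • b i) x = val P x - val (∑ i, c' i • b i) x := by
        simp [hP, val_sum, val_smul, sub_mul, Finset.sum_sub_distrib]
      rw [h2] at h1
      have h3 : K * ‖c - c'‖ ≤ θ / 2 := by
        rw [← dist_eq_norm, dist_comm]
        calc K * dist c' c ≤ K * (θ / (2 * K)) := by
              gcongr
              exact (Metric.mem_ball.1 hc').le
          _ = θ / 2 := by field_simp
      have h4 : |val P x| ≤ |val P x - val (∑ i, c' i • b i) x| + |val (∑ i, c' i • b i) x| := by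
        simpa using abs_add_le (val P x - val (∑ i, c' i • b i) x) (val (∑ i, c' i • b i) x)
      have h5 := hx.2
      change |val P x| ≤ θ
      linarith
  obtain ⟨η, hη, h⟩ := key
  refine ⟨η, hη, fun c => ?_⟩
  rcases eq_or_ne c 0 with rfl | hc
  · have h0 : ∀ x : E m, ¬ |val (0 : Poly m) x| < 0 := fun x => (abs_nonneg _).not_gt
    simp [h0]
  have hc' : 0 < ‖c‖ := norm_pos_iff.2 hc
  have h1 := h (‖c‖⁻¹ • c) (by simp [norm_smul, hc'.ne'])
  refine h1.trans' (measure_mono fun x hx => ⟨hx.1, ?_⟩)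
  have h2 : val (∑ i, (‖c‖⁻¹ • c) i • b i) x = ‖c‖⁻¹ * val (∑ i, c i • b i) x := by
    simp [val_sum, val_smul, Finset.mul_sum, mul_assoc]
  have h3 := hx.2
  rw [h2, abs_mul, abs_of_pos (inv_pos.2 hc'), inv_mul_lt_iff₀ hc', mul_comm]
  exact h3

lemma exists_rescaled (P : Poly m) (x₀ : E m) (h : ℝ) : ∃ Q : Poly m,
    Q.totalDegree ≤ P.totalDegree ∧ (∀ y, val Q y = val P (x₀ + h • y)) ∧
    ∀ y, grad Q y = h • grad P (x₀ + h • y) := by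
  refine ⟨compAffine P x₀ (h • ContinuousLinearMap.id ℝ (E m)), totalDegree_compAffine_le _ _ _,
    fun y => by simp [val_compAffine], fun y => ?_⟩
  refine ext_inner_right ℝ fun u => ?_
  rw [inner_grad_compAffine]
  simp [real_inner_smul_left, real_inner_smul_right]

lemma rescale_mem_closedBall {x₀ y : E m} {h : ℝ} (hh : 0 < h)
    (hy : y ∈ Metric.closedBall x₀ h) :
    ∃ y' ∈ Metric.closedBall (0 : E m) 1, y = x₀ + h • y' := by
  refine ⟨h⁻¹ • (y - x₀), ?_, ?_⟩
  · rw [mem_closedBall_iff_norm] at hy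
    rw [mem_closedBall_zero_iff, norm_smul, norm_inv, Real.norm_of_nonneg hh.le]
    exact (inv_mul_le_one₀ hh).2 hy
  · rw [smul_inv_smul₀ hh.ne']; simp

/-- A polynomial of bounded degree is small on a small part of a ball only. -/
lemma volume_sublevel_le (m k : ℕ) {μ : ℝ} (hμ : 0 < μ) : ∃ η : ℝ, 0 < η ∧ ∀ (x₀ : E m) (h : ℝ),
    0 < h → ∀ P : Poly m, P.totalDegree ≤ k → ∀ y ∈ Metric.closedBall x₀ h,
      volume {x | x ∈ Metric.closedBall x₀ h ∧ |val P x| < η * |val P y|}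
        ≤ ENNReal.ofReal (μ * h ^ m) := by
  obtain ⟨n, b, hb, hspan⟩ := exists_poly_basis m k
  obtain ⟨K, hK, hbound⟩ := abs_val_sum_smul_le b
  obtain ⟨η, hη, hsub⟩ := volume_sublevel_unit_le b hb hμ
  refine ⟨η / K, by positivity, fun x₀ h hh P hP y hy => ?_⟩
  obtain ⟨Q, hQd, hQ, -⟩ := exists_rescaled P x₀ h
  obtain ⟨c, hc⟩ := hspan Q (hQd.trans hP)
  obtain ⟨y', hy', rfl⟩ := rescale_mem_closedBall hh hy
  set S := {x | x ∈ Metric.closedBall x₀ h ∧ |val P x| < η / K * |val P (x₀ + h • y')|}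
  have h1 : volume ((fun x => h • x) ⁻¹' ((fun x => x₀ + x) ⁻¹' S)) ≤ ENNReal.ofReal μ := by
    refine (hsub c).trans' (measure_mono fun x hx => ⟨?_, ?_⟩)
    · have h2 : x₀ + h • x ∈ Metric.closedBall x₀ h := hx.1
      rw [mem_closedBall_iff_norm, add_sub_cancel_left, norm_smul, Real.norm_of_nonneg hh.le] at h2
      rw [mem_closedBall_zero_iff]
      exact le_of_mul_le_mul_left (by linarith) hh
    · have h2 : |val P (x₀ + h • x)| < η / K * |val P (x₀ + h • y')| := hx.2
      rw [← hQ, ← hQ, hc] at h2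
      refine h2.trans_le ?_
      have h3 := (hbound c y' hy').1
      calc η / K * |val (∑ i, c i • b i) y'| ≤ η / K * (K * ‖c‖) := by gcongr
        _ = η * ‖c‖ := by field_simp
  rw [Measure.addHaar_preimage_smul _ hh.ne', measure_preimage_add, finrank_euclideanSpace_fin] at h1
  have hpow : 0 < h ^ m := by positivity
  calc volume S = ENNReal.ofReal (h ^ m) * (ENNReal.ofReal |(h ^ m)⁻¹| * volume S) := by
        rw [← mul_assoc, ← ENNReal.ofReal_mul hpow.le, abs_of_pos (inv_pos.2 hpow),
          mul_inv_cancel₀ hpow.ne', ENNReal.ofReal_one, one_mul]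
    _ ≤ ENNReal.ofReal (h ^ m) * ENNReal.ofReal μ := by gcongr
    _ = ENNReal.ofReal (μ * h ^ m) := by rw [← ENNReal.ofReal_mul hpow.le, mul_comm]

/-- Markov's inequality. -/
lemma norm_grad_le (m k : ℕ) : ∃ C : ℝ, 0 < C ∧ ∀ (x₀ : E m) (h : ℝ), 0 < h →
    ∀ P : Poly m, P.totalDegree ≤ k → ∀ B : ℝ, (∀ x ∈ Metric.closedBall x₀ h, |val P x| ≤ B) →
      ∀ x ∈ Metric.closedBall x₀ h, ‖grad P x‖ ≤ C / h * B := by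
  obtain ⟨n, b, hb, hspan⟩ := exists_poly_basis m k
  obtain ⟨K, hK, hbound⟩ := abs_val_sum_smul_le b
  have hvol : 0 < volume.real (Metric.closedBall (0 : E m) 1) :=
    ENNReal.toReal_pos (Metric.measure_closedBall_pos _ _ one_pos).ne' measure_closedBall_lt_top.ne
  obtain ⟨η, hη, hsub⟩ := volume_sublevel_unit_le b hb (half_pos hvol)
  refine ⟨K / η, by positivity, fun x₀ h hh P hP B hB x hx => ?_⟩
  obtain ⟨Q, hQd, hQ, hQg⟩ := exists_rescaled P x₀ h
  obtain ⟨c, hc⟩ := hspan Q (hQd.trans hP)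
  -- Otherwise the sublevel set `|Q| < η ‖c‖` would be the whole unit ball, while its volume is at
  -- most half of that of the ball.
  have h1 : η * ‖c‖ ≤ B := by
    by_contra! hlt
    have h2 := hsub c
    rw [show {x | x ∈ Metric.closedBall (0 : E m) 1 ∧ |val (∑ i, c i • b i) x| < η * ‖c‖}
      = Metric.closedBall (0 : E m) 1 from ?_] at h2
    · have h3 := ENNReal.toReal_mono ENNReal.ofReal_ne_top h2
      rw [ENNReal.toReal_ofReal (half_pos hvol).le] at h3
      change volume.real _ ≤ _ at h3
      linarith
    · refine Set.ext fun y => ⟨fun hy => hy.1, fun hy => ⟨hy, lt_of_le_of_lt ?_ hlt⟩⟩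
      rw [← hc, hQ]
      refine hB _ ?_
      rw [mem_closedBall_zero_iff] at hy
      rw [mem_closedBall_iff_norm, add_sub_cancel_left, norm_smul, Real.norm_of_nonneg hh.le]
      nlinarith
  obtain ⟨x', hx', rfl⟩ := rescale_mem_closedBall hh hx
  have h2 := (hbound c x' hx').2
  rw [← hc, hQg, norm_smul, Real.norm_of_nonneg hh.le] at h2
  have h3 : ‖c‖ ≤ B / η := by rw [le_div_iff₀ hη]; linarith
  calc ‖grad P (x₀ + h • x')‖ = h⁻¹ * (h * ‖grad P (x₀ + h • x')‖) := by field_simp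
    _ ≤ h⁻¹ * (K * (B / η)) := by
        exact mul_le_mul_of_nonneg_left (h2.trans (mul_le_mul_of_nonneg_left h3 hK.le))
          (inv_pos.2 hh).le
    _ = K / η / h * B := by field_simp

/-- Lower bound for the integral of the square of a product of polynomials over a subset of a ball,
in terms of the volume of the subset and of values of the factors. -/
lemma integral_prod_sq_ge (m k N : ℕ) {μ : ℝ} (hμ : 0 < μ) : ∃ c : ℝ, 0 < c ∧ ∀ (x₀ : E m) (h : ℝ),
    0 < h → ∀ S : Set (E m), MeasurableSet S → S ⊆ Metric.closedBall x₀ h →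
    μ * h ^ m ≤ volume.real S →
    ∀ {ι : Type} (I : Finset ι), I.card ≤ N → ∀ P : ι → Poly m, (∀ i ∈ I, (P i).totalDegree ≤ k) →
    ∀ y : ι → E m, (∀ i ∈ I, y i ∈ Metric.closedBall x₀ h) →
      c * h ^ m * ∏ i ∈ I, val (P i) (y i) ^ 2 ≤ ∫ x in S, ∏ i ∈ I, val (P i) x ^ 2 := by
  -- Each factor is small on a bad set of relative volume `μ / (2 (N + 1))`, so at most `N` bad sets
  -- leave at least half of the volume guaranteed in `S`. Taking `η ≤ 1` allows the exponent `N` in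
  -- place of the actual number of factors.
  obtain ⟨η₀, hη₀, hsub₀⟩ := volume_sublevel_le m k (μ := μ / (2 * (N + 1))) (by positivity)
  set η := min η₀ 1 with hηdef
  have hη : 0 < η := lt_min hη₀ one_pos
  have hη1 : η ≤ 1 := min_le_right _ _
  refine ⟨μ / 2 * (η ^ 2) ^ N, by positivity, fun x₀ h hh S hS hSB hvol ι I hI P hP y hy => ?_⟩
  set bad : ι → Set (E m) := fun i =>
    {x | x ∈ Metric.closedBall x₀ h ∧ |val (P i) x| < η * |val (P i) (y i)|} with hbad
  have hbadm : ∀ i, MeasurableSet (bad i) := fun i =>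
    Metric.isClosed_closedBall.measurableSet.inter
      (isOpen_lt (continuous_val (P i)).abs continuous_const).measurableSet
  have hbadv : ∀ i ∈ I, volume.real (bad i) ≤ μ / (2 * (N + 1)) * h ^ m := fun i hi => by
    have h1 := hsub₀ x₀ h hh (P i) (hP i hi) (y i) (hy i hi)
    have h2 : volume (bad i) ≤ ENNReal.ofReal (μ / (2 * (N + 1)) * h ^ m) := by
      refine h1.trans' (measure_mono fun x hx => ⟨hx.1, hx.2.trans_le ?_⟩)
      gcongr
      exact min_le_left _ _
    have h3 := ENNReal.toReal_mono ENNReal.ofReal_ne_top h2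
    rwa [ENNReal.toReal_ofReal (by positivity)] at h3
  set U := ⋃ i ∈ I, bad i with hU
  have hUv : volume.real U ≤ μ / 2 * h ^ m := by
    refine (measureReal_biUnion_finset_le I bad).trans ((Finset.sum_le_sum hbadv).trans ?_)
    rw [Finset.sum_const, nsmul_eq_mul]
    have h1 : (I.card : ℝ) ≤ N := by exact_mod_cast hI
    have h2 : (I.card : ℝ) * (μ / (2 * (N + 1))) ≤ μ / 2 := by
      rw [mul_div_assoc', div_le_div_iff₀ (by positivity) (by positivity)]
      nlinarith
    rw [← mul_assoc]
    gcongr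
  have hUm : MeasurableSet U := Finset.measurableSet_biUnion I fun i _ => hbadm i
  have hSfin : volume S ≠ ⊤ := ((measure_mono hSB).trans_lt measure_closedBall_lt_top).ne
  have hS' : μ / 2 * h ^ m ≤ volume.real (S \ U) := by
    have hUfin : volume U ≠ ⊤ := ((measure_closedBall_lt_top (x := x₀) (r := h)).trans_le'
      (measure_mono (Set.iUnion₂_subset fun i _ x (hx : x ∈ bad i) => hx.1))).ne
    have h1 := le_measureReal_sdiff (μ := volume) (s₁ := S) (s₂ := U) hUfin
    linarith
  have hcont : Continuous fun x => ∏ i ∈ I, val (P i) x ^ 2 :=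
    continuous_finsetProd _ fun i _ => (continuous_val _).pow 2
  have hint : IntegrableOn (fun x => ∏ i ∈ I, val (P i) x ^ 2) S :=
    (integrableOn_of_continuous hcont (isCompact_closedBall x₀ h)).mono_set hSB
  calc μ / 2 * (η ^ 2) ^ N * h ^ m * ∏ i ∈ I, val (P i) (y i) ^ 2
      = (μ / 2 * h ^ m) * ((η ^ 2) ^ N * ∏ i ∈ I, val (P i) (y i) ^ 2) := by ring
    _ ≤ volume.real (S \ U) * ((η ^ 2) ^ N * ∏ i ∈ I, val (P i) (y i) ^ 2) := by
        gcongr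
    _ = ∫ x in S \ U, (η ^ 2) ^ N * ∏ i ∈ I, val (P i) (y i) ^ 2 := by simp
    _ ≤ ∫ x in S \ U, ∏ i ∈ I, val (P i) x ^ 2 := by
        refine setIntegral_mono_on (integrableOn_const ?_) (hint.mono_set Set.sdiff_subset)
          (hS.diff hUm) fun x hx => ?_
        · exact ((measure_mono Set.sdiff_subset).trans_lt hSfin.lt_top).ne
        · calc (η ^ 2) ^ N * ∏ i ∈ I, val (P i) (y i) ^ 2
              ≤ (η ^ 2) ^ I.card * ∏ i ∈ I, val (P i) (y i) ^ 2 := by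
                gcongr ?_ * _
                exact pow_le_pow_of_le_one (by positivity) (pow_le_one₀ hη.le hη1) hI
            _ = ∏ i ∈ I, (η * |val (P i) (y i)|) ^ 2 := by
                rw [← Finset.prod_const, ← Finset.prod_mul_distrib]
                exact Finset.prod_congr rfl fun i _ => by rw [mul_pow, sq_abs]
            _ ≤ ∏ i ∈ I, val (P i) x ^ 2 := by
                refine Finset.prod_le_prod (fun i _ => by positivity) fun i hi => ?_
                rw [← sq_abs (val (P i) x)]
                gcongr
                by_contra! hlt
                exact hx.2 (Set.mem_biUnion hi ⟨hSB hx.1, hlt⟩)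
    _ ≤ ∫ x in S, ∏ i ∈ I, val (P i) x ^ 2 :=
        setIntegral_mono_set hint
          (Eventually.of_forall fun x => Finset.prod_nonneg fun i _ => sq_nonneg _)
          (Eventually.of_forall fun x hx => hx.1)

end UniformEstimates

/-! ### Hyperplanes and their surface measure -/

section Hyperplanes

variable {d : ℕ}

/-- A chart of the hyperplane orthogonal to `n`: it turns surface integrals over flat faces into
Lebesgue integrals over subsets of `E (d - 1)`. -/
lemma exists_hyperplane_isometry (hd : 0 < d) {n : E d} (hn : ‖n‖ = 1) :
    ∃ J : E (d - 1) →ₗᵢ[ℝ] E d, (∀ y, inner ℝ n (J y) = 0) ∧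
      ∀ w, inner ℝ n w = 0 → ∃ y, J y = w := by
  have hn0 : n ≠ 0 := fun h => by simp [h] at hn
  have : Fact (Module.finrank ℝ (E d) = (d - 1) + 1) := ⟨by simp; omega⟩
  let b := OrthonormalBasis.fromOrthogonalSpanSingleton (𝕜 := ℝ) (d - 1) hn0
  refine ⟨(Submodule.subtypeₗᵢ _).comp b.repr.symm.toLinearIsometry, fun y => ?_, fun w hw => ?_⟩
  · exact Submodule.mem_orthogonal_singleton_iff_inner_right.1 (b.repr.symm y).2
  · exact ⟨b.repr ⟨w, Submodule.mem_orthogonal_singleton_iff_inner_right.2 hw⟩, by simp⟩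

/-- With the Euclidean norm on the product the map is a linear isometry between spaces of equal
dimension, by Pythagoras. -/
lemma measurePreserving_orthogonal (hd : 0 < d) {n : E d} (hn : ‖n‖ = 1)
    {J : E (d - 1) →ₗᵢ[ℝ] E d} (hJ : ∀ y, inner ℝ n (J y) = 0) :
    MeasurePreserving (fun p : ℝ × E (d - 1) => p.1 • n + J p.2) := by
  let L : WithLp 2 (ℝ × E (d - 1)) →ₗᵢ[ℝ] E d :=
    { toFun := fun p => p.fst • n + J p.snd
      map_add' := fun p q => by simp [add_smul]; abel
      map_smul' := fun c p => by simp [mul_smul]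
      norm_map' := fun p => by
        change ‖p.fst • n + J p.snd‖ = ‖p‖
        have h1 := norm_add_sq_eq_norm_sq_add_norm_sq_of_inner_eq_zero (p.fst • n) (J p.snd)
          (by rw [real_inner_smul_left, hJ, mul_zero])
        have h2 := WithLp.prod_norm_sq_eq_of_L2 p
        rw [norm_smul, hn, mul_one, J.norm_map] at h1
        nlinarith [norm_nonneg (p.fst • n + J p.snd), norm_nonneg p,
          sq_eq_sq₀ (norm_nonneg (p.fst • n + J p.snd)) (norm_nonneg p)] }
  have hrank : Module.finrank ℝ (WithLp 2 (ℝ × E (d - 1))) = Module.finrank ℝ (E d) := by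
    rw [(WithLp.linearEquiv 2 ℝ (ℝ × E (d - 1))).finrank_eq, Module.finrank_prod]
    simp
    omega
  exact (L.toLinearIsometryEquiv hrank).measurePreserving.comp
    (WithLp.volume_preserving_toLp ℝ (E (d - 1)))

/-- Write `u = ⟪n, u⟫ n + J w`. The map is a dilation of `t` by `⟪n, u⟫`, then the shear `y ↦ y + t
w`, then the orthogonal coordinates; only the dilation changes the volume. -/
lemma measurePreserving_shear (hd : 0 < d) {n : E d} (hn : ‖n‖ = 1)
    {J : E (d - 1) →ₗᵢ[ℝ] E d} (hJ : ∀ y, inner ℝ n (J y) = 0)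
    (hJ' : ∀ w, inner ℝ n w = 0 → ∃ y, J y = w) (z : E d) {u : E d} (hu : inner ℝ n u ≠ 0) :
    MeasurePreserving (fun p : ℝ × E (d - 1) => z + p.1 • u + J p.2)
      ((ENNReal.ofReal |inner ℝ n u| • volume).prod volume) volume := by
  obtain ⟨w, hw⟩ := hJ' (u - inner ℝ n u • n) (by
    rw [inner_sub_right, real_inner_smul_right, real_inner_self_eq_norm_sq, hn]; ring)
  have h1 : MeasurePreserving (fun t : ℝ => inner ℝ n u * t)
      (ENNReal.ofReal |inner ℝ n u| • volume) volume :=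
    ⟨by fun_prop, by rw [Measure.map_smul]; exact Real.smul_map_volume_mul_left hu⟩
  have h2 : MeasurePreserving
      (fun p : ℝ × E (d - 1) => (inner ℝ n u * p.1, p.2 + p.1 • w))
      ((ENNReal.ofReal |inner ℝ n u| • volume).prod volume) (volume.prod volume) :=
    h1.skew_product (g := fun t y => y + t • w) (by fun_prop)
      (Eventually.of_forall fun t => map_add_right_eq_self _ _)
  have h3 := (measurePreserving_add_left (volume : Measure (E d)) z).comp
    ((measurePreserving_orthogonal hd hn hJ).comp h2)
  convert h3 using 2 with p
  simp only [Function.comp_apply, map_add, map_smul, hw, smul_sub, smul_smul]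
  module

lemma measurableEmbedding_shear {n : E d}
    {J : E (d - 1) →ₗᵢ[ℝ] E d} (hJ : ∀ y, inner ℝ n (J y) = 0)
    (z : E d) {u : E d} (hu : inner ℝ n u ≠ 0) :
    MeasurableEmbedding (fun p : ℝ × E (d - 1) => z + p.1 • u + J p.2) := by
  refine Continuous.measurableEmbedding (by fun_prop) fun p q hpq => ?_
  simp only [add_assoc, add_right_inj] at hpq
  have h1 := congrArg (inner ℝ n) hpq
  simp only [inner_add_right, real_inner_smul_right, hJ, add_zero] at h1
  have h2 : p.1 = q.1 := mul_right_cancel₀ hu h1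
  rw [h2, add_right_inj] at hpq
  exact Prod.ext h2 (J.injective hpq)

lemma surf_eq_map {n z : E d} {J : E (d - 1) →ₗᵢ[ℝ] E d}
    (hJ' : ∀ w, inner ℝ n w = 0 → ∃ y, J y = w) {e : Set (E d)} (he : MeasurableSet e)
    (hez : ∀ x ∈ e, inner ℝ n (x - z) = 0) :
    surf e = Measure.map (fun y => z + J y) (volume.restrict ((fun y => z + J y) ⁻¹' e)) := by
  have hiso : Isometry (fun y => z + J y) := (IsometryEquiv.addLeft z).isometry.comp J.isometry
  have h1 := hiso.map_euclideanHausdorffMeasure (d := d - 1)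
  rw [EuclideanSpace.euclideanHausdorffMeasure_eq_volume] at h1
  rw [← Measure.restrict_map hiso.continuous.measurable he, h1, Measure.restrict_restrict he, surf]
  congr 1
  refine (Set.inter_eq_left.2 fun x hx => ?_).symm
  obtain ⟨y, hy⟩ := hJ' (x - z) (hez x hx)
  exact ⟨y, by simp [hy]⟩

lemma integral_surf {n z : E d} {J : E (d - 1) →ₗᵢ[ℝ] E d}
    (hJ' : ∀ w, inner ℝ n w = 0 → ∃ y, J y = w) {e : Set (E d)} (he : MeasurableSet e)
    (hez : ∀ x ∈ e, inner ℝ n (x - z) = 0) (f : E d → ℝ) :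
    ∫ x, f x ∂(surf e) = ∫ y in (fun y => z + J y) ⁻¹' e, f (z + J y) := by
  have hiso : Isometry (fun y => z + J y) := (IsometryEquiv.addLeft z).isometry.comp J.isometry
  rw [surf_eq_map hJ' he hez, hiso.isEmbedding.injective |> fun hinj =>
    (hiso.continuous.measurableEmbedding hinj).integral_map]

lemma surfReal_eq {n z : E d} {J : E (d - 1) →ₗᵢ[ℝ] E d}
    (hJ' : ∀ w, inner ℝ n w = 0 → ∃ y, J y = w) {e s : Set (E d)} (he : MeasurableSet e)
    (hs : MeasurableSet s) (hez : ∀ x ∈ e, inner ℝ n (x - z) = 0) :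
    surf e s = volume ((fun y => z + J y) ⁻¹' (s ∩ e)) := by
  have hc : Continuous (fun y => z + J y) := by fun_prop
  rw [surf_eq_map hJ' he hez, Measure.map_apply hc.measurable hs,
    Measure.restrict_apply (hc.measurable hs)]
  rfl

lemma volume_hyperplane {n : E d} (hn : n ≠ 0) (c : ℝ) : volume {x : E d | inner ℝ n x = c} = 0 := by
  have h : affPoly n (-c) ≠ 0 := fun h => by
    have h1 := val_affPoly n (-c) 0
    have h2 := val_affPoly n (-c) n
    simp only [h, inner_zero_right, zero_add] at h1 h2
    have h3 : inner ℝ n n = 0 := by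
      have : val (0 : Poly d) 0 = val 0 n := by simp [val]
      linarith
    exact hn (inner_self_eq_zero.1 h3)
  refine measure_mono_null (fun x hx => ?_) (volume_zeros_eq_zero h)
  simp only [Set.mem_ofPred_eq, val_affPoly] at hx ⊢
  rw [hx]; ring

/-- The set of points from which `e` is reached in the direction `u`. -/
def shadow (e : Set (E d)) (u : E d) : Set (E d) := {x | ∃ t : ℝ, 0 ≤ t ∧ x + t • u ∈ e}

/-- As `u` is transversal to the hyperplane of `e`, the only possible `t` is `(c - ⟪n, x⟫) / ⟪n,
u⟫`, a continuous function of `x`; so the existential quantifier disappears. -/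
lemma isClosed_shadow {e : Set (E d)} (he : IsClosed e) {n : E d} {c : ℝ}
    (hez : ∀ x ∈ e, inner ℝ n x = c) {u : E d} (hu : inner ℝ n u ≠ 0) :
    IsClosed (shadow e u) := by
  have h : shadow e u = {x | 0 ≤ (c - inner ℝ n x) / inner ℝ n u} ∩
      (fun x => x + ((c - inner ℝ n x) / inner ℝ n u) • u) ⁻¹' e := by
    ext x
    constructor
    · rintro ⟨t, ht, hx⟩
      have h1 := hez _ hx
      rw [inner_add_right, real_inner_smul_right] at h1
      have h2 : (c - inner ℝ n x) / inner ℝ n u = t := by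
        rw [div_eq_iff hu]; linarith
      exact ⟨by simpa [h2] using ht, by simpa [h2] using hx⟩
    · rintro ⟨h1, h2⟩
      exact ⟨_, h1, h2⟩
  rw [h]
  refine (isClosed_le continuous_const (by fun_prop)).inter (he.preimage (by fun_prop))

/-- The integral of a directional derivative over a shadow. -/
lemma integral_shadow (hd : 0 < d) {n : E d} (hn : ‖n‖ = 1) {e : Set (E d)} (he : IsCompact e)
    (hperp : ∀ x ∈ e, ∀ y ∈ e, inner ℝ n (x - y) = 0) {u : E d} (hu : inner ℝ n u ≠ 0)
    {f : E d → ℝ} (hf : ContDiff ℝ 1 f) (hfc : HasCompactSupport f) :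
    ∫ x in shadow e u, fderiv ℝ f x u = |inner ℝ n u| * ∫ x, f x ∂(surf e) := by
  rcases e.eq_empty_or_nonempty with rfl | ⟨z, hz⟩
  · simp [shadow, surf]
  obtain ⟨J, hJ, hJ'⟩ := exists_hyperplane_isometry hd hn
  have hez : ∀ x ∈ e, inner ℝ n (x - z) = 0 := fun x hx => hperp x hx z hz
  have hmp := measurePreserving_shear hd hn hJ hJ' z hu
  have hme := measurableEmbedding_shear hJ z hu
  have hu0 : u ≠ 0 := fun h => by simp [h] at hu
  set Φ := fun p : ℝ × E (d - 1) => z + p.1 • u + J p.2 with hΦ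
  -- In the sheared coordinates the shadow is a half-line times the face, so Fubini and the
  -- fundamental theorem of calculus on each half-line finish the proof.
  have hsh : Φ ⁻¹' (shadow e u) = Set.Iic 0 ×ˢ ((fun y => z + J y) ⁻¹' e) := by
    ext ⟨t, y⟩
    constructor
    · rintro ⟨s, hs, hx⟩
      have h1 := hez _ hx
      have h2 : z + t • u + J y + s • u - z = (t + s) • u + J y := by module
      simp only [hΦ] at h1
      rw [h2, inner_add_right, real_inner_smul_right, hJ, add_zero, mul_eq_zero] at h1
      have h3 : t + s = 0 := h1.resolve_right hu
      refine ⟨by simp only [Set.mem_Iic]; linarith, ?_⟩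
      have h4 : z + t • u + J y + s • u = z + J y := by
        rw [show s = -t by linarith]; module
      have h5 : z + t • u + J y + s • u ∈ e := hx
      rw [h4] at h5
      exact h5
    · rintro ⟨ht, hy⟩
      refine ⟨-t, by simpa using ht, ?_⟩
      have h4 : z + t • u + J y + (-t) • u = z + J y := by module
      change z + t • u + J y + (-t) • u ∈ e
      rw [h4]
      exact hy
  have hmeas : MeasurableSet ((fun y => z + J y) ⁻¹' e) :=
    he.isClosed.measurableSet.preimage (by fun_prop : Continuous fun y => z + J y).measurable
  have hDf : Continuous fun x => fderiv ℝ f x u :=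
    (hf.continuous_fderiv one_ne_zero).clm_apply continuous_const
  have hDfc : HasCompactSupport fun x => fderiv ℝ f x u := hfc.fderiv_apply ℝ u
  have hint : Integrable (fun x => fderiv ℝ f x u) volume := hDf.integrable_of_hasCompactSupport hDfc
  rw [← hmp.setIntegral_preimage_emb hme, hsh, integral_surf hJ' he.isClosed.measurableSet hez,
    Measure.prod_smul_left, Measure.restrict_smul, integral_smul_measure, ← Measure.prod_restrict,
    ENNReal.toReal_ofReal (abs_nonneg _), smul_eq_mul]
  congr 1
  have hint' : Integrable (fun p => fderiv ℝ f (Φ p) u) ((volume.restrict (Set.Iic 0)).prod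
      (volume.restrict ((fun y => z + J y) ⁻¹' e))) := by
    have h1 : Integrable (fun p => fderiv ℝ f (Φ p) u)
        ((ENNReal.ofReal |inner ℝ n u| • volume).prod volume) :=
      (hmp.integrable_comp_emb hme).2 hint
    rw [Measure.prod_smul_left, integrable_smul_measure (by simpa using hu) ENNReal.ofReal_ne_top] at h1
    rw [Measure.prod_restrict]
    exact h1.restrict
  rw [integral_prod_symm _ hint']
  refine setIntegral_congr_fun hmeas fun y hy => ?_
  have hline : ContDiff ℝ 1 (fun t : ℝ => f (z + t • u + J y)) := hf.comp (by fun_prop)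
  have hemb : IsClosedEmbedding fun t : ℝ => z + t • u + J y := by
    have h1 := isClosedEmbedding_smul_left hu0 (𝕜 := ℝ)
    have h2 := (Homeomorph.addRight (z + J y)).isClosedEmbedding.comp h1
    convert h2 using 2 with t
    simp; abel
  have hlc : HasCompactSupport (fun t : ℝ => f (z + t • u + J y)) := hfc.comp_isClosedEmbedding hemb
  have h1 := hlc.integral_Iic_deriv_eq hline 0
  simp only [zero_smul, add_zero] at h1
  rw [← h1]
  refine integral_congr_ae (Eventually.of_forall fun t => ?_)
  have h2 : HasDerivAt (fun t : ℝ => z + t • u + J y) u t := by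
    simpa using (((hasDerivAt_id t).smul_const u).const_add z).add_const (J y)
  exact (((hf.differentiable one_ne_zero _).hasFDerivAt.comp_hasDerivAt t h2).deriv).symm

end Hyperplanes

/-! ### The divergence theorem -/

section Divergence

variable {d : ℕ}

/-- The boundary of the compact set `T` consists of the flat pieces `e ∈ F`, which are essentially
disjoint, and almost everywhere on `e` the set `T` lies behind `e` in the direction `ν e`. -/
structure IsFlatBoundary (T : Set (E d)) (F : Finset (Set (E d))) (ν : Set (E d) → E d) : Prop where
  isCompact : IsCompact T
  isCompact_face : ∀ e ∈ F, IsCompact e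
  unit : ∀ e ∈ F, ‖ν e‖ = 1
  perp : ∀ e ∈ F, ∀ x ∈ e, ∀ y ∈ e, inner ℝ (ν e) (x - y) = 0
  exists_face : ∀ x ∈ frontier T, ∃ e ∈ F, x ∈ e
  disjoint : ∀ e ∈ F, ∀ e' ∈ F, e ≠ e' → surf e e' = 0
  behind : ∀ e ∈ F, ∀ᵐ x ∂(surf e), LiesBehind T (ν e) x

/-- Near `x` the set `T` is a half-space with outer normal `n`. -/
def IsHalfSpaceNear (T : Set (E d)) (n x : E d) : Prop :=
  ∀ᶠ y in 𝓝 x, (y ∈ T ↔ inner ℝ n (y - x) ≤ 0)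

/-- The open half-ball is convex, hence connected, and does not meet the frontier of `T`; so it lies
in the interior of `T` or outside the closure, and one point decides which. -/
lemma halfBall_subset {T : Set (E d)} {n x : E d} {ε : ℝ}
    (hfr : ∀ y ∈ frontier T, y ∈ Metric.ball x ε → inner ℝ n (y - x) ≤ 0)
    {y₀ : E d} (hy₀ : y₀ ∈ Metric.ball x ε) (hn : 0 < inner ℝ n (y₀ - x)) (hT : y₀ ∈ T) :
    ∀ y ∈ Metric.ball x ε, 0 < inner ℝ n (y - x) → y ∈ T := by
  intro y hy hny
  by_contra hyT
  have hconv : Convex ℝ (Metric.ball x ε ∩ {y | 0 < inner ℝ n (y - x)}) := by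
    refine (convex_ball x ε).inter ?_
    have h : {y | 0 < inner ℝ n (y - x)} = {y | inner ℝ n x < innerSL ℝ n y} := by
      ext y; simp [inner_sub_right]
    rw [h]
    exact convex_halfSpace_gt (innerSL ℝ n).isLinear _
  have hnot : ∀ w ∈ Metric.ball x ε ∩ {y | 0 < inner ℝ n (y - x)}, w ∉ frontier T :=
    fun w hw hwT => (hfr w hwT hw.1).not_gt hw.2
  obtain ⟨w, -, hw1, hw2⟩ := hconv.isPreconnected (interior T) (closure T)ᶜ isOpen_interior
    isClosed_closure.isOpen_compl
    (fun w hw => by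
      by_cases h : w ∈ interior T
      · exact Or.inl h
      · exact Or.inr fun h' => hnot w hw ⟨h', h⟩)
    ⟨y₀, ⟨hy₀, hn⟩, by
      by_contra h
      exact hnot y₀ ⟨hy₀, hn⟩ ⟨subset_closure hT, h⟩⟩
    ⟨y, ⟨hy, hny⟩, fun h => hnot y ⟨hy, hny⟩ ⟨h, fun h' => hyT (interior_subset h')⟩⟩
  exact hw2 (interior_subset_closure hw1)

/-- The frontier is locally contained in one hyperplane, so each of the two half-balls lies entirely
inside or entirely outside `T`. `LiesBehind` supplies a point of `T` in the back one and a point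
outside `T` in the front one. Points on the hyperplane itself belong to `T` because `T` is closed.
-/
lemma isHalfSpaceNear_of_liesBehind {T : Set (E d)} (hT : IsClosed T) {n x : E d} (hn : ‖n‖ = 1)
    (hb : LiesBehind T n x) (hfr : ∀ᶠ y in 𝓝 x, y ∈ frontier T → inner ℝ n (y - x) = 0) :
    IsHalfSpaceNear T n x := by
  obtain ⟨ε, hε, hball⟩ := Metric.eventually_nhds_iff_ball.1 hfr
  have hnn : inner ℝ n n = 1 := by rw [real_inner_self_eq_norm_sq, hn, one_pow]
  obtain ⟨t, ⟨ht1, ht2⟩, ht⟩ := (hb.and (Ioo_mem_nhdsGT hε)).exists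
  have hmem : ∀ s : ℝ, |s| < ε → x + s • n ∈ Metric.ball x ε := fun s hs => by
    rw [mem_ball_iff_norm, add_sub_cancel_left, norm_smul, hn, mul_one]; exact hs
  have hback : ∀ y ∈ Metric.ball x ε, inner ℝ n (y - x) < 0 → y ∈ T := fun y hy hlt => by
    refine halfBall_subset (n := -n) (x := x) (ε := ε) (fun y hy hyb => ?_)
      (y₀ := x - t • n) ?_ ?_ ht1 y hy ?_
    · rw [inner_neg_left, hball y hyb hy, neg_zero]
    · have := hmem (-t) (by rw [abs_neg, abs_of_pos ht.1]; exact ht.2)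
      rwa [neg_smul, ← sub_eq_add_neg] at this
    · rw [sub_sub_cancel_left, inner_neg_neg, real_inner_smul_right, hnn, mul_one]; exact ht.1
    · rw [inner_neg_left]; linarith
  have hfront : ∀ y ∈ Metric.ball x ε, 0 < inner ℝ n (y - x) → y ∈ Tᶜ := fun y hy hlt => by
    refine halfBall_subset (n := n) (x := x) (ε := ε) (fun y hy hyb => ?_)
      (y₀ := x + t • n) (hmem t (by rw [abs_of_pos ht.1]; exact ht.2)) ?_ ht2 y hy hlt
    · rw [frontier_compl] at hy
      exact (hball y hyb hy).le
    · rw [add_sub_cancel_left, real_inner_smul_right, hnn, mul_one]; exact ht.1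
  filter_upwards [Metric.ball_mem_nhds x hε] with y hy
  refine ⟨fun hyT => not_lt.1 fun hlt => hfront y hy hlt hyT, fun hle => ?_⟩
  rcases hle.lt_or_eq with hlt | heq
  · exact hback y hy hlt
  · have hlim : Tendsto (fun s : ℝ => y - s • n) (𝓝[>] 0) (𝓝 y) := by
      have : Continuous fun s : ℝ => y - s • n := by fun_prop
      simpa using (this.tendsto 0).mono_left nhdsWithin_le_nhds
    refine hT.mem_of_tendsto hlim ?_
    filter_upwards [hlim (Metric.isOpen_ball.mem_nhds hy), self_mem_nhdsWithin] with s hs hs0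
    refine hback _ hs ?_
    rw [sub_right_comm, inner_sub_right, heq, real_inner_smul_right, hnn]
    have : 0 < s := hs0
    linarith

variable {T : Set (E d)} {F : Finset (Set (E d))} {ν : Set (E d) → E d}

namespace IsFlatBoundary

/-- Almost every point of `e` avoids the other, closed, faces; near such a point the frontier lies
in `e`, hence in its hyperplane. -/
lemma ae_regular (hB : IsFlatBoundary T F ν) {e : Set (E d)} (he : e ∈ F) :
    ∀ᵐ x ∂(surf e), x ∈ e ∧ IsHalfSpaceNear T (ν e) x ∧ ∀ e' ∈ F, e' ≠ e → x ∉ e' := by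
  have h1 : ∀ᵐ x ∂(surf e), ∀ e' ∈ F, e' ≠ e → x ∉ e' := by
    refine (ae_ball_iff F.countable_toSet).2 fun e' he' => ?_
    by_cases hee : e' = e
    · simp [hee]
    · have := measure_eq_zero_iff_ae_notMem.1 (hB.disjoint e he e' he' (Ne.symm hee))
      filter_upwards [this] with x hx _ using hx
  have h2 : ∀ᵐ x ∂(surf e), x ∈ e :=
    ae_restrict_mem (hB.isCompact_face e he).isClosed.measurableSet
  filter_upwards [h1, h2, hB.behind e he] with x hx1 hx2 hx3
  refine ⟨hx2, isHalfSpaceNear_of_liesBehind hB.isCompact.isClosed (hB.unit e he) hx3 ?_, hx1⟩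
  have h3 : ∀ᶠ y in 𝓝 x, ∀ e' ∈ F, e' ≠ e → y ∉ e' := by
    refine (Filter.eventually_all_finset F).2 fun e' he' => ?_
    by_cases hee : e' = e
    · simp [hee]
    · filter_upwards [(hB.isCompact_face e' he').isClosed.isOpen_compl.mem_nhds (hx1 e' he' hee)]
        with y hy _ using hy
  filter_upwards [h3] with y hy hyT
  obtain ⟨e', he', hye'⟩ := hB.exists_face y hyT
  have : e' = e := by
    by_contra hne
    exact hy e' he' hne hye'
  subst this
  exact hB.perp e' he' y hye' x hx2

/-- For a face transversal to `u`, the irregular points are null on the surface, and the lines in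
direction `u` through them form `ℝ` times a null set in sheared coordinates. A face parallel to `u`
is met only by lines inside its hyperplane, which is null. -/
lemma ae_regular_line (hB : IsFlatBoundary T F ν) (hd : 0 < d) (u : E d) :
    ∀ᵐ y : E d, ∀ e ∈ F, ∀ t : ℝ, y + t • u ∈ e → inner ℝ (ν e) u ≠ 0 ∧
      IsHalfSpaceNear T (ν e) (y + t • u) ∧ ∀ e' ∈ F, e' ≠ e → y + t • u ∉ e' := by
  refine (ae_ball_iff F.countable_toSet).2 fun e he => ?_
  rcases e.eq_empty_or_nonempty with rfl | ⟨z, hz⟩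
  · simp
  have hn := hB.unit e he
  have hn0 : ν e ≠ 0 := fun h => by simp [h] at hn
  by_cases hu : inner ℝ (ν e) u = 0
  · have h0 := measure_eq_zero_iff_ae_notMem.1 (volume_hyperplane hn0 (inner ℝ (ν e) z))
    filter_upwards [h0] with y hy t ht
    refine absurd ?_ hy
    have := hB.perp e he _ ht z hz
    rw [inner_sub_right, inner_add_right, real_inner_smul_right, hu] at this
    change inner ℝ (ν e) y = _
    linarith
  · have hez : ∀ x ∈ e, inner ℝ (ν e) (x - z) = 0 := fun x hx => hB.perp e he x hx z hz
    have hem := (hB.isCompact_face e he).isClosed.measurableSet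
    obtain ⟨J, hJ, hJ'⟩ := exists_hyperplane_isometry hd hn
    have hmp := measurePreserving_shear hd hn hJ hJ' z hu
    have hme := measurableEmbedding_shear hJ z hu
    have hιc : Continuous (fun y => z + J y) := by fun_prop
    have hιi : Function.Injective (fun y => z + J y) := fun a b hab =>
      J.injective (add_left_cancel hab)
    set Q : E d → Prop := fun x => IsHalfSpaceNear T (ν e) x ∧ ∀ e' ∈ F, e' ≠ e → x ∉ e' with hQ
    set N : Set (E d) := {x | x ∈ e ∧ ¬ Q x} with hN
    have hN0 : surf e N = 0 := by
      refine measure_eq_zero_iff_ae_notMem.2 ?_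
      filter_upwards [hB.ae_regular he] with x hx hxN using hxN.2 hx.2
    have hιN : volume ((fun y => z + J y) ⁻¹' N) = 0 := by
      rw [surf_eq_map hJ' hem hez, (hιc.measurableEmbedding hιi).map_apply,
        Measure.restrict_apply' (hιc.measurable hem)] at hN0
      refine measure_mono_null (fun y hy => ?_) hN0
      exact ⟨hy, (show z + J y ∈ N from hy).1⟩
    have hA : volume {y : E d | ∃ t : ℝ, y + t • u ∈ N} = 0 := by
      rw [← hmp.measure_preimage_emb hme]
      refine measure_mono_null (t := Set.univ ×ˢ ((fun y => z + J y) ⁻¹' N)) ?_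
        (by rw [Measure.prod_prod, hιN, mul_zero])
      rintro ⟨s, y⟩ ⟨t, ht⟩
      refine ⟨trivial, ?_⟩
      have h1 := hez _ ht.1
      have h2 : z + s • u + J y + t • u - z = (s + t) • u + J y := by module
      change inner ℝ (ν e) (z + s • u + J y + t • u - z) = 0 at h1
      rw [h2, inner_add_right, real_inner_smul_right, hJ, add_zero, mul_eq_zero] at h1
      have h3 : s + t = 0 := h1.resolve_right hu
      have h4 : z + s • u + J y + t • u = z + J y := by
        rw [show t = -s by linarith]; module
      change z + s • u + J y + t • u ∈ N at ht
      rw [h4] at ht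
      exact ht
    filter_upwards [measure_eq_zero_iff_ae_notMem.1 hA] with y hy t ht
    refine ⟨hu, ?_⟩
    by_contra hcon
    exact hy ⟨t, ht, hcon⟩

open Classical in
/-- Almost every point of `T` is counted correctly by the signed shadows of the faces. -/
lemma ae_indicator_eq (hB : IsFlatBoundary T F ν) (hd : 0 < d) {u : E d} (hu : u ≠ 0) :
    ∀ᵐ y : E d, T.indicator (fun _ => (1 : ℝ)) y =
      ∑ e ∈ F with inner ℝ (ν e) u ≠ 0,
        (SignType.sign (inner ℝ (ν e) u) : ℝ) * (shadow e u).indicator (fun _ => (1 : ℝ)) y := by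
  -- In direction `0` the condition `⟪ν e, 0⟫ ≠ 0` can never hold, so the second statement says that
  -- `y` lies on no face.
  filter_upwards [hB.ae_regular_line hd u, hB.ae_regular_line hd 0] with y hy hy0
  have hyF : ∀ e ∈ F, y ∉ e := fun e he hye => by
    simpa using (hy0 e he 0 (by simpa using hye)).1
  set F' := F.filter fun e => inner ℝ (ν e) u ≠ 0 with hF'
  -- `R e t` says that `e` is still ahead on the line at time `t`. Since `T` is closed, the crossing
  -- point belongs to `T` both on leaving and on entering; the choice between `≤` and `<` makes the
  -- jumps cancel at the crossing point itself, so that `G` is locally constant everywhere.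
  let R : Set (E d) → ℝ → Prop := fun e t =>
    ∃ s : ℝ, y + s • u ∈ e ∧ (if 0 < inner ℝ (ν e) u then t ≤ s else t < s)
  let G : ℝ → ℝ := fun t => T.indicator (fun _ => (1 : ℝ)) (y + t • u) -
    ∑ e ∈ F', (SignType.sign (inner ℝ (ν e) u) : ℝ) * (if R e t then 1 else 0)
  have huniq : ∀ e ∈ F', ∀ s s' : ℝ, y + s • u ∈ e → y + s' • u ∈ e → s = s' := by
    intro e he s s' hs hs'
    have h1 := hB.perp e (Finset.mem_filter.1 he).1 _ hs _ hs'
    rw [add_sub_add_left_eq_sub, ← sub_smul, real_inner_smul_right, mul_eq_zero] at h1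
    linarith [h1.resolve_right (Finset.mem_filter.1 he).2]
  have hRconst : ∀ e ∈ F', ∀ t₀ : ℝ, y + t₀ • u ∉ e → ∀ᶠ t in 𝓝 t₀, (R e t ↔ R e t₀) := by
    intro e he t₀ ht₀
    by_cases hex : ∃ s : ℝ, y + s • u ∈ e
    · obtain ⟨s, hs⟩ := hex
      have hR : ∀ t, R e t ↔ (if 0 < inner ℝ (ν e) u then t ≤ s else t < s) := fun t =>
        ⟨fun ⟨s', hs', h⟩ => by rwa [huniq e he s s' hs hs'], fun h => ⟨s, hs, h⟩⟩
      have hne : t₀ ≠ s := fun h => ht₀ (h ▸ hs)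
      rcases hne.lt_or_gt with hlt | hlt
      · filter_upwards [gt_mem_nhds hlt] with t ht
        rw [hR, hR]
        split_ifs
        · exact ⟨fun _ => hlt.le, fun _ => le_of_lt ht⟩
        · exact ⟨fun _ => hlt, fun _ => ht⟩
      · filter_upwards [lt_mem_nhds hlt] with t ht
        rw [hR, hR]
        split_ifs
        · exact ⟨fun h => absurd h (not_le.2 ht), fun h => absurd h (not_le.2 hlt)⟩
        · exact ⟨fun h => absurd h (not_lt.2 (le_of_lt ht)), fun h => absurd h (not_lt.2 hlt.le)⟩
    · exact Eventually.of_forall fun t =>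
        ⟨fun ⟨s, hs, _⟩ => absurd ⟨s, hs⟩ hex, fun ⟨s, hs, _⟩ => absurd ⟨s, hs⟩ hex⟩
  have hline : Continuous fun t : ℝ => y + t • u := by fun_prop
  -- At a crossing of one face the indicator of `T` and the signed term of that face jump together,
  -- while the terms of the other faces do not change; away from the faces nothing changes.
  have hG : IsLocallyConstant G := by
    refine (IsLocallyConstant.iff_eventually_eq G).2 fun t₀ => ?_
    by_cases hcase : ∃ e ∈ F, y + t₀ • u ∈ e
    · obtain ⟨e, he, hte⟩ := hcase
      obtain ⟨hue, hhalf, hoth⟩ := hy e he t₀ hte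
      have heF' : e ∈ F' := Finset.mem_filter.2 ⟨he, hue⟩
      have h1 : ∀ᶠ t in 𝓝 t₀, ∀ e' ∈ F'.erase e, (R e' t ↔ R e' t₀) := by
        refine (Filter.eventually_all_finset _).2 fun e' he' => ?_
        have h := Finset.mem_erase.1 he'
        exact hRconst e' h.2 t₀ (hoth e' (Finset.mem_filter.1 h.2).1 h.1)
      have h2 : ∀ t, R e t ↔ (if 0 < inner ℝ (ν e) u then t ≤ t₀ else t < t₀) := fun t =>
        ⟨fun ⟨s', hs', h⟩ => by rwa [huniq e heF' t₀ s' hte hs'], fun h => ⟨t₀, hte, h⟩⟩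
      have h3 : ∀ᶠ t in 𝓝 t₀, (y + t • u ∈ T ↔ (t - t₀) * inner ℝ (ν e) u ≤ 0) := by
        filter_upwards [hline.tendsto t₀ hhalf] with t ht
        have ht' : y + t • u ∈ T ↔ inner ℝ (ν e) (y + t • u - (y + t₀ • u)) ≤ 0 := ht
        rwa [add_sub_add_left_eq_sub, ← sub_smul, real_inner_smul_right] at ht'
      filter_upwards [h1, h3] with t ht1 ht3
      have ht3' := h3.self_of_nhds
      have key : T.indicator (fun _ => (1 : ℝ)) (y + t • u) -
            (SignType.sign (inner ℝ (ν e) u) : ℝ) * (if R e t then 1 else 0) =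
          T.indicator (fun _ => (1 : ℝ)) (y + t₀ • u) -
            (SignType.sign (inner ℝ (ν e) u) : ℝ) * (if R e t₀ then 1 else 0) := by
        simp only [Set.indicator_apply, ht3, ht3', h2]
        rcases lt_or_gt_of_ne hue with hneg | hpos
        · rw [sign_neg hneg]
          simp only [not_lt.2 hneg.le, if_false, sub_self, zero_mul, le_refl, if_true, lt_irrefl]
          rcases lt_or_ge t t₀ with hlt | hge
          · have : ¬ (t - t₀) * inner ℝ (ν e) u ≤ 0 := by nlinarith
            simp [this, hlt]
          · have : (t - t₀) * inner ℝ (ν e) u ≤ 0 := by nlinarith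
            simp [this, not_lt.2 hge]
        · rw [sign_pos hpos]
          simp only [hpos, if_true, sub_self, zero_mul, le_refl]
          rcases le_or_gt t t₀ with hlt | hge
          · have : (t - t₀) * inner ℝ (ν e) u ≤ 0 := by nlinarith
            simp [this, hlt]
          · have : ¬ (t - t₀) * inner ℝ (ν e) u ≤ 0 := by nlinarith
            simp [this, not_le.2 hge]
      simp only [G]
      rw [← Finset.add_sum_erase _ _ heF', ← Finset.add_sum_erase _ _ heF']
      have hsum : ∑ e' ∈ F'.erase e, (SignType.sign (inner ℝ (ν e') u) : ℝ) * (if R e' t then 1 else 0) =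
          ∑ e' ∈ F'.erase e, (SignType.sign (inner ℝ (ν e') u) : ℝ) * (if R e' t₀ then 1 else 0) :=
        Finset.sum_congr rfl fun e' he' => by simp only [ht1 e' he']
      rw [hsum]
      linarith
    · push Not at hcase
      have hfr : y + t₀ • u ∉ frontier T := fun h => by
        obtain ⟨e, he, h'⟩ := hB.exists_face _ h
        exact hcase e he h'
      have h1 : ∀ᶠ t in 𝓝 t₀, ∀ e' ∈ F', (R e' t ↔ R e' t₀) := by
        refine (Filter.eventually_all_finset _).2 fun e' he' => ?_
        exact hRconst e' he' t₀ (hcase e' (Finset.mem_filter.1 he').1)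
      have h2 : ∀ᶠ t in 𝓝 t₀, (y + t • u ∈ T ↔ y + t₀ • u ∈ T) := by
        by_cases hT : y + t₀ • u ∈ T
        · have hint : y + t₀ • u ∈ interior T := by
            by_contra h
            exact hfr ⟨subset_closure hT, h⟩
          filter_upwards [hline.tendsto t₀ (isOpen_interior.mem_nhds hint)] with t ht
          exact ⟨fun _ => hT, fun _ => interior_subset ht⟩
        · filter_upwards [hline.tendsto t₀ (hB.isCompact.isClosed.isOpen_compl.mem_nhds hT)] with t ht
          exact ⟨fun h => absurd h ht, fun h => absurd h hT⟩
      filter_upwards [h1, h2] with t ht1 ht2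
      simp only [G, Set.indicator_apply, ht2]
      congr 1
      exact Finset.sum_congr rfl fun e' he' => by simp only [ht1 e' he']
  -- Far along the line there is neither `T` nor a face ahead, by compactness. So the constant value
  -- of `G` is zero.
  obtain ⟨t₁, ht₁, htT⟩ : ∃ t₁ : ℝ, (∀ e ∈ F', ¬ R e t₁) ∧ y + t₁ • u ∉ T := by
    have h1 : Tendsto (fun t : ℝ => ‖y + t • u‖) atTop atTop := by
      have h2 : Tendsto (fun t : ℝ => t * ‖u‖ - ‖y‖) atTop atTop :=
        tendsto_atTop_add_const_right _ _ (tendsto_id.atTop_mul_const (norm_pos_iff.2 hu))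
      refine tendsto_atTop_mono' _ ?_ h2
      filter_upwards [eventually_ge_atTop 0] with t ht
      have := norm_sub_norm_le (t • u) (-y)
      rw [norm_smul, Real.norm_of_nonneg ht, norm_neg, sub_neg_eq_add, add_comm (t • u)] at this
      exact this
    have hbdd : ∀ S : Set (E d), IsCompact S → ∀ᶠ t : ℝ in atTop, y + t • u ∉ S := fun S hS => by
      obtain ⟨C, hC⟩ := hS.isBounded.exists_norm_le
      filter_upwards [h1.eventually_gt_atTop C] with t ht hmem
      exact ht.not_ge (hC _ hmem)
    have h3 : ∀ᶠ t : ℝ in atTop, ∀ e ∈ F', ¬ R e t := by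
      refine (Filter.eventually_all_finset _).2 fun e he => ?_
      obtain ⟨C, hC⟩ := Filter.eventually_atTop.1
        (hbdd e (hB.isCompact_face e (Finset.mem_filter.1 he).1))
      filter_upwards [eventually_ge_atTop C] with t ht
      rintro ⟨s, hs, hle⟩
      refine hC s ?_ hs
      split_ifs at hle <;> linarith
    exact (h3.and (hbdd T hB.isCompact)).exists
  have hconst := hG.apply_eq_of_preconnectedSpace 0 t₁
  have hG1 : G t₁ = 0 := by
    simp only [G, Set.indicator_of_notMem htT, zero_sub, neg_eq_zero]
    exact Finset.sum_eq_zero fun e he => by simp [ht₁ e he]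
  rw [hG1] at hconst
  simp only [G, zero_smul, add_zero, sub_eq_zero] at hconst
  rw [hconst]
  refine Finset.sum_congr rfl fun e he => ?_
  have h4 : R e 0 ↔ y ∈ shadow e u := by
    constructor
    · rintro ⟨s, hs, hle⟩
      refine ⟨s, ?_, hs⟩
      split_ifs at hle <;> linarith
    · rintro ⟨s, hs, hmem⟩
      refine ⟨s, hmem, ?_⟩
      have : s ≠ 0 := fun h => hyF e (Finset.mem_filter.1 he).1 (by simpa [h] using hmem)
      split_ifs
      · exact hs
      · exact lt_of_le_of_ne hs this.symm
  simp only [Set.indicator_apply, h4]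

/-- The divergence theorem for functions of class `C¹` with compact support. -/
lemma integral_fderiv (hB : IsFlatBoundary T F ν) (hd : 0 < d) (u : E d) {f : E d → ℝ}
    (hf : ContDiff ℝ 1 f) (hfc : HasCompactSupport f) :
    ∫ x in T, fderiv ℝ f x u = ∑ e ∈ F, inner ℝ (ν e) u * ∫ x, f x ∂(surf e) := by
  classical
  rcases eq_or_ne u 0 with rfl | hu
  · simp
  have hDf : Continuous fun x => fderiv ℝ f x u :=
    (hf.continuous_fderiv one_ne_zero).clm_apply continuous_const
  have hint : Integrable (fun x => fderiv ℝ f x u) volume :=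
    hDf.integrable_of_hasCompactSupport (hfc.fderiv_apply ℝ u)
  have hTm := hB.isCompact.isClosed.measurableSet
  have hshm : ∀ e ∈ F, inner ℝ (ν e) u ≠ 0 → MeasurableSet (shadow e u) := by
    intro e he hue
    rcases e.eq_empty_or_nonempty with rfl | ⟨z, hz⟩
    · simp [shadow]
    · refine (isClosed_shadow (hB.isCompact_face e he).isClosed (n := ν e) (c := inner ℝ (ν e) z)
        (fun x hx => ?_) hue).measurableSet
      have := hB.perp e he x hx z hz
      rw [inner_sub_right] at this
      linarith
  have h1 : ∫ x in T, fderiv ℝ f x u = ∫ x, ∑ e ∈ F with inner ℝ (ν e) u ≠ 0,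
      (SignType.sign (inner ℝ (ν e) u) : ℝ) *
        (shadow e u).indicator (fun x => fderiv ℝ f x u) x := by
    rw [← integral_indicator hTm]
    refine integral_congr_ae ?_
    filter_upwards [hB.ae_indicator_eq hd hu] with y hy
    have h2 : ∀ S : Set (E d), S.indicator (fun x => fderiv ℝ f x u) y =
        S.indicator (fun _ => (1 : ℝ)) y * fderiv ℝ f y u := fun S => by
      by_cases h : y ∈ S <;> simp [h]
    simp only [h2]
    rw [hy, Finset.sum_mul]
    exact Finset.sum_congr rfl fun e _ => by ring
  rw [h1, integral_finsetSum]
  · rw [Finset.sum_filter]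
    refine Finset.sum_congr rfl fun e he => ?_
    split_ifs with hue
    · rw [integral_const_mul, integral_indicator (hshm e he hue),
        integral_shadow hd (hB.unit e he) (hB.isCompact_face e he) (hB.perp e he) hue hf hfc,
        ← mul_assoc, sign_mul_abs]
    · push Not at hue
      rw [hue, zero_mul]
  · intro e he
    rw [Finset.mem_filter] at he
    exact (hint.indicator (hshm e he.1 he.2)).const_mul _

/-- The divergence theorem for polynomials. -/
lemma integral_inner_grad (hB : IsFlatBoundary T F ν) (hd : 0 < d) (hFT : ∀ e ∈ F, e ⊆ T) (u : E d)
    (P : Poly d) :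
    ∫ x in T, inner ℝ (grad P x) u = ∑ e ∈ F, inner ℝ (ν e) u * ∫ x, val P x ∂(surf e) := by
  obtain ⟨R, hR, hTR⟩ := hB.isCompact.isBounded.subset_ball_lt 0 0
  -- A cutoff that equals one near `T` makes the polynomial compactly supported and changes neither
  -- side.
  let χ : ContDiffBump (0 : E d) := ⟨R, R + 1, hR, by linarith⟩
  have hval : ContDiff ℝ 1 (val P) := by
    refine contDiff_one_iff_hasFDerivAt.2 ⟨fun x => innerSL ℝ (grad P x), ?_, hasFDerivAt_val P⟩
    exact (innerSL ℝ).continuous.comp (continuous_grad P)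
  have hone : ∀ x ∈ T, (fun y => χ y * val P y) =ᶠ[𝓝 x] val P := fun x hx => by
    filter_upwards [Metric.isOpen_ball.mem_nhds (hTR hx)] with y hy
    rw [χ.one_of_mem_closedBall (Metric.ball_subset_closedBall hy), one_mul]
  have h := hB.integral_fderiv hd u (f := fun y => χ y * val P y) (χ.contDiff.mul hval)
    χ.hasCompactSupport.mul_right
  have h1 : ∫ x in T, inner ℝ (grad P x) u = ∫ x in T, fderiv ℝ (fun y => χ y * val P y) x u := by
    refine setIntegral_congr_fun hB.isCompact.isClosed.measurableSet fun x hx => ?_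
    rw [(hone x hx).fderiv_eq, (hasFDerivAt_val P x).fderiv]
    rfl
  rw [h1, h]
  refine Finset.sum_congr rfl fun e he => ?_
  congr 1
  refine setIntegral_congr_fun (hB.isCompact_face e he).isClosed.measurableSet fun x hx => ?_
  exact (hone x (hFT e he hx)).eq_of_nhds

end IsFlatBoundary

end Divergence

/-! ### Green's formula and the error representation of the weak Laplacian -/

section Green

variable {d : ℕ} {T : Set (E d)} {F : Finset (Set (E d))} {ν : Set (E d) → E d}

/-- The polynomial `x ↦ ⟪∇P x, u⟫`. -/
def dirDeriv (P : Poly d) (u : E d) : Poly d :=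
  ∑ i, MvPolynomial.C (u i) * MvPolynomial.pderiv i P

lemma val_dirDeriv (P : Poly d) (u x : E d) : val (dirDeriv P u) x = inner ℝ (grad P x) u := by
  simp [dirDeriv, val_sum, val_mul, val_C, inner_grad, mul_comm]

lemma totalDegree_dirDeriv_le (P : Poly d) (u : E d) :
    (dirDeriv P u).totalDegree ≤ P.totalDegree - 1 := by
  refine MvPolynomial.totalDegree_finsetSum_le fun i _ => ?_
  refine (MvPolynomial.totalDegree_mul _ _).trans ?_
  rw [MvPolynomial.totalDegree_C, zero_add]
  exact totalDegree_pderiv_le P i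

lemma val_lap (P : Poly d) (x : E d) :
    val (lap P) x = ∑ i, val (MvPolynomial.pderiv i (MvPolynomial.pderiv i P)) x := by
  simp [lap, val_sum]

lemma IsFlatBoundary.integrable_surf (hB : IsFlatBoundary T F ν) {e : Set (E d)} (he : e ∈ F)
    (hfin : surf e Set.univ < ⊤) {f : E d → ℝ} (hf : Continuous f) : Integrable f (surf e) := by
  obtain ⟨B, hB'⟩ := (hB.isCompact_face e he).exists_bound_of_continuousOn hf.continuousOn
  refine Measure.integrableOn_of_bounded ?_ hf.aestronglyMeasurable
    (ae_restrict_of_forall_mem (hB.isCompact_face e he).isClosed.measurableSet hB')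
  rw [surf, Measure.restrict_apply_univ] at hfin
  exact hfin.ne

/-- Green's second formula for polynomials. -/
lemma IsFlatBoundary.green (hB : IsFlatBoundary T F ν) (hd : 0 < d) (hFT : ∀ e ∈ F, e ⊆ T)
    (hfin : ∀ e ∈ F, surf e Set.univ < ⊤) (f φ : Poly d) :
    ∫ x in T, val f x * val (lap φ) x = (∫ x in T, val (lap f) x * val φ x)
      + (∑ e ∈ F, ∫ x, val f x * inner ℝ (grad φ x) (ν e) ∂(surf e))
      - ∑ e ∈ F, ∫ x, inner ℝ (grad f x) (ν e) * val φ x ∂(surf e) := by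
  have hint : ∀ g : E d → ℝ, Continuous g → IntegrableOn g T := fun g hg =>
    integrableOn_of_continuous hg hB.isCompact
  -- The components of the field `f ∇φ - φ ∇f`, whose divergence is `f Δφ - φ Δf`.
  set Q : Fin d → Poly d := fun i =>
    f * MvPolynomial.pderiv i φ - MvPolynomial.pderiv i f * φ with hQ
  have h1 : ∀ i, ∫ x in T, val (MvPolynomial.pderiv i (Q i)) x =
      ∑ e ∈ F, ν e i * ∫ x, val (Q i) x ∂(surf e) := fun i => by
    have h2 := hB.integral_inner_grad hd hFT (EuclideanSpace.single i 1) (Q i)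
    simpa [EuclideanSpace.inner_single_right, grad_apply] using h2
  have h3 : ∀ x, ∑ i, val (MvPolynomial.pderiv i (Q i)) x =
      val f x * val (lap φ) x - val (lap f) x * val φ x := fun x => by
    rw [val_lap, val_lap, Finset.mul_sum, Finset.sum_mul, ← Finset.sum_sub_distrib]
    refine Finset.sum_congr rfl fun i _ => ?_
    simp only [hQ, map_sub, MvPolynomial.pderiv_mul, val_sub, val_add, val_mul]
    ring
  have h4 : ∫ x in T, (val f x * val (lap φ) x - val (lap f) x * val φ x) =
      ∑ e ∈ F, ((∫ x, val f x * inner ℝ (grad φ x) (ν e) ∂(surf e))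
        - ∫ x, inner ℝ (grad f x) (ν e) * val φ x ∂(surf e)) := by
    simp only [← h3]
    rw [integral_finsetSum _ fun i _ => hint _ (continuous_val _)]
    simp only [h1]
    rw [Finset.sum_comm]
    refine Finset.sum_congr rfl fun e he => ?_
    have hs := fun g hg => hB.integrable_surf he (hfin e he) (f := g) hg
    have hi1 : Integrable (fun x => val f x * inner ℝ (grad φ x) (ν e)) (surf e) :=
      hs _ ((continuous_val f).mul ((continuous_grad φ).inner continuous_const))
    have hi2 : Integrable (fun x => inner ℝ (grad f x) (ν e) * val φ x) (surf e) :=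
      hs _ (((continuous_grad f).inner continuous_const).mul (continuous_val φ))
    rw [← integral_sub hi1 hi2]
    simp only [← integral_const_mul]
    rw [← integral_finsetSum _ fun i _ => (hs _ (continuous_val (Q i))).const_mul _]
    refine integral_congr_ae (Eventually.of_forall fun x => ?_)
    simp only [inner_grad, Finset.mul_sum, Finset.sum_mul, ← Finset.sum_sub_distrib]
    refine Finset.sum_congr rfl fun i _ => ?_
    simp only [hQ, val_sub, val_mul]
    ring
  have hi1 : IntegrableOn (fun x => val f x * val (lap φ) x) T :=
    hint _ ((continuous_val _).mul (continuous_val _))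
  have hi2 : IntegrableOn (fun x => val (lap f) x * val φ x) T :=
    hint _ ((continuous_val _).mul (continuous_val _))
  rw [integral_sub hi1 hi2, Finset.sum_sub_distrib] at h4
  linarith

end Green

/-! ### Elements of a mesh: flat boundary, jumps and the error representation -/

section MeshElements

variable {d : ℕ} {Ω : Set (E d)} (M : PolytopalMesh d Ω)

namespace PolytopalMesh

lemma mem_facesOf {T e : Set (E d)} : e ∈ M.facesOf T ↔ e ∈ M.faces ∧ e ⊆ frontier T := by
  classical
  exact Finset.mem_filter

lemma facesOf_polytope {T e : Set (E d)} (he : e ∈ M.facesOf T) : IsPolytope (d - 1) e :=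
  M.face_polytope e (M.mem_facesOf.1 he).1

lemma face_subset {T e : Set (E d)} (hT : T ∈ M.elems) (he : e ∈ M.facesOf T) : e ⊆ T :=
  (M.mem_facesOf.1 he).2.trans (M.elem_polytope T hT).isCompact.isClosed.frontier_subset

lemma face_nonempty {T e : Set (E d)} (he : e ∈ M.facesOf T) : e.Nonempty :=
  (M.facesOf_polytope he).connected.nonempty.mono intrinsicInterior_subset

lemma outward_eq (T e : Set (E d)) :
    M.outward T e = M.normal e ∨ M.outward T e = -M.normal e := by
  unfold outward
  split_ifs
  · exact Or.inl rfl
  · exact Or.inr rfl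

lemma surf_univ_lt_top {T e : Set (E d)} (he : e ∈ M.facesOf T) : surf e Set.univ < ⊤ := by
  rw [surf, Measure.restrict_apply_univ]
  exact (M.facesOf_polytope he).surf_lt_top

/-- The sign chosen in `outward` is right in both branches: where `M.normal e` fails, `one_sided`
leaves only the opposite normal. -/
lemma isFlatBoundary {T : Set (E d)} (hT : T ∈ M.elems) :
    IsFlatBoundary T (M.facesOf T) (M.outward T) where
  isCompact := (M.elem_polytope T hT).isCompact
  isCompact_face e he := (M.facesOf_polytope he).isCompact
  unit e he := by
    have h := M.normal_unit e (M.mem_facesOf.1 he).1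
    rcases M.outward_eq T e with h' | h' <;> simp [h', h]
  perp e he x hx y hy := by
    have h := M.normal_orth e (M.mem_facesOf.1 he).1 x hx y hy
    rcases M.outward_eq T e with h' | h' <;> simp [h', h]
  exists_face x hx := by
    obtain ⟨e, he, heT, hxe⟩ := M.bdry_faces T hT x hx
    exact ⟨e, M.mem_facesOf.2 ⟨he, heT⟩, hxe⟩
  disjoint e he e' he' hne :=
    M.face_disjoint e (M.mem_facesOf.1 he).1 e' (M.mem_facesOf.1 he').1 hne
  behind e he := by
    have h := M.one_sided T hT e (M.mem_facesOf.1 he).1 (M.mem_facesOf.1 he).2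
    unfold outward
    split_ifs with h'
    · exact h'
    · exact h.resolve_left h'

end PolytopalMesh

namespace WeakSpace

variable {M} {k p q : ℕ}

/-- The polynomial `v_0 - v_b`, for the face `e` of `T`. -/
def jump (v : WeakSpace M k p q) (T e : Set (E d)) : Poly d := v.v0 T - v.vb e

/-- The polynomial `(∇v_0 - v_n n_e)·n`, for the face `e` of `T`. -/
def fluxJump (v : WeakSpace M k p q) (T e : Set (E d)) : Poly d :=
  dirDeriv (v.v0 T) (M.outward T e) -
    MvPolynomial.C (inner ℝ (M.normal e) (M.outward T e)) * v.vn e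

lemma val_jump (v : WeakSpace M k p q) (T e : Set (E d)) (x : E d) :
    val (v.jump T e) x = val (v.v0 T) x - val (v.vb e) x := val_sub _ _ _

lemma val_fluxJump (v : WeakSpace M k p q) (T e : Set (E d)) (x : E d) :
    val (v.fluxJump T e) x =
      inner ℝ (grad (v.v0 T) x - val (v.vn e) x • M.normal e) (M.outward T e) := by
  rw [fluxJump, val_sub, val_dirDeriv, val_mul, val_C, inner_sub_left, real_inner_smul_left,
    mul_comm]

lemma totalDegree_jump_le (hpk : p ≤ k) (v : WeakSpace M k p q) {T e : Set (E d)}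
    (hT : T ∈ M.elems) (he : e ∈ M.facesOf T) : (v.jump T e).totalDegree ≤ k :=
  (MvPolynomial.totalDegree_sub _ _).trans
    (max_le (v.degree_v0 T hT) ((v.degree_vb e (M.mem_facesOf.1 he).1).trans hpk))

lemma totalDegree_fluxJump_le (hqk : q ≤ k) (v : WeakSpace M k p q) {T e : Set (E d)}
    (hT : T ∈ M.elems) (he : e ∈ M.facesOf T) : (v.fluxJump T e).totalDegree ≤ k := by
  refine (MvPolynomial.totalDegree_sub _ _).trans (max_le ?_ ?_)
  · have h1 := totalDegree_dirDeriv_le (v.v0 T) (M.outward T e)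
    have h2 := v.degree_v0 T hT
    omega
  · refine (MvPolynomial.totalDegree_mul _ _).trans ?_
    rw [MvPolynomial.totalDegree_C, zero_add]
    exact (v.degree_vn e (M.mem_facesOf.1 he).1).trans hqk

/-- The weak Laplacian of `v` in terms of `Δv_0` and of the jumps of `v` on the faces of `T`. -/
lemma lapForm_eq (hd : 0 < d) (v : WeakSpace M k p q) {T : Set (E d)} (hT : T ∈ M.elems)
    (φ : Poly d) :
    v.lapForm T φ = (∫ x in T, val (lap (v.v0 T)) x * val φ x)
      + (∑ e ∈ M.facesOf T,
          ∫ x, val (v.jump T e) x * inner ℝ (grad φ x) (M.outward T e) ∂(surf e))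
      - ∑ e ∈ M.facesOf T, ∫ x, val (v.fluxJump T e) x * val φ x ∂(surf e) := by
  have hB := M.isFlatBoundary hT
  have hg := hB.green hd (fun e he => M.face_subset hT he) (fun e he => M.surf_univ_lt_top he)
    (v.v0 T) φ
  have hs : ∀ e ∈ M.facesOf T, ∀ g : E d → ℝ, Continuous g → Integrable g (surf e) :=
    fun e he g hg => hB.integrable_surf he (M.surf_univ_lt_top he) hg
  have h1 : ∀ e ∈ M.facesOf T,
      ∫ x, val (v.jump T e) x * inner ℝ (grad φ x) (M.outward T e) ∂(surf e) =
        (∫ x, val (v.v0 T) x * inner ℝ (grad φ x) (M.outward T e) ∂(surf e))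
          - ∫ x, val (v.vb e) x * inner ℝ (grad φ x) (M.outward T e) ∂(surf e) := fun e he => by
    have hφ : Continuous fun x => inner ℝ (grad φ x) (M.outward T e) :=
      (continuous_grad φ).inner continuous_const
    have hi : ∀ P : Poly d,
        Integrable (fun x => val P x * inner ℝ (grad φ x) (M.outward T e)) (surf e) :=
      fun P => hs e he _ ((continuous_val P).mul hφ)
    rw [← integral_sub (hi _) (hi _)]
    simp only [val_jump, sub_mul]
  have h2 : ∀ e ∈ M.facesOf T, ∫ x, val (v.fluxJump T e) x * val φ x ∂(surf e) =
        (∫ x, inner ℝ (grad (v.v0 T) x) (M.outward T e) * val φ x ∂(surf e))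
          - ∫ x, val (v.vn e) x * inner ℝ (M.normal e) (M.outward T e) * val φ x ∂(surf e) :=
    fun e he => by
    have hi1 : Integrable (fun x => inner ℝ (grad (v.v0 T) x) (M.outward T e) * val φ x) (surf e) :=
      hs e he _ (((continuous_grad _).inner continuous_const).mul (continuous_val φ))
    have hi2 : Integrable (fun x => val (v.vn e) x * inner ℝ (M.normal e) (M.outward T e) *
        val φ x) (surf e) :=
      hs e he _ (((continuous_val _).mul continuous_const).mul (continuous_val φ))
    rw [← integral_sub hi1 hi2]
    simp only [val_fluxJump, inner_sub_left, real_inner_smul_left, sub_mul]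
  rw [lapForm, hg, Finset.sum_congr rfl h1, Finset.sum_congr rfl h2, Finset.sum_sub_distrib,
    Finset.sum_sub_distrib]
  ring

end WeakSpace

end MeshElements

/-! ### Normalised norms on an element and on its faces -/

section Norms

variable {d : ℕ}

lemma abs_integral_mul_le {μ : Measure (E d)} {f g : E d → ℝ} (hf : Integrable (fun x => f x ^ 2) μ)
    (hfg : Integrable (fun x => f x * g x) μ) (hg : Integrable (fun x => g x ^ 2) μ) :
    |∫ x, f x * g x ∂μ| ≤ normL2 μ f * normL2 μ g := by
  have h1 : ∀ t : ℝ, 0 ≤ (∫ x, f x ^ 2 ∂μ) * (t * t) + (2 * ∫ x, f x * g x ∂μ) * t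
      + ∫ x, g x ^ 2 ∂μ := fun t => by
    have h2 : ∫ x, (t * f x + g x) ^ 2 ∂μ = (∫ x, f x ^ 2 ∂μ) * (t * t)
        + (2 * ∫ x, f x * g x ∂μ) * t + ∫ x, g x ^ 2 ∂μ := by
      have h3 : ∀ x, (t * f x + g x) ^ 2 = (t * t) * f x ^ 2 + (2 * t) * (f x * g x) + g x ^ 2 :=
        fun x => by ring
      have hi : Integrable (fun x => (t * t) * f x ^ 2 + (2 * t) * (f x * g x)) μ := (hf.const_mul (t * t)).add (hfg.const_mul (2 * t))
      simp only [h3]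
      rw [integral_add (hf := hi) (hg := hg),
        integral_add (hf := hf.const_mul _) (hg := hfg.const_mul _), integral_const_mul,
        integral_const_mul]
      ring
    rw [← h2]
    exact integral_nonneg fun x => sq_nonneg _
  have h2 := discrim_le_zero h1
  rw [discrim] at h2
  have hf0 : 0 ≤ ∫ x, f x ^ 2 ∂μ := integral_nonneg fun x => sq_nonneg _
  rw [normL2, normL2, ← Real.sqrt_mul hf0, ← Real.sqrt_sq_eq_abs]
  exact Real.sqrt_le_sqrt (by nlinarith)

/-- The norm of `L²(μ)`, where `s` is the reference value of the total mass of `μ`. -/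
def rms (μ : Measure (E d)) (s : ℝ) (f : E d → ℝ) : ℝ := normL2 μ f / √s

lemma rms_nonneg (μ : Measure (E d)) (s : ℝ) (f : E d → ℝ) : 0 ≤ rms μ s f :=
  div_nonneg (Real.sqrt_nonneg _) (Real.sqrt_nonneg _)

lemma integral_sq_eq (μ : Measure (E d)) {s : ℝ} (hs : 0 < s) (f : E d → ℝ) :
    ∫ x, f x ^ 2 ∂μ = s * rms μ s f ^ 2 := by
  rw [rms, normL2, div_pow, Real.sq_sqrt hs.le, Real.sq_sqrt (integral_nonneg fun x => sq_nonneg _)]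
  field_simp

/-- Cauchy-Schwarz in normalised form: one factor is measured by its mean square, the other by its
maximum, so that powers of `h` appear explicitly as `s`. -/
lemma abs_integral_mul_le_rms {μ : Measure (E d)} [IsFiniteMeasure μ] {C s : ℝ} (hC : 0 ≤ C)
    (hs : 0 < s) (hμ : μ.real Set.univ ≤ C ^ 2 * s) {f g : E d → ℝ}
    (hf : Integrable (fun x => f x ^ 2) μ) (hfg : Integrable (fun x => f x * g x) μ)
    (hg : Integrable (fun x => g x ^ 2) μ) {B : ℝ} (hB : 0 ≤ B) (hgB : ∀ᵐ x ∂μ, |g x| ≤ B) :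
    |∫ x, f x * g x ∂μ| ≤ C * s * rms μ s f * B := by
  have hsq : 0 < √s := Real.sqrt_pos.2 hs
  have h1 : normL2 μ f = √s * rms μ s f := by rw [rms]; field_simp
  have h2 : normL2 μ g ≤ √s * C * B := by
    refine Real.sqrt_le_iff.2 ⟨by positivity, ?_⟩
    calc ∫ x, g x ^ 2 ∂μ ≤ ∫ _, B ^ 2 ∂μ := by
          refine integral_mono_ae hg (integrable_const _) ?_
          filter_upwards [hgB] with x hx
          rw [← sq_abs]
          exact pow_le_pow_left₀ (abs_nonneg _) hx 2
      _ = μ.real Set.univ * B ^ 2 := by simp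
      _ ≤ C ^ 2 * s * B ^ 2 := by gcongr
      _ = (√s * C * B) ^ 2 := by rw [mul_pow, mul_pow, Real.sq_sqrt hs.le]; ring
  refine (abs_integral_mul_le hf hfg hg).trans ?_
  calc normL2 μ f * normL2 μ g ≤ √s * rms μ s f * (√s * C * B) := by
        rw [h1]
        have := rms_nonneg μ s f
        gcongr
    _ = C * (√s * √s) * rms μ s f * B := by ring
    _ = C * s * rms μ s f * B := by rw [Real.mul_self_sqrt hs.le]

/-- A bounded element of diameter at most `h` with at most `N` flat faces, whose volume is at least
`ρ h ^ d` and whose faces have area at least `ρ h ^ (d - 1)`. -/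
structure IsRegularElement (T : Set (E d)) (F : Finset (Set (E d))) (ν : Set (E d) → E d) (h : ℝ)
    (N : ℕ) (ρ : ℝ) : Prop extends IsFlatBoundary T F ν where
  h_pos : 0 < h
  dist_le : ∀ x ∈ T, ∀ y ∈ T, ‖x - y‖ ≤ h
  face_subset : ∀ e ∈ F, e ⊆ T
  face_nonempty : ∀ e ∈ F, e.Nonempty
  card_le : F.card ≤ N
  volume_ge : ρ * h ^ d ≤ volume.real T
  surf_ge : ∀ e ∈ F, ρ * h ^ (d - 1) ≤ (surf e).real Set.univ

lemma preimage_isometry_subset {m : ℕ} (J : E m →ₗᵢ[ℝ] E d) {z : E d} {e : Set (E d)} {h : ℝ}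
    (he : e ⊆ Metric.closedBall z h) : (fun y => z + J y) ⁻¹' e ⊆ Metric.closedBall 0 h :=
  fun y hy => by
    have h1 := he hy
    rw [mem_closedBall_iff_norm, add_sub_cancel_left, J.norm_map] at h1
    rwa [mem_closedBall_zero_iff]

lemma volume_real_closedBall (m : ℕ) (x : E m) {h : ℝ} (hh : 0 ≤ h) :
    volume.real (Metric.closedBall x h) = h ^ m * volume.real (Metric.ball (0 : E m) 1) := by
  rw [Measure.real, Measure.addHaar_closedBall _ _ hh, ENNReal.toReal_mul,
    ENNReal.toReal_ofReal (by positivity), finrank_euclideanSpace_fin]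
  rfl

lemma surf_univ_eq {n z : E d} {J : E (d - 1) →ₗᵢ[ℝ] E d}
    (hJ' : ∀ w, inner ℝ n w = 0 → ∃ y, J y = w) {e : Set (E d)} (he : MeasurableSet e)
    (hez : ∀ x ∈ e, inner ℝ n (x - z) = 0) :
    surf e Set.univ = volume ((fun y => z + J y) ⁻¹' e) := by
  rw [surfReal_eq hJ' he MeasurableSet.univ hez, Set.univ_inter]

/-- Lower bound for the surface integral of the square of a product of polynomials. -/
lemma integral_surf_prod_sq_ge (hd : 0 < d) (k N : ℕ) {μ : ℝ} (hμ : 0 < μ) : ∃ c : ℝ, 0 < c ∧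
    ∀ (n z : E d) (h : ℝ), ‖n‖ = 1 → 0 < h → ∀ e : Set (E d), MeasurableSet e →
    (∀ x ∈ e, inner ℝ n (x - z) = 0) → e ⊆ Metric.closedBall z h →
    μ * h ^ (d - 1) ≤ (surf e).real Set.univ →
    ∀ {ι : Type} (I : Finset ι), I.card ≤ N → ∀ P : ι → Poly d, (∀ i ∈ I, (P i).totalDegree ≤ k) →
    ∀ y : ι → E d, (∀ i ∈ I, y i ∈ Metric.closedBall z h ∧ inner ℝ n (y i - z) = 0) →
      c * h ^ (d - 1) * ∏ i ∈ I, val (P i) (y i) ^ 2 ≤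
        ∫ x, ∏ i ∈ I, val (P i) x ^ 2 ∂(surf e) := by
  obtain ⟨c, hc, hmain⟩ := integral_prod_sq_ge (d - 1) k N hμ
  refine ⟨c, hc, fun n z h hn hh e he hez heB harea ι I hI P hP y hy => ?_⟩
  obtain ⟨J, hJ, hJ'⟩ := exists_hyperplane_isometry hd hn
  have hιc : Continuous (fun y => z + J y) := by fun_prop
  rw [integral_surf hJ' he hez]
  rw [Measure.real, surf_univ_eq hJ' he hez] at harea
  have hex : ∀ i, ∃ w : E (d - 1), i ∈ I → w ∈ Metric.closedBall 0 h ∧ z + J w = y i := by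
    intro i
    by_cases hi : i ∈ I
    · obtain ⟨w, hw⟩ := hJ' _ (hy i hi).2
      refine ⟨w, fun _ => ⟨?_, by rw [hw]; abel⟩⟩
      have h1 := (hy i hi).1
      rwa [mem_closedBall_iff_norm, ← hw, J.norm_map, ← mem_closedBall_zero_iff] at h1
    · exact ⟨0, fun h => absurd h hi⟩
  choose w hw using hex
  have h2 := hmain 0 h hh _ (hιc.measurable he) (preimage_isometry_subset J heB) harea I hI
    (fun i => compAffine (P i) z J.toContinuousLinearMap)
    (fun i hi => (totalDegree_compAffine_le _ _ _).trans (hP i hi)) w (fun i hi => (hw i hi).1)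
  simp only [val_compAffine, LinearIsometry.coe_toContinuousLinearMap] at h2
  rwa [Finset.prod_congr rfl fun i hi => by rw [(hw i hi).2]] at h2

namespace IsRegularElement

variable {T : Set (E d)} {F : Finset (Set (E d))} {ν : Set (E d) → E d} {h ρ : ℝ} {N : ℕ}

lemma subset_closedBall (hR : IsRegularElement T F ν h N ρ) {z : E d} (hz : z ∈ T) :
    T ⊆ Metric.closedBall z h := fun x hx => by
  rw [mem_closedBall_iff_norm]; exact hR.dist_le x hx z hz

lemma measurableSet (hR : IsRegularElement T F ν h N ρ) : MeasurableSet T :=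
  hR.isCompact.isClosed.measurableSet

lemma measurableSet_face (hR : IsRegularElement T F ν h N ρ) {e : Set (E d)} (he : e ∈ F) :
    MeasurableSet e := (hR.isCompact_face e he).isClosed.measurableSet

lemma ae_mem_face (hR : IsRegularElement T F ν h N ρ) {e : Set (E d)} (he : e ∈ F) :
    ∀ᵐ x ∂(surf e), x ∈ e := ae_restrict_mem (hR.measurableSet_face he)

lemma surf_le (hd : 0 < d) (hR : IsRegularElement T F ν h N ρ) {e : Set (E d)} (he : e ∈ F) :
    surf e Set.univ ≤
      ENNReal.ofReal (h ^ (d - 1) * volume.real (Metric.ball (0 : E (d - 1)) 1)) := by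
  obtain ⟨z, hz⟩ := hR.face_nonempty e he
  obtain ⟨J, hJ, hJ'⟩ := exists_hyperplane_isometry hd (hR.unit e he)
  rw [surf_univ_eq hJ' (hR.measurableSet_face he) fun x hx => hR.perp e he x hx z hz]
  refine (measure_mono (preimage_isometry_subset J
    ((hR.face_subset e he).trans (hR.subset_closedBall (hR.face_subset e he hz))))).trans ?_
  rw [← volume_real_closedBall _ (0 : E (d - 1)) hR.h_pos.le, Measure.real,
    ENNReal.ofReal_toReal measure_closedBall_lt_top.ne]

lemma isFiniteMeasure_surf (hd : 0 < d) (hR : IsRegularElement T F ν h N ρ) {e : Set (E d)}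
    (he : e ∈ F) : IsFiniteMeasure (surf e) :=
  ⟨(hR.surf_le hd he).trans_lt ENNReal.ofReal_lt_top⟩

lemma integrable_face (hd : 0 < d) (hR : IsRegularElement T F ν h N ρ) {e : Set (E d)}
    (he : e ∈ F) {f : E d → ℝ} (hf : Continuous f) : Integrable f (surf e) :=
  hR.toIsFlatBoundary.integrable_surf he ((hR.surf_le hd he).trans_lt ENNReal.ofReal_lt_top) hf

end IsRegularElement

/-- Bounds for the integrals over a regular element and over its faces. -/
lemma exists_integral_bound (hd : 0 < d) : ∃ C : ℝ, 1 ≤ C ∧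
    ∀ (T : Set (E d)) (F : Finset (Set (E d))) (ν : Set (E d) → E d) (h ρ : ℝ) (N : ℕ),
    IsRegularElement T F ν h N ρ →
    (∀ f g : E d → ℝ, Continuous f → Continuous g → ∀ B, 0 ≤ B → (∀ x ∈ T, |g x| ≤ B) →
      |∫ x in T, f x * g x| ≤ C * h ^ d * rms (volume.restrict T) (h ^ d) f * B) ∧
    ∀ e ∈ F, ∀ f g : E d → ℝ, Continuous f → Continuous g → ∀ B, 0 ≤ B →
      (∀ᵐ x ∂(surf e), |g x| ≤ B) →
      |∫ x, f x * g x ∂(surf e)| ≤ C * h ^ (d - 1) * rms (surf e) (h ^ (d - 1)) f * B := by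
  set V := volume.real (Metric.ball (0 : E d) 1)
  set V' := volume.real (Metric.ball (0 : E (d - 1)) 1)
  have hV : 0 ≤ V := measureReal_nonneg
  have hV' : 0 ≤ V' := measureReal_nonneg
  refine ⟨1 + V + V', by linarith, fun T F ν h ρ N hR => ⟨fun f g hf hg B hB hgB => ?_,
    fun e he f g hf hg B hB hgB => ?_⟩⟩
  · have hint : ∀ u : E d → ℝ, Continuous u → IntegrableOn u T := fun u hu =>
      integrableOn_of_continuous hu hR.isCompact
    have : IsFiniteMeasure (volume.restrict T) :=
      isFiniteMeasure_restrict.2 hR.isCompact.measure_lt_top.ne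
    refine abs_integral_mul_le_rms (by positivity) (pow_pos hR.h_pos d) ?_ (hint _ (hf.pow 2))
      (hint _ (hf.mul hg)) (hint _ (hg.pow 2)) hB (ae_restrict_of_forall_mem hR.measurableSet hgB)
    rw [measureReal_restrict_apply_univ]
    have hpos := pow_pos hR.h_pos d
    rcases T.eq_empty_or_nonempty with rfl | ⟨z, hz⟩
    · simp only [measureReal_empty]; positivity
    · calc volume.real T ≤ volume.real (Metric.closedBall z h) :=
            measureReal_mono (hR.subset_closedBall hz) measure_closedBall_lt_top.ne
        _ = V * h ^ d := by rw [volume_real_closedBall _ _ hR.h_pos.le, mul_comm]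
        _ ≤ (1 + V + V') ^ 2 * h ^ d := by gcongr; nlinarith
  · have := hR.isFiniteMeasure_surf hd he
    refine abs_integral_mul_le_rms (by positivity) (pow_pos hR.h_pos _) ?_
      (hR.integrable_face hd he (hf.pow 2)) (hR.integrable_face hd he (hf.mul hg))
      (hR.integrable_face hd he (hg.pow 2)) hB hgB
    have hpos := pow_pos hR.h_pos (d - 1)
    have h1 := ENNReal.toReal_mono ENNReal.ofReal_ne_top (hR.surf_le hd he)
    rw [ENNReal.toReal_ofReal (by positivity)] at h1
    refine h1.trans ?_
    change h ^ (d - 1) * V' ≤ _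
    rw [mul_comm]
    gcongr
    nlinarith

/-- Polynomials of bounded degree are bounded near an element or face by their normalised norm. -/
lemma exists_sup_bound (hd : 0 < d) (k : ℕ) {ρ : ℝ} (hρ : 0 < ρ) : ∃ C : ℝ, 1 ≤ C ∧
    ∀ (T : Set (E d)) (F : Finset (Set (E d))) (ν : Set (E d) → E d) (h : ℝ) (N : ℕ),
    IsRegularElement T F ν h N ρ → ∀ P : Poly d, P.totalDegree ≤ k →
    (∀ z ∈ T, ∀ x ∈ Metric.closedBall z h,
      |val P x| ≤ C * rms (volume.restrict T) (h ^ d) (val P)) ∧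
    ∀ e ∈ F, ∀ z ∈ e, ∀ x ∈ Metric.closedBall z h, inner ℝ (ν e) (x - z) = 0 →
      |val P x| ≤ C * rms (surf e) (h ^ (d - 1)) (val P) := by
  obtain ⟨c₁, hc₁, h₁⟩ := integral_prod_sq_ge d k 1 hρ
  obtain ⟨c₂, hc₂, h₂⟩ := integral_surf_prod_sq_ge hd k 1 hρ
  -- The lower bound for integrals of squares is used with a single factor. The point `x` need only
  -- lie in the ball, not in the element or the face; this is what allows test functions to be
  -- estimated off the face on which they are built.
  have key : ∀ (μ : Measure (E d)) (c s : ℝ) (P : Poly d) (x : E d), 0 < c → 0 < s →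
      c * s * val P x ^ 2 ≤ ∫ x, val P x ^ 2 ∂μ → |val P x| ≤ (√c)⁻¹ * rms μ s (val P) := by
    intro μ c s P x hc hs h
    rw [integral_sq_eq μ hs] at h
    have h3 : (√c * |val P x|) ^ 2 ≤ rms μ s (val P) ^ 2 := by
      rw [mul_pow, Real.sq_sqrt hc.le, sq_abs]
      nlinarith
    have h4 := abs_le_of_sq_le_sq h3 (rms_nonneg _ _ _)
    rw [inv_mul_eq_div, le_div_iff₀ (Real.sqrt_pos.2 hc), mul_comm]
    exact (le_abs_self _).trans h4
  refine ⟨1 + (√c₁)⁻¹ + (√c₂)⁻¹, by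
    have := Real.sqrt_nonneg c₁
    have := Real.sqrt_nonneg c₂
    have := inv_nonneg.2 (Real.sqrt_nonneg c₁)
    have := inv_nonneg.2 (Real.sqrt_nonneg c₂)
    linarith, fun T F ν h N hR P hP => ⟨fun z hz x hx => ?_, fun e he z hz x hx hxz => ?_⟩⟩
  · have h3 := h₁ z h hR.h_pos T hR.measurableSet (hR.subset_closedBall hz) hR.volume_ge
      ({()} : Finset Unit) (by simp) (fun _ => P) (fun _ _ => hP) (fun _ => x) (fun _ _ => hx)
    simp only [Finset.prod_singleton] at h3
    refine (key _ _ _ P x hc₁ (pow_pos hR.h_pos _) h3).trans ?_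
    gcongr
    · exact rms_nonneg _ _ _
    · have := inv_nonneg.2 (Real.sqrt_nonneg c₂)
      linarith
  · have h3 := h₂ (ν e) z h (hR.unit e he) hR.h_pos e (hR.measurableSet_face he)
      (fun x hx => hR.perp e he x hx z hz)
      ((hR.face_subset e he).trans (hR.subset_closedBall (hR.face_subset e he hz)))
      (hR.surf_ge e he) ({()} : Finset Unit) (by simp) (fun _ => P) (fun _ _ => hP) (fun _ => x)
      (fun _ _ => ⟨hx, hxz⟩)
    simp only [Finset.prod_singleton] at h3
    refine (key _ _ _ P x hc₂ (pow_pos hR.h_pos _) h3).trans ?_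
    gcongr
    · exact rms_nonneg _ _ _
    · have := inv_nonneg.2 (Real.sqrt_nonneg c₁)
      linarith

/-- The polynomial that is constant in the direction `n` and equals `P` on the hyperplane through
`z` orthogonal to `n`. -/
def flatten (P : Poly d) (n z : E d) : Poly d :=
  compAffine P (inner ℝ n z • n) (ContinuousLinearMap.id ℝ (E d) - (innerSL ℝ n).smulRight n)

lemma val_flatten (P : Poly d) (n z x : E d) :
    val (flatten P n z) x = val P (x - inner ℝ n (x - z) • n) := by
  rw [flatten, val_compAffine]
  congr 1
  simp [inner_sub_right, sub_smul]
  abel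

lemma val_flatten_of_inner_eq_zero (P : Poly d) {n z x : E d} (hx : inner ℝ n (x - z) = 0) :
    val (flatten P n z) x = val P x := by
  rw [val_flatten, hx, zero_smul, sub_zero]

lemma totalDegree_flatten_le (P : Poly d) (n z : E d) :
    (flatten P n z).totalDegree ≤ P.totalDegree := totalDegree_compAffine_le _ _ _

lemma inner_grad_flatten (P : Poly d) {n : E d} (hn : ‖n‖ = 1) (z x : E d) :
    inner ℝ (grad (flatten P n z) x) n = 0 := by
  rw [flatten, inner_grad_compAffine]
  simp [hn]

/-- Orthogonal projection onto the hyperplane through `z` does not increase the distance to `z`.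
Thus bounds on the hyperplane part of the ball pass to `flatten` on the whole ball. -/
lemma flatten_point {n : E d} (hn : ‖n‖ = 1) {z x : E d} {h : ℝ} (hx : x ∈ Metric.closedBall z h) :
    x - inner ℝ n (x - z) • n ∈ Metric.closedBall z h ∧
      inner ℝ n (x - inner ℝ n (x - z) • n - z) = 0 := by
  rw [mem_closedBall_iff_norm] at hx ⊢
  rw [sub_right_comm]
  set y := x - z
  constructor
  · refine le_trans (abs_le_of_sq_le_sq' ?_ (norm_nonneg y)).2 hx
    rw [norm_sub_sq_real, real_inner_smul_right, norm_smul, hn, mul_one, Real.norm_eq_abs, sq_abs,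
      real_inner_comm n y]
    nlinarith [sq_nonneg (inner ℝ n y)]
  · rw [inner_sub_right, real_inner_smul_right, real_inner_self_eq_norm_sq, hn]; ring

end Norms

/-! ### Estimates of the jumps by means of localised test functions -/

section Localisation

variable {d : ℕ}

/-- The functionals given by `w` on one side and by `g`, `a`, `b` on the other side agree on the
polynomials of degree at most `D`. -/
def Represents (T : Set (E d)) (F : Finset (Set (E d))) (ν : Set (E d) → E d) (D : ℕ)
    (w g : Poly d) (a b : Set (E d) → Poly d) : Prop :=
  ∀ φ : Poly d, φ.totalDegree ≤ D → ∫ x in T, val w x * val φ x =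
    (∫ x in T, val g x * val φ x)
      + (∑ e ∈ F, ∫ x, val (a e) x * inner ℝ (grad φ x) (ν e) ∂(surf e))
      - ∑ e ∈ F, ∫ x, val (b e) x * val φ x ∂(surf e)

/-- The normalised norm on the element `T`. -/
def rmsElem (T : Set (E d)) (h : ℝ) (P : Poly d) : ℝ := rms (volume.restrict T) (h ^ d) (val P)

/-- The normalised norm on the face `e`. -/
def rmsFace (e : Set (E d)) (h : ℝ) (P : Poly d) : ℝ := rms (surf e) (h ^ (d - 1)) (val P)

lemma rmsElem_nonneg (T : Set (E d)) (h : ℝ) (P : Poly d) : 0 ≤ rmsElem T h P := rms_nonneg _ _ _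

lemma rmsFace_nonneg (e : Set (E d)) (h : ℝ) (P : Poly d) : 0 ≤ rmsFace e h P := rms_nonneg _ _ _

/-- The scaled sum of the norms of the jumps. -/
def jumpSum (F : Finset (Set (E d))) (h : ℝ) (a b : Set (E d) → Poly d) : ℝ :=
  ∑ e ∈ F, (rmsFace e h (a e) + h * rmsFace e h (b e))

/-- All terms of the error representation except those of `e` are moved to one side. `B₁` measures
the test function inside `T`, `B₂` on the other faces; keeping them apart is what later lets the
other jumps be absorbed. -/
lemma exists_test_bound (hd : 0 < d) : ∃ C : ℝ, 1 ≤ C ∧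
    ∀ (T : Set (E d)) (F : Finset (Set (E d))) (ν : Set (E d) → E d) (h ρ : ℝ) (N : ℕ),
    IsRegularElement T F ν h N ρ → ∀ (D : ℕ) (w g : Poly d) (a b : Set (E d) → Poly d),
    Represents T F ν D w g a b → ∀ φ : Poly d, φ.totalDegree ≤ D → ∀ e ∈ F, ∀ B₁ B₂ : ℝ,
    0 ≤ B₁ → 0 ≤ B₂ → (∀ x ∈ T, |val φ x| ≤ B₁) →
    (∀ e' ∈ F, e' ≠ e → ∀ᵐ x ∂(surf e'), |val φ x| ≤ B₂ ∧ ‖grad φ x‖ ≤ B₂ / h) →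
    |(∫ x, val (a e) x * inner ℝ (grad φ x) (ν e) ∂(surf e))
        - ∫ x, val (b e) x * val φ x ∂(surf e)| ≤
      C * (h ^ (d - 1) * (h * (rmsElem T h w + rmsElem T h g) * B₁
        + h⁻¹ * jumpSum F h a b * B₂)) := by
  obtain ⟨C, hC, hint⟩ := exists_integral_bound hd
  refine ⟨C, hC, fun T F ν h ρ N hR D w g a b hrep φ hφ e he B₁ B₂ hB₁ hB₂ hT hF => ?_⟩
  obtain ⟨hintT, hintF⟩ := hint T F ν h ρ N hR
  have hh := hR.h_pos
  have hpow : h ^ d = h ^ (d - 1) * h := by rw [← pow_succ, Nat.sub_add_cancel hd]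
  have h1 := hrep φ hφ
  rw [← Finset.add_sum_erase F _ he, ← Finset.add_sum_erase F _ he] at h1
  have hw := hintT (val w) (val φ) (continuous_val _) (continuous_val _) B₁ hB₁ hT
  have hg := hintT (val g) (val φ) (continuous_val _) (continuous_val _) B₁ hB₁ hT
  change _ ≤ C * h ^ d * rmsElem T h w * B₁ at hw
  change _ ≤ C * h ^ d * rmsElem T h g * B₁ at hg
  have hcg : ∀ e', Continuous fun x => inner ℝ (grad φ x) (ν e') := fun e' =>
    (continuous_grad φ).inner continuous_const
  have ha : ∀ e' ∈ F.erase e, |∫ x, val (a e') x * inner ℝ (grad φ x) (ν e') ∂(surf e')| ≤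
      C * h ^ (d - 1) * rmsFace e' h (a e') * (B₂ / h) := fun e' he' => by
    rw [Finset.mem_erase] at he'
    refine hintF e' he'.2 _ _ (continuous_val _) (hcg e') (B₂ / h) (by positivity) ?_
    filter_upwards [hF e' he'.2 he'.1] with x hx
    refine (abs_real_inner_le_norm _ _).trans ?_
    rw [hR.unit e' he'.2, mul_one]
    exact hx.2
  have hb : ∀ e' ∈ F.erase e, |∫ x, val (b e') x * val φ x ∂(surf e')| ≤
      C * h ^ (d - 1) * rmsFace e' h (b e') * B₂ := fun e' he' => by
    rw [Finset.mem_erase] at he'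
    refine hintF e' he'.2 _ _ (continuous_val _) (continuous_val φ) B₂ hB₂ ?_
    filter_upwards [hF e' he'.2 he'.1] with x hx using hx.1
  have hsum : |∑ e' ∈ F.erase e, ∫ x, val (a e') x * inner ℝ (grad φ x) (ν e') ∂(surf e')|
      + |∑ e' ∈ F.erase e, ∫ x, val (b e') x * val φ x ∂(surf e')| ≤
      C * (h ^ (d - 1) * (h⁻¹ * jumpSum F h a b * B₂)) := by
    refine (add_le_add ((Finset.abs_sum_le_sum_abs _ _).trans (Finset.sum_le_sum ha))
      ((Finset.abs_sum_le_sum_abs _ _).trans (Finset.sum_le_sum hb))).trans ?_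
    rw [← Finset.sum_add_distrib]
    have h2 : ∀ e', C * h ^ (d - 1) * rmsFace e' h (a e') * (B₂ / h)
        + C * h ^ (d - 1) * rmsFace e' h (b e') * B₂ =
        (C * (h ^ (d - 1) * (h⁻¹ * B₂))) * (rmsFace e' h (a e') + h * rmsFace e' h (b e')) :=
      fun e' => by field_simp
    simp only [h2]
    rw [← Finset.mul_sum]
    have h3 : ∑ e' ∈ F.erase e, (rmsFace e' h (a e') + h * rmsFace e' h (b e')) ≤ jumpSum F h a b :=
      Finset.sum_le_sum_of_subset_of_nonneg (Finset.erase_subset _ _) fun i _ _ =>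
        add_nonneg (rmsFace_nonneg _ _ _) (mul_nonneg hh.le (rmsFace_nonneg _ _ _))
    calc _ ≤ (C * (h ^ (d - 1) * (h⁻¹ * B₂))) * jumpSum F h a b := by gcongr
      _ = _ := by ring
  have e1 : (∫ x, val (a e) x * inner ℝ (grad φ x) (ν e) ∂(surf e))
        - ∫ x, val (b e) x * val φ x ∂(surf e) =
      (∫ x in T, val w x * val φ x) - (∫ x in T, val g x * val φ x)
        - (∑ e' ∈ F.erase e, ∫ x, val (a e') x * inner ℝ (grad φ x) (ν e') ∂(surf e'))
        + ∑ e' ∈ F.erase e, ∫ x, val (b e') x * val φ x ∂(surf e') := by linarith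
  rw [e1]
  have e2 : C * (h ^ (d - 1) * (h * (rmsElem T h w + rmsElem T h g) * B₁
        + h⁻¹ * jumpSum F h a b * B₂)) = C * h ^ d * rmsElem T h w * B₁
        + C * h ^ d * rmsElem T h g * B₁ + C * (h ^ (d - 1) * (h⁻¹ * jumpSum F h a b * B₂)) := by
    rw [hpow]; ring
  rw [e2]
  rw [abs_le] at hw hg ⊢
  have hA := abs_le.1 (le_refl |∑ e' ∈ F.erase e,
    ∫ x, val (a e') x * inner ℝ (grad φ x) (ν e') ∂(surf e')|)
  have hB := abs_le.1 (le_refl |∑ e' ∈ F.erase e, ∫ x, val (b e') x * val φ x ∂(surf e')|)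
  constructor <;> linarith

/-- The polynomial `ψ` singles out the face `e`: it is positive enough on `e`, and at most `η` on
the other faces. -/
structure IsLocalizer (T : Set (E d)) (F : Finset (Set (E d))) (ν : Set (E d) → E d) (h : ℝ)
    (k : ℕ) (c₀ K₀ K η : ℝ) (e : Set (E d)) (ψ : Poly d) : Prop where
  lower : ∀ P : Poly d, P.totalDegree ≤ k →
    c₀ * ∫ x, val P x ^ 2 ∂(surf e) ≤ ∫ x, val ψ x * val P x ^ 2 ∂(surf e)
  bound : ∀ x ∈ T, |val ψ x| ≤ K
  normal_deriv : ∀ x ∈ e, |inner ℝ (grad ψ x) (ν e)| ≤ K₀ / h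
  small : ∀ e' ∈ F, e' ≠ e → ∀ᵐ x ∂(surf e'), |val ψ x| ≤ η ∧ ‖grad ψ x‖ ≤ η / h

/-- Two test functions, both cut off by `ψ`. For `a`: its extension constant along the normal, times
the scaled distance to `e`; this vanishes on `e` and has normal derivative `h⁻¹ a ψ` there. For `b`:
its extension constant along the normal; on `e` its product with `ψ` has normal derivative `b
∂ψ/∂n`, which costs the term with `K₀`. The degree `k + 1 + deg ψ` comes from the distance factor of
the first. -/
lemma exists_localizer_face_bound (hd : 0 < d) (k : ℕ) {ρ : ℝ} (hρ : 0 < ρ) : ∃ C : ℝ, 1 ≤ C ∧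
    ∀ (T : Set (E d)) (F : Finset (Set (E d))) (ν : Set (E d) → E d) (h : ℝ) (N : ℕ),
    IsRegularElement T F ν h N ρ → ∀ (D : ℕ) (w g : Poly d) (a b : Set (E d) → Poly d),
    (∀ e ∈ F, (a e).totalDegree ≤ k ∧ (b e).totalDegree ≤ k) →
    ∀ e ∈ F, ∀ (ψ : Poly d) (c₀ K₀ K η : ℝ), 0 ≤ K₀ → 0 ≤ K → 0 ≤ η →
    IsLocalizer T F ν h k c₀ K₀ K η e ψ → ψ.totalDegree + k + 1 ≤ D →
    Represents T F ν D w g a b →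
    c₀ * rmsFace e h (a e) ≤ C * (K * (h ^ 2 * (rmsElem T h w + rmsElem T h g))
      + η * jumpSum F h a b) ∧
    c₀ * (h * rmsFace e h (b e)) ≤ C * (K * (h ^ 2 * (rmsElem T h w + rmsElem T h g))
      + K₀ * rmsFace e h (a e) + η * jumpSum F h a b) := by
  obtain ⟨C₁, hC₁, htest⟩ := exists_test_bound hd
  obtain ⟨C₂, hC₂, hsup⟩ := exists_sup_bound hd k hρ
  obtain ⟨C₃, hC₃, hmarkov⟩ := norm_grad_le d (k + 1)
  obtain ⟨C₄, hC₄, hint⟩ := exists_integral_bound hd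
  have hCge : 1 ≤ C₁ * C₂ * (C₃ + 1) := by
    have h1 : 1 ≤ C₁ * C₂ := one_le_mul_of_one_le_of_one_le hC₁ hC₂
    exact one_le_mul_of_one_le_of_one_le h1 (by linarith)
  refine ⟨C₁ * C₂ * (C₃ + 1) + C₄ * C₂, by nlinarith, fun T F ν h N hR D w g a b hab e he ψ c₀ K₀ K
    η hK₀ hK hη hψ hD hrep => ?_⟩
  have hh := hR.h_pos
  have hn := hR.unit e he
  have hnn : inner ℝ (ν e) (ν e) = 1 := by rw [real_inner_self_eq_norm_sq, hn, one_pow]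
  obtain ⟨z, hz⟩ := hR.face_nonempty e he
  have hez : ∀ x ∈ e, inner ℝ (ν e) (x - z) = 0 := fun x hx => hR.perp e he x hx z hz
  have hTz := hR.subset_closedBall (hR.face_subset e he hz)
  have hs : 0 < h ^ (d - 1) := pow_pos hh _
  set s := h ^ (d - 1) with hsdef
  set X := rmsElem T h w + rmsElem T h g with hX
  have hX0 : 0 ≤ X := add_nonneg (rmsElem_nonneg _ _ _) (rmsElem_nonneg _ _ _)
  set S := jumpSum F h a b with hS
  have hS0 : 0 ≤ S := Finset.sum_nonneg fun i _ =>
    add_nonneg (rmsFace_nonneg _ _ _) (mul_nonneg hh.le (rmsFace_nonneg _ _ _))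
  have hflat : ∀ P : Poly d, P.totalDegree ≤ k → ∀ x ∈ Metric.closedBall z h,
      |val (flatten P (ν e) z) x| ≤ C₂ * rmsFace e h P := fun P hP x hx => by
    rw [val_flatten]
    have h1 := flatten_point hn hx
    exact (hsup T F ν h N hR P hP).2 e he z hz _ h1.1 h1.2
  -- Common to both test functions: `χ` is bounded on the ball of radius `h` about `z`, so Markov's
  -- inequality bounds its gradient there, and `ψ` supplies the factors `K` in `T` and `η` on the
  -- other faces.
  have htestφ : ∀ (χ : Poly d) (A : ℝ), 0 ≤ A → χ.totalDegree ≤ k + 1 →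
      (∀ x ∈ Metric.closedBall z h, |val χ x| ≤ C₂ * A) →
      |(∫ x, val (a e) x * inner ℝ (grad (χ * ψ) x) (ν e) ∂(surf e))
        - ∫ x, val (b e) x * val (χ * ψ) x ∂(surf e)| ≤
      C₁ * C₂ * (C₃ + 1) * (s * h⁻¹ * (K * (h ^ 2 * X) + η * S)) * A := by
    intro χ A hA hχ hχb
    have hgr := hmarkov z h hh χ hχ (C₂ * A) hχb
    have h1 := htest T F ν h ρ N hR D w g a b hrep (χ * ψ)
      ((MvPolynomial.totalDegree_mul _ _).trans (by omega)) e he (C₂ * A * K)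
      ((C₃ + 1) * (C₂ * A) * η) (by positivity) (by positivity)
      (fun x hx => by
        rw [val_mul, abs_mul]
        exact mul_le_mul (hχb x (hTz hx)) (hψ.bound x hx) (abs_nonneg _) (by positivity))
      (fun e' he' hne => by
        filter_upwards [hψ.small e' he' hne, hR.ae_mem_face he'] with x hx hxe
        have hxz := hTz (hR.face_subset e' he' hxe)
        constructor
        · rw [val_mul, abs_mul]
          calc |val χ x| * |val ψ x| ≤ (C₂ * A) * η :=
                mul_le_mul (hχb x hxz) hx.1 (abs_nonneg _) (by positivity)
            _ ≤ (C₃ + 1) * (C₂ * A) * η := by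
                have : 0 ≤ C₂ * A * η := by positivity
                nlinarith
        · rw [grad_mul]
          calc ‖val ψ x • grad χ x + val χ x • grad ψ x‖
              ≤ |val ψ x| * ‖grad χ x‖ + |val χ x| * ‖grad ψ x‖ := by
                refine (norm_add_le _ _).trans ?_
                rw [norm_smul, norm_smul, Real.norm_eq_abs, Real.norm_eq_abs]
            _ ≤ η * (C₃ / h * (C₂ * A)) + C₂ * A * (η / h) := by
                refine add_le_add (mul_le_mul hx.1 (hgr x hxz) (norm_nonneg _) hη)
                  (mul_le_mul (hχb x hxz) hx.2 (norm_nonneg _) (by positivity))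
            _ = (C₃ + 1) * (C₂ * A) * η / h := by ring)
    refine h1.trans ?_
    have h2 : h * X * (C₂ * A * K) + h⁻¹ * S * ((C₃ + 1) * (C₂ * A) * η) ≤
        (C₃ + 1) * (C₂ * A) * (h⁻¹ * (K * (h ^ 2 * X) + η * S)) := by
      have h3 : (C₃ + 1) * (C₂ * A) * (h⁻¹ * (K * (h ^ 2 * X) + η * S)) =
          (C₃ + 1) * (h * X * (C₂ * A * K)) + h⁻¹ * S * ((C₃ + 1) * (C₂ * A) * η) := by
        field_simp
      rw [h3]
      have : 0 ≤ h * X * (C₂ * A * K) := by positivity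
      nlinarith
    calc _ ≤ C₁ * (s * ((C₃ + 1) * (C₂ * A) * (h⁻¹ * (K * (h ^ 2 * X) + η * S)))) := by gcongr
      _ = _ := by ring
  set α := rmsFace e h (a e) with hα
  set β := rmsFace e h (b e) with hβ
  have hα0 : 0 ≤ α := rmsFace_nonneg _ _ _
  have hβ0 : 0 ≤ β := rmsFace_nonneg _ _ _
  have hR1 : 0 ≤ K * (h ^ 2 * X) + η * S := by positivity
  constructor
  · rcases hα0.eq_or_lt with h0 | hαpos
    · rw [← h0, mul_zero]; positivity
    -- The scaled distance to the hyperplane of `e`: zero on `e`, normal derivative `h⁻¹`, at most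
    -- one in the ball.
    set lam : Poly d := affPoly (h⁻¹ • ν e) (-(h⁻¹ * inner ℝ (ν e) z)) with hlam
    have hlamv : ∀ x, val lam x = h⁻¹ * inner ℝ (ν e) (x - z) := fun x => by
      rw [hlam, val_affPoly, real_inner_smul_left, inner_sub_right]; ring
    have hb := htestφ (lam * flatten (a e) (ν e) z) α hα0
      ((MvPolynomial.totalDegree_mul _ _).trans (by
        have h1 : lam.totalDegree ≤ 1 := totalDegree_affPoly_le _ _
        have h2 := (totalDegree_flatten_le (a e) (ν e) z).trans (hab e he).1
        omega))
      (fun x hx => by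
        rw [val_mul, abs_mul]
        have h1 : |val lam x| ≤ 1 := by
          rw [hlamv, abs_mul, abs_of_pos (inv_pos.2 hh), inv_mul_le_one₀ hh]
          refine (abs_real_inner_le_norm _ _).trans ?_
          rw [hn, one_mul]
          exact mem_closedBall_iff_norm.1 hx
        have h2 := hflat (a e) (hab e he).1 x hx
        calc _ ≤ 1 * (C₂ * α) := mul_le_mul h1 h2 (abs_nonneg _) zero_le_one
          _ = _ := one_mul _)
    have hI1 : ∫ x, val (a e) x * inner ℝ (grad (lam * flatten (a e) (ν e) z * ψ) x) (ν e) ∂(surf e)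
        = h⁻¹ * ∫ x, val ψ x * val (a e) x ^ 2 ∂(surf e) := by
      rw [← integral_const_mul]
      refine integral_congr_ae ?_
      filter_upwards [hR.ae_mem_face he] with x hx
      have h1 : val lam x = 0 := by rw [hlamv, hez x hx, mul_zero]
      have h2 := val_flatten_of_inner_eq_zero (a e) (hez x hx)
      rw [grad_mul, grad_mul, val_mul, h1, h2, hlam, grad_affPoly]
      simp only [zero_mul, zero_smul, add_zero, real_inner_smul_left, hnn, mul_one]
      ring
    have hI2 : ∫ x, val (b e) x * val (lam * flatten (a e) (ν e) z * ψ) x ∂(surf e) = 0 := by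
      refine integral_eq_zero_of_ae ?_
      filter_upwards [hR.ae_mem_face he] with x hx
      have h1 : val lam x = 0 := by rw [hlamv, hez x hx, mul_zero]
      simp [val_mul, h1]
    have hlow := hψ.lower (a e) (hab e he).1
    rw [integral_sq_eq _ hs] at hlow
    change c₀ * (s * α ^ 2) ≤ _ at hlow
    rw [hI1, hI2, sub_zero] at hb
    have h3 := (le_abs_self _).trans hb
    have h4 : h⁻¹ * (c₀ * (s * α ^ 2)) ≤
        C₁ * C₂ * (C₃ + 1) * (s * h⁻¹ * (K * (h ^ 2 * X) + η * S)) * α :=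
      (mul_le_mul_of_nonneg_left hlow (inv_pos.2 hh).le).trans h3
    have h5 : (s * h⁻¹ * α) * (c₀ * α) ≤
        (s * h⁻¹ * α) * (C₁ * C₂ * (C₃ + 1) * (K * (h ^ 2 * X) + η * S)) := by
      calc _ = h⁻¹ * (c₀ * (s * α ^ 2)) := by ring
        _ ≤ _ := h4
        _ = _ := by ring
    refine (le_of_mul_le_mul_left h5 (by positivity)).trans ?_
    gcongr
    have : 0 ≤ C₄ * C₂ := by positivity
    linarith
  · rcases hβ0.eq_or_lt with h0 | hβpos
    · rw [← h0, mul_zero, mul_zero]; positivity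
    -- The flattened polynomial has zero normal derivative, so the term with `a` sees only the
    -- normal derivative of `ψ`.
    have hb := htestφ (flatten (b e) (ν e) z) β hβ0
      (((totalDegree_flatten_le (b e) (ν e) z).trans (hab e he).2).trans (Nat.le_succ k))
      (hflat (b e) (hab e he).2)
    have hI1 : |∫ x, val (a e) x * inner ℝ (grad (flatten (b e) (ν e) z * ψ) x) (ν e) ∂(surf e)|
        ≤ C₄ * s * α * (C₂ * β * (K₀ / h)) := by
      refine (hint T F ν h ρ N hR).2 e he _ _ (continuous_val _)
        ((continuous_grad _).inner continuous_const) _ (by positivity) ?_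
      filter_upwards [hR.ae_mem_face he] with x hx
      rw [grad_mul, inner_add_left, real_inner_smul_left, real_inner_smul_left,
        inner_grad_flatten _ hn, mul_zero, zero_add, abs_mul]
      exact mul_le_mul (hflat (b e) (hab e he).2 x (hTz (hR.face_subset e he hx)))
        (hψ.normal_deriv x hx) (abs_nonneg _) (by positivity)
    have hI2 : ∫ x, val (b e) x * val (flatten (b e) (ν e) z * ψ) x ∂(surf e)
        = ∫ x, val ψ x * val (b e) x ^ 2 ∂(surf e) := by
      refine integral_congr_ae ?_
      filter_upwards [hR.ae_mem_face he] with x hx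
      rw [val_mul, val_flatten_of_inner_eq_zero (b e) (hez x hx)]
      ring
    have hlow := hψ.lower (b e) (hab e he).2
    rw [integral_sq_eq _ hs] at hlow
    change c₀ * (s * β ^ 2) ≤ _ at hlow
    rw [hI2] at hb
    have h4 : c₀ * (s * β ^ 2) ≤ C₁ * C₂ * (C₃ + 1) * (s * h⁻¹ * (K * (h ^ 2 * X) + η * S)) * β
        + C₄ * s * α * (C₂ * β * (K₀ / h)) := by
      rw [abs_le] at hb hI1
      linarith [hb.1, hI1.2]
    have h5 : (s * h⁻¹ * β) * (c₀ * (h * β)) ≤ (s * h⁻¹ * β) *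
        (C₁ * C₂ * (C₃ + 1) * (K * (h ^ 2 * X) + η * S) + C₄ * C₂ * (K₀ * α)) := by
      calc _ = c₀ * (s * β ^ 2) := by field_simp
        _ ≤ _ := h4
        _ = _ := by field_simp
    refine (le_of_mul_le_mul_left h5 (by positivity)).trans ?_
    have h6 : 0 ≤ C₄ * C₂ * (K * (h ^ 2 * X) + η * S) := by positivity
    have h7 : 0 ≤ C₁ * C₂ * (C₃ + 1) * (K₀ * α) := by positivity
    nlinarith

/-- Localised test functions on all faces control all jumps. -/
lemma exists_localizer_bound (hd : 0 < d) (k N : ℕ) {ρ c₀ K₀ : ℝ} (hρ : 0 < ρ) (hc₀ : 0 < c₀)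
    (hK₀ : 0 ≤ K₀) : ∃ η : ℝ, 0 < η ∧ ∀ K : ℝ, 0 ≤ K → ∃ C : ℝ, 0 < C ∧
    ∀ (T : Set (E d)) (F : Finset (Set (E d))) (ν : Set (E d) → E d) (h : ℝ),
    IsRegularElement T F ν h N ρ → ∀ (D : ℕ) (w g : Poly d) (a b : Set (E d) → Poly d),
    (∀ e ∈ F, (a e).totalDegree ≤ k ∧ (b e).totalDegree ≤ k) →
    (∀ e ∈ F, ∃ ψ : Poly d, IsLocalizer T F ν h k c₀ K₀ K η e ψ ∧ ψ.totalDegree + k + 1 ≤ D) →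
    Represents T F ν D w g a b →
    jumpSum F h a b ≤ C * (h ^ 2 * (rmsElem T h w + rmsElem T h g)) := by
  obtain ⟨C, hC, hface⟩ := exists_localizer_face_bound hd k hρ
  -- The bound for the jump of the values is inserted into the bound for the jump of the fluxes, and
  -- the two are added.
  set L : ℝ := C / c₀ + C / c₀ * (1 + K₀ * (C / c₀)) with hL
  have hL0 : 0 < L := by positivity
  -- With this `η` the jumps reappearing on the right amount, over at most `N` faces, to at most
  -- half of their sum. It is chosen before `K`, since a localizer with small `η` may need a large
  -- `K`.
  refine ⟨1 / (2 * (N + 1) * L), by positivity, fun K hK => ⟨2 * (N + 1) * L * (K + 1), by positivity,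
    fun T F ν h hR D w g a b hab hψ hrep => ?_⟩⟩
  have hh := hR.h_pos
  set η : ℝ := 1 / (2 * (N + 1) * L) with hη
  have hη0 : 0 < η := by positivity
  set S := jumpSum F h a b with hS
  set X := h ^ 2 * (rmsElem T h w + rmsElem T h g) with hX
  have hX0 : 0 ≤ X := mul_nonneg (sq_nonneg _)
    (add_nonneg (rmsElem_nonneg _ _ _) (rmsElem_nonneg _ _ _))
  have hS0 : 0 ≤ S := Finset.sum_nonneg fun i _ =>
    add_nonneg (rmsFace_nonneg _ _ _) (mul_nonneg hh.le (rmsFace_nonneg _ _ _))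
  have hterm : ∀ e ∈ F, rmsFace e h (a e) + h * rmsFace e h (b e) ≤ L * (K * X + η * S) := by
    intro e he
    obtain ⟨ψ, hψ1, hψ2⟩ := hψ e he
    obtain ⟨h1, h2⟩ := hface T F ν h N hR D w g a b hab e he ψ c₀ K₀ K η hK₀ hK hη0.le hψ1 hψ2 hrep
    set Y := K * X + η * S with hY
    have hY0 : 0 ≤ Y := by positivity
    have h3 : rmsFace e h (a e) ≤ C / c₀ * Y := by
      rw [div_mul_eq_mul_div, le_div_iff₀ hc₀]
      linarith
    have h4 : h * rmsFace e h (b e) ≤ C / c₀ * (Y + K₀ * rmsFace e h (a e)) := by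
      rw [div_mul_eq_mul_div, le_div_iff₀ hc₀]
      linarith
    have h5 : C / c₀ * (Y + K₀ * rmsFace e h (a e)) ≤ C / c₀ * (Y + K₀ * (C / c₀ * Y)) := by gcongr
    calc _ ≤ C / c₀ * Y + C / c₀ * (Y + K₀ * (C / c₀ * Y)) := by linarith
      _ = L * Y := by rw [hL]; ring
  have hsum : S ≤ N * (L * (K * X + η * S)) := by
    refine (Finset.sum_le_sum hterm).trans ?_
    rw [Finset.sum_const, nsmul_eq_mul]
    have : (F.card : ℝ) ≤ N := by exact_mod_cast hR.card_le
    gcongr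
  have hsmall : N * (L * (η * S)) ≤ S / 2 := by
    have h1 : (N : ℝ) * (L * η) ≤ 1 / 2 := by
      rw [hη, mul_one_div, mul_div_assoc', div_le_div_iff₀ (by positivity) (by norm_num)]
      nlinarith
    nlinarith
  have h6 : S ≤ 2 * (N * L * K * X) := by nlinarith
  refine h6.trans ?_
  have h7 : (N : ℝ) * L * K * X ≤ (N + 1) * L * (K + 1) * X := by
    gcongr <;> linarith
  linarith

end Localisation

/-! ### The Laplacian of `v_0`, separated faces and the upper bound -/

section LocalBounds

variable {d : ℕ}

/-- The scaled distance to the hyperplane through `z` orthogonal to `n`. -/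
def faceCoord (n z : E d) (h : ℝ) : Poly d := affPoly (h⁻¹ • n) (-(h⁻¹ * inner ℝ n z))

lemma val_faceCoord (n z : E d) (h : ℝ) (x : E d) :
    val (faceCoord n z h) x = h⁻¹ * inner ℝ n (x - z) := by
  rw [faceCoord, val_affPoly, real_inner_smul_left, inner_sub_right]; ring

lemma abs_val_faceCoord_le {n z x : E d} (hn : ‖n‖ = 1) {h B : ℝ} (hh : 0 < h)
    (hx : ‖x - z‖ ≤ B * h) : |val (faceCoord n z h) x| ≤ B := by
  rw [val_faceCoord, abs_mul, abs_of_pos (inv_pos.2 hh), inv_mul_le_iff₀ hh, mul_comm]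
  refine (abs_real_inner_le_norm _ _).trans ?_
  rwa [hn, one_mul]

/-- From `x₀` a step of length `h` along the normal, away from the hyperplane, changes the scaled
distance by one. -/
lemma exists_one_le_abs_faceCoord {n : E d} (hn : ‖n‖ = 1) (z : E d) {h : ℝ} (hh : 0 < h)
    (x₀ : E d) : ∃ y ∈ Metric.closedBall x₀ h, 1 ≤ |val (faceCoord n z h) y| := by
  have hnn : inner ℝ n n = 1 := by rw [real_inner_self_eq_norm_sq, hn, one_pow]
  have h1 : ∀ t : ℝ, val (faceCoord n z h) (x₀ + (t * h) • n) = val (faceCoord n z h) x₀ + t := by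
    intro t
    rw [val_faceCoord, val_faceCoord, add_sub_right_comm, inner_add_right, real_inner_smul_right,
      hnn]
    field_simp
  have h2 : ∀ t : ℝ, |t| = 1 → x₀ + (t * h) • n ∈ Metric.closedBall x₀ h := fun t ht => by
    rw [mem_closedBall_iff_norm, add_sub_cancel_left, norm_smul, hn, mul_one, Real.norm_eq_abs,
      abs_mul, ht, one_mul, abs_of_pos hh]
  rcases le_total 0 (val (faceCoord n z h) x₀) with h0 | h0
  · refine ⟨_, h2 1 (by simp), ?_⟩
    rw [h1, abs_of_nonneg (by linarith)]
    linarith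
  · refine ⟨_, h2 (-1) (by simp), ?_⟩
    rw [h1, abs_of_nonpos (by linarith)]
    linarith

lemma totalDegree_prod_sq_le {ι : Type*} (I : Finset ι) (P : ι → Poly d)
    (hP : ∀ i ∈ I, (P i).totalDegree ≤ 1) : (∏ i ∈ I, P i ^ 2).totalDegree ≤ 2 * I.card := by
  refine (MvPolynomial.totalDegree_finsetProd _ _).trans ?_
  rw [mul_comm, ← smul_eq_mul, ← Finset.sum_const]
  refine Finset.sum_le_sum fun i hi => (MvPolynomial.totalDegree_pow _ _).trans ?_
  have := hP i hi
  omega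

/-- The square gives a double zero, so the gradient vanishes together with the value. -/
lemma prod_sq_mul_vanishes {ι : Type*} {I : Finset ι} (P : ι → Poly d) {i : ι} (hi : i ∈ I)
    (Q : Poly d) {x : E d} (hx : val (P i) x = 0) :
    val ((∏ i ∈ I, P i ^ 2) * Q) x = 0 ∧ grad ((∏ i ∈ I, P i ^ 2) * Q) x = 0 := by
  classical
  rw [← Finset.mul_prod_erase I _ hi, mul_assoc]
  constructor
  · rw [val_mul, val_pow, hx]; simp
  · rw [grad_mul, grad_pow, val_pow, hx]; simp

/-- The converse of `exists_sup_bound`: the mean square is at most a multiple of the maximum, and a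
maximum point is a concrete point at which lower bounds for products can be applied. -/
lemma exists_rms_le (hd : 0 < d) : ∃ C : ℝ, 1 ≤ C ∧
    ∀ (T : Set (E d)) (F : Finset (Set (E d))) (ν : Set (E d) → E d) (h ρ : ℝ) (N : ℕ),
    IsRegularElement T F ν h N ρ → ∀ P : Poly d,
    (T.Nonempty → ∃ y ∈ T, rmsElem T h P ≤ C * |val P y|) ∧
      ∀ e ∈ F, ∃ y ∈ e, rmsFace e h P ≤ C * |val P y| := by
  obtain ⟨C, hC, hint⟩ := exists_integral_bound hd
  have key : ∀ {μ : Measure (E d)} {s : ℝ} {P : Poly d} {B : ℝ}, 0 < s → 0 ≤ B →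
      |∫ x, val P x * val P x ∂μ| ≤ C * s * rms μ s (val P) * B → rms μ s (val P) ≤ C * B := by
    intro μ s P B hs hB hle
    have h1 := (le_abs_self _).trans hle
    have h2 : ∫ x, val P x * val P x ∂μ = s * rms μ s (val P) ^ 2 := by
      rw [← integral_sq_eq μ hs]; simp only [sq]
    rw [h2] at h1
    rcases (rms_nonneg μ s (val P)).eq_or_lt with h0 | hpos
    · rw [← h0]; positivity
    · refine le_of_mul_le_mul_left (?_ : s * rms μ s (val P) * _ ≤ s * rms μ s (val P) * _)
        (by positivity)
      linarith
  refine ⟨C, hC, fun T F ν h ρ N hR P => ⟨fun hT => ?_, fun e he => ?_⟩⟩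
  · obtain ⟨y, hy, hmax⟩ := hR.isCompact.exists_isMaxOn hT (continuous_val P).abs.continuousOn
    exact ⟨y, hy, key (pow_pos hR.h_pos _) (abs_nonneg _) ((hint T F ν h ρ N hR).1 _ _
      (continuous_val P) (continuous_val P) _ (abs_nonneg _) fun x hx => hmax hx)⟩
  · obtain ⟨y, hy, hmax⟩ := (hR.isCompact_face e he).exists_isMaxOn (hR.face_nonempty e he)
      (continuous_val P).abs.continuousOn
    refine ⟨y, hy, key (pow_pos hR.h_pos _) (abs_nonneg _) ((hint T F ν h ρ N hR).2 e he _ _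
      (continuous_val P) (continuous_val P) _ (abs_nonneg _) ?_)⟩
    filter_upwards [hR.ae_mem_face he] with x hx using hmax hx

lemma IsRegularElement.nonempty {T : Set (E d)} {F : Finset (Set (E d))} {ν : Set (E d) → E d}
    {h ρ : ℝ} {N : ℕ} (hρ : 0 < ρ) (hR : IsRegularElement T F ν h N ρ) : T.Nonempty := by
  by_contra hT
  rw [Set.not_nonempty_iff_eq_empty] at hT
  have h1 := hR.volume_ge
  rw [hT, measureReal_empty] at h1
  have h2 := mul_pos hρ (pow_pos hR.h_pos d)
  linarith

/-- The functionals of the jumps do not see a test function that vanishes to second order on the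
boundary; hence `g` is bounded by `w`. -/
lemma exists_volume_bound (hd : 0 < d) (k N : ℕ) {ρ : ℝ} (hρ : 0 < ρ) : ∃ C : ℝ, 0 < C ∧
    ∀ (T : Set (E d)) (F : Finset (Set (E d))) (ν : Set (E d) → E d) (h : ℝ),
    IsRegularElement T F ν h N ρ → ∀ (D : ℕ) (w g : Poly d) (a b : Set (E d) → Poly d),
    g.totalDegree ≤ k → 2 * N + k ≤ D → Represents T F ν D w g a b →
    rmsElem T h g ≤ C * rmsElem T h w := by
  obtain ⟨c, hc, hlow⟩ := integral_prod_sq_ge d (k + 1) (N + 1) hρ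
  obtain ⟨C₁, hC₁, hint⟩ := exists_integral_bound hd
  obtain ⟨C₂, hC₂, hsup⟩ := exists_sup_bound hd k hρ
  obtain ⟨C₃, hC₃, hrms⟩ := exists_rms_le hd
  refine ⟨C₁ * C₂ * C₃ ^ 2 / c, by positivity, fun T F ν h hR D w g a b hg hD hrep => ?_⟩
  have hh := hR.h_pos
  obtain ⟨y₀, hy₀, hγ⟩ := (hrms T F ν h ρ N hR g).1 (hR.nonempty hρ)
  have hsupT := (hsup T F ν h N hR g hg).1
  set γ := rmsElem T h g with hγdef
  change ∀ z ∈ T, ∀ x ∈ Metric.closedBall z h, |val g x| ≤ C₂ * γ at hsupT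
  rcases (rmsElem_nonneg T h g).eq_or_lt with h0 | hγpos
  · rw [hγdef, ← h0]
    exact mul_nonneg (by positivity) (rmsElem_nonneg _ _ _)
  change 0 < γ at hγpos
  choose! z hz using hR.face_nonempty
  set lam : Set (E d) → Poly d := fun e => faceCoord (ν e) (z e) h with hlam
  have hlamdeg : ∀ e, (lam e).totalDegree ≤ 1 := fun e => totalDegree_affPoly_le _ _
  have hlam0 : ∀ e ∈ F, ∀ x ∈ e, val (lam e) x = 0 := fun e he x hx => by
    simp only [hlam]
    rw [val_faceCoord, hR.perp e he x hx _ (hz e he), mul_zero]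
  have hlam1 : ∀ e ∈ F, ∀ x ∈ T, |val (lam e) x| ≤ 1 := fun e he x hx =>
    abs_val_faceCoord_le (hR.unit e he) hh (by
      rw [one_mul]; exact hR.dist_le x hx _ (hR.face_subset e he (hz e he)))
  -- One squared linear factor per face kills both boundary functionals and costs degree `2 N`.
  set φ : Poly d := (∏ e ∈ F, lam e ^ 2) * g with hφ
  have hφdeg : φ.totalDegree ≤ D := by
    refine (MvPolynomial.totalDegree_mul _ _).trans ?_
    have h1 := totalDegree_prod_sq_le F lam fun e _ => hlamdeg e
    have h2 := hR.card_le
    omega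
  have hφ0 : ∀ e ∈ F, ∀ x ∈ e, val φ x = 0 ∧ grad φ x = 0 := fun e he x hx =>
    prod_sq_mul_vanishes lam he g (hlam0 e he x hx)
  have h1 := hrep φ hφdeg
  rw [Finset.sum_eq_zero (fun e he => integral_eq_zero_of_ae (by
      filter_upwards [hR.ae_mem_face he] with x hx
      simp [(hφ0 e he x hx).2])),
    Finset.sum_eq_zero (fun e he => integral_eq_zero_of_ae (by
      filter_upwards [hR.ae_mem_face he] with x hx
      simp [(hφ0 e he x hx).1])), add_zero, sub_zero] at h1
  have h2 := (le_abs_self _).trans ((hint T F ν h ρ N hR).1 (val w) (val φ) (continuous_val _)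
    (continuous_val _) (C₂ * γ) (by positivity) fun x hx => by
      rw [hφ, val_mul, val_prod, abs_mul, Finset.abs_prod]
      calc _ ≤ 1 * (C₂ * γ) := by
            refine mul_le_mul (Finset.prod_le_one (fun e _ => abs_nonneg _) fun e he => ?_)
              (hsupT x hx x (Metric.mem_closedBall_self hh.le)) (abs_nonneg _) zero_le_one
            rw [val_pow, abs_pow]
            exact pow_le_one₀ (abs_nonneg _) (hlam1 e he x hx)
        _ = C₂ * γ := one_mul _)
  rw [h1] at h2
  -- The points at which the factors are evaluated need not lie in `T`; it suffices that they lie in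
  -- the ball about `y₀`.
  choose! y hyB hy1 using fun e (he : e ∈ F) =>
    exists_one_le_abs_faceCoord (hR.unit e he) (z e) hh y₀
  -- The family consists of the `λ_e` and, at the extra index `none`, of `g`. Hence the bounds `N +
  -- 1` for the number of factors and `k + 1` for the degrees, the latter covering linear factors
  -- also when `k = 0`.
  have h3 := hlow y₀ h hh T hR.measurableSet (hR.subset_closedBall hy₀) hR.volume_ge
    (Finset.insertNone F) (by rw [Finset.card_insertNone]; exact Nat.succ_le_succ hR.card_le)
    (fun o => o.elim g lam)
    (by
      rintro (_ | e) he
      · exact hg.trans (Nat.le_succ k)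
      · exact (hlamdeg e).trans (by omega))
    (fun o => o.elim y₀ y)
    (by
      rintro (_ | e) he
      · exact Metric.mem_closedBall_self hh.le
      · exact hyB e (by simpa using he))
  simp only [Finset.prod_insertNone, Option.elim] at h3
  have h4 : ∀ x, val g x ^ 2 * ∏ e ∈ F, val (lam e) x ^ 2 = val g x * val φ x := fun x => by
    rw [hφ, val_mul, val_prod]
    simp only [val_pow]
    ring
  simp only [h4] at h3
  have h5 : 1 ≤ ∏ e ∈ F, val (lam e) (y e) ^ 2 := by
    rw [← Finset.prod_const_one (s := F)]
    refine Finset.prod_le_prod (fun _ _ => zero_le_one) fun e he => ?_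
    rw [← sq_abs]
    exact one_le_pow₀ (hy1 e he)
  have hpow : 0 < h ^ d := pow_pos hh d
  have h6 : c * h ^ d * val g y₀ ^ 2 ≤ C₁ * h ^ d * rmsElem T h w * (C₂ * γ) := by
    refine le_trans ?_ (h3.trans h2)
    have : 0 ≤ c * h ^ d * val g y₀ ^ 2 := by positivity
    nlinarith
  have h7 : γ ^ 2 ≤ C₃ ^ 2 * val g y₀ ^ 2 := by
    rw [← sq_abs (val g y₀), ← mul_pow]
    exact pow_le_pow_left₀ hγpos.le hγ 2
  rw [div_mul_eq_mul_div, le_div_iff₀ hc]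
  refine le_of_mul_le_mul_left (?_ : h ^ d * γ * _ ≤ h ^ d * γ * _) (by positivity)
  calc h ^ d * γ * (γ * c) = c * h ^ d * γ ^ 2 := by ring
    _ ≤ c * h ^ d * (C₃ ^ 2 * val g y₀ ^ 2) := by gcongr
    _ = C₃ ^ 2 * (c * h ^ d * val g y₀ ^ 2) := by ring
    _ ≤ C₃ ^ 2 * (C₁ * h ^ d * rmsElem T h w * (C₂ * γ)) := by gcongr
    _ = h ^ d * γ * (C₁ * C₂ * C₃ ^ 2 * rmsElem T h w) := by ring

/-- If the hyperplanes of the faces are separated, then squares of products of their equations are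
localised test functions. -/
lemma exists_separated_localizer (hd : 0 < d) (k N : ℕ) {ρ δ : ℝ} (hρ : 0 < ρ) (hδ : 0 < δ) :
    ∃ c₀ K₀ K : ℝ, 0 < c₀ ∧ 0 ≤ K₀ ∧ 0 ≤ K ∧
    ∀ (T : Set (E d)) (F : Finset (Set (E d))) (ν : Set (E d) → E d) (h : ℝ),
    IsRegularElement T F ν h N ρ →
    (∀ e ∈ F, ∀ e' ∈ F, e ≠ e' → ∃ x ∈ e, ∀ y ∈ e', δ * h ≤ |inner ℝ (ν e') (x - y)|) →
    ∀ e ∈ F, ∀ η : ℝ, 0 ≤ η → ∃ ψ : Poly d, IsLocalizer T F ν h k c₀ K₀ K η e ψ ∧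
      ψ.totalDegree ≤ 2 * (N - 1) := by
  classical
  obtain ⟨c, hc, hlow⟩ := integral_surf_prod_sq_ge hd (k + 1) (N + 1) hρ
  obtain ⟨C₁, hC₁, hrms⟩ := exists_rms_le hd
  obtain ⟨C₂, hC₂, hmarkov⟩ := norm_grad_le d (2 * (N - 1))
  set δ' := min δ 1 with hδ'
  have hδ'0 : 0 < δ' := lt_min hδ one_pos
  refine ⟨c * (δ' ^ 2) ^ N / C₁ ^ 2, C₂ * 4 ^ N, 4 ^ N, by positivity, by positivity, by positivity,
    fun T F ν h hR hsep e he η hη => ?_⟩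
  have hh := hR.h_pos
  choose! z hz using hR.face_nonempty
  set lam : Set (E d) → Poly d := fun e => faceCoord (ν e) (z e) h with hlam
  have hlamdeg : ∀ e, (lam e).totalDegree ≤ 1 := fun e => totalDegree_affPoly_le _ _
  have hlam0 : ∀ e ∈ F, ∀ x ∈ e, val (lam e) x = 0 := fun e he x hx => by
    simp only [hlam]
    rw [val_faceCoord, hR.perp e he x hx _ (hz e he), mul_zero]
  -- Zero to second order on every other face, so any `η ≥ 0` is admissible. Separation gives for
  -- each factor a point of `e` where it is at least `δ`, and the lower bound for products needs no
  -- common point.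
  set ψ : Poly d := ∏ e' ∈ F.erase e, lam e' ^ 2 with hψ
  have hcard : (F.erase e).card ≤ N - 1 := by
    rw [Finset.card_erase_of_mem he]
    exact Nat.sub_le_sub_right hR.card_le 1
  have hψdeg : ψ.totalDegree ≤ 2 * (N - 1) :=
    (totalDegree_prod_sq_le (F.erase e) lam fun e _ => hlamdeg e).trans (Nat.mul_le_mul_left 2 hcard)
  have hzT : ∀ e ∈ F, z e ∈ T := fun e he => hR.face_subset e he (hz e he)
  -- A bound on the whole ball, not only on `T`, is needed for Markov's inequality. There a point is
  -- within `2 h` of each `z e'`, so each squared factor is at most `4`.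
  have hψb : ∀ x ∈ Metric.closedBall (z e) h, |val ψ x| ≤ 4 ^ N := fun x hx => by
    rw [hψ, val_prod, Finset.abs_prod]
    calc ∏ e' ∈ F.erase e, |val (lam e' ^ 2) x| ≤ ∏ e' ∈ F.erase e, (4 : ℝ) := by
          refine Finset.prod_le_prod (fun _ _ => abs_nonneg _) fun e' he' => ?_
          have he'F := (Finset.mem_erase.1 he').2
          have h1 : |val (lam e') x| ≤ 2 := abs_val_faceCoord_le (hR.unit e' he'F) hh (by
            rw [mem_closedBall_iff_norm] at hx
            have h2 := hR.dist_le _ (hzT e he) _ (hzT e' he'F)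
            have h3 := norm_sub_le_norm_sub_add_norm_sub x (z e) (z e')
            linarith)
          rw [val_pow, abs_pow]
          nlinarith [abs_nonneg (val (lam e') x)]
      _ = 4 ^ (F.erase e).card := Finset.prod_const _
      _ ≤ 4 ^ N := pow_le_pow_right₀ (by norm_num) (hcard.trans (Nat.sub_le _ _))
  have hTz := hR.subset_closedBall (hzT e he)
  refine ⟨ψ, ⟨fun P hP => ?_, fun x hx => hψb x (hTz hx), fun x hx => ?_, fun e' he' hne => ?_⟩,
    hψdeg⟩
  · obtain ⟨y₀, hy₀, hα⟩ := (hrms T F ν h ρ N hR P).2 e he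
    choose! x hx hxδ using fun e' (he' : e' ∈ F.erase e) =>
      hsep e he e' (Finset.mem_erase.1 he').2 (Finset.mem_erase.1 he').1.symm
    have hmem : ∀ y ∈ e, y ∈ Metric.closedBall (z e) h ∧ inner ℝ (ν e) (y - z e) = 0 := fun y hy =>
      ⟨hTz (hR.face_subset e he hy), hR.perp e he y hy _ (hz e he)⟩
    have h3 := hlow (ν e) (z e) h (hR.unit e he) hh e (hR.measurableSet_face he)
      (fun y hy => (hmem y hy).2) (fun y hy => (hmem y hy).1) (hR.surf_ge e he)
      (Finset.insertNone (F.erase e)) (by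
        rw [Finset.card_insertNone]
        exact Nat.succ_le_succ (hcard.trans (Nat.sub_le _ _)))
      (fun o => o.elim P lam)
      (by
        rintro (_ | e) he
        · exact hP.trans (Nat.le_succ k)
        · exact (hlamdeg e).trans (by omega))
      (fun o => o.elim y₀ x)
      (by
        rintro (_ | e') he'
        · exact hmem y₀ hy₀
        · exact hmem _ (hx e' (by simpa using he')))
    simp only [Finset.prod_insertNone, Option.elim] at h3
    have h4 : ∀ x, val P x ^ 2 * ∏ e ∈ F.erase e, val (lam e) x ^ 2 = val ψ x * val P x ^ 2 :=
      fun x => by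
      rw [hψ, val_prod]
      simp only [val_pow]
      ring
    simp only [h4] at h3
    refine le_trans ?_ h3
    have h5 : (δ' ^ 2) ^ N ≤ ∏ e' ∈ F.erase e, val (lam e') (x e') ^ 2 := by
      calc (δ' ^ 2) ^ N ≤ (δ' ^ 2) ^ (F.erase e).card :=
            pow_le_pow_of_le_one (by positivity) (pow_le_one₀ hδ'0.le (min_le_right _ _))
              (hcard.trans (Nat.sub_le _ _))
        _ = ∏ e' ∈ F.erase e, δ' ^ 2 := (Finset.prod_const _).symm
        _ ≤ _ := by
            refine Finset.prod_le_prod (fun _ _ => by positivity) fun e' he' => ?_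
            have h6 := hxδ e' he' _ (hz e' (Finset.mem_erase.1 he').2)
            rw [← sq_abs (val (lam e') (x e'))]
            refine pow_le_pow_left₀ hδ'0.le ((min_le_left _ _).trans ?_) 2
            simp only [hlam]
            rw [val_faceCoord, abs_mul, abs_of_pos (inv_pos.2 hh), le_inv_mul_iff₀ hh, mul_comm]
            exact h6
    have h7 : rmsFace e h P ^ 2 ≤ C₁ ^ 2 * val P y₀ ^ 2 := by
      rw [← sq_abs (val P y₀), ← mul_pow]
      exact pow_le_pow_left₀ (rmsFace_nonneg _ _ _) hα 2
    have hs : 0 < h ^ (d - 1) := pow_pos hh _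
    rw [integral_sq_eq _ hs]
    change _ * (_ * rmsFace e h P ^ 2) ≤ _
    calc c * (δ' ^ 2) ^ N / C₁ ^ 2 * (h ^ (d - 1) * rmsFace e h P ^ 2)
        ≤ c * (δ' ^ 2) ^ N / C₁ ^ 2 * (h ^ (d - 1) * (C₁ ^ 2 * val P y₀ ^ 2)) := by gcongr
      _ = c * h ^ (d - 1) * (val P y₀ ^ 2 * (δ' ^ 2) ^ N) := by field_simp
      _ ≤ _ := by gcongr
  · refine (abs_real_inner_le_norm _ _).trans ?_
    rw [hR.unit e he, mul_one]
    refine (hmarkov (z e) h hh ψ hψdeg (4 ^ N) hψb x (hTz (hR.face_subset e he hx))).trans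
      (le_of_eq (by ring))
  · filter_upwards [hR.ae_mem_face he'] with x hx
    have h1 := prod_sq_mul_vanishes (I := F.erase e) lam (Finset.mem_erase.2 ⟨hne, he'⟩) 1
      (hlam0 e' he' x hx)
    rw [mul_one] at h1
    rw [h1.1, h1.2, abs_zero, norm_zero]
    exact ⟨hη, by positivity⟩

/-- The bound of `w` by the Laplacian and the jumps. -/
lemma exists_upper_bound (hd : 0 < d) (r N : ℕ) {ρ : ℝ} (hρ : 0 < ρ) : ∃ C : ℝ, 0 < C ∧
    ∀ (T : Set (E d)) (F : Finset (Set (E d))) (ν : Set (E d) → E d) (h : ℝ),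
    IsRegularElement T F ν h N ρ → ∀ (w g : Poly d) (a b : Set (E d) → Poly d),
    w.totalDegree ≤ r → Represents T F ν r w g a b →
    h ^ 2 * rmsElem T h w ≤ C * (h ^ 2 * rmsElem T h g + jumpSum F h a b) := by
  obtain ⟨C₁, hC₁, hint⟩ := exists_integral_bound hd
  obtain ⟨C₂, hC₂, hsup⟩ := exists_sup_bound hd r hρ
  obtain ⟨C₃, hC₃, hmarkov⟩ := norm_grad_le d r
  refine ⟨C₁ * C₂ * (C₃ + 1), by positivity, fun T F ν h hR w g a b hw hrep => ?_⟩
  have hh := hR.h_pos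
  obtain ⟨z, hz⟩ := hR.nonempty hρ
  have hTz := hR.subset_closedBall hz
  have hsupT := (hsup T F ν h N hR w hw).1 z hz
  set ω := rmsElem T h w with hω
  change ∀ x ∈ Metric.closedBall z h, |val w x| ≤ C₂ * ω at hsupT
  have hgr := hmarkov z h hh w hw (C₂ * ω) hsupT
  have hJ0 : 0 ≤ jumpSum F h a b := Finset.sum_nonneg fun i _ =>
    add_nonneg (rmsFace_nonneg _ _ _) (mul_nonneg hh.le (rmsFace_nonneg _ _ _))
  have hγ0 := rmsElem_nonneg T h g
  rcases (rmsElem_nonneg T h w).eq_or_lt with h0 | hωpos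
  · rw [hω, ← h0, mul_zero]; positivity
  change 0 < ω at hωpos
  have hs : 0 < h ^ (d - 1) := pow_pos hh _
  set s := h ^ (d - 1) with hsdef
  have hpow : h ^ d = s * h := by rw [hsdef, ← pow_succ, Nat.sub_add_cancel hd]
  -- The test function is `w` itself; its boundary values and gradients are controlled by its norm
  -- through the sup bound and Markov's inequality.
  have h1 := hrep w hw
  have h2 : ∫ x in T, val w x * val w x = s * h * ω ^ 2 := by
    rw [← hpow, hω, rmsElem, ← integral_sq_eq _ (pow_pos hh d)]
    simp only [sq]
  have hg := (le_abs_self _).trans ((hint T F ν h ρ N hR).1 (val g) (val w) (continuous_val _)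
    (continuous_val _) (C₂ * ω) (by positivity) fun x hx => hsupT x (hTz hx))
  change _ ≤ C₁ * h ^ d * rmsElem T h g * (C₂ * ω) at hg
  have ha : ∀ e ∈ F, ∫ x, val (a e) x * inner ℝ (grad w x) (ν e) ∂(surf e) ≤
      C₁ * s * rmsFace e h (a e) * (C₃ / h * (C₂ * ω)) := fun e he => by
    refine (le_abs_self _).trans ((hint T F ν h ρ N hR).2 e he _ _ (continuous_val _)
      ((continuous_grad w).inner continuous_const) _ (by positivity) ?_)
    filter_upwards [hR.ae_mem_face he] with x hx
    refine (abs_real_inner_le_norm _ _).trans ?_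
    rw [hR.unit e he, mul_one]
    exact hgr x (hTz (hR.face_subset e he hx))
  have hb : ∀ e ∈ F, -(C₁ * s * rmsFace e h (b e) * (C₂ * ω)) ≤
      ∫ x, val (b e) x * val w x ∂(surf e) := fun e he => by
    refine (abs_le.1 ((hint T F ν h ρ N hR).2 e he _ _ (continuous_val _) (continuous_val _) _
      (by positivity) ?_)).1
    filter_upwards [hR.ae_mem_face he] with x hx
    exact hsupT x (hTz (hR.face_subset e he hx))
  have hsum : (∑ e ∈ F, ∫ x, val (a e) x * inner ℝ (grad w x) (ν e) ∂(surf e))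
      - ∑ e ∈ F, ∫ x, val (b e) x * val w x ∂(surf e) ≤
      C₁ * C₂ * (C₃ + 1) * (s * h⁻¹ * ω) * jumpSum F h a b := by
    rw [← Finset.sum_sub_distrib, jumpSum, Finset.mul_sum]
    refine Finset.sum_le_sum fun e he => ?_
    have h3 : C₁ * C₂ * (C₃ + 1) * (s * h⁻¹ * ω) * (rmsFace e h (a e) + h * rmsFace e h (b e)) =
        C₁ * s * rmsFace e h (a e) * (C₃ / h * (C₂ * ω)) + C₁ * s * rmsFace e h (b e) * (C₂ * ω)
        + (C₁ * C₂ * s * h⁻¹ * ω * rmsFace e h (a e) +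
          C₁ * C₂ * C₃ * s * ω * rmsFace e h (b e)) := by
      field_simp
      ring
    have h4 : 0 ≤ C₁ * C₂ * s * h⁻¹ * ω * rmsFace e h (a e) +
          C₁ * C₂ * C₃ * s * ω * rmsFace e h (b e) := by
      have := rmsFace_nonneg e h (a e)
      have := rmsFace_nonneg e h (b e)
      positivity
    rw [h3]
    linarith [ha e he, hb e he]
  rw [h2] at h1
  have h5 : s * h * ω ^ 2 ≤ C₁ * C₂ * (C₃ + 1) * (s * h * ω) * rmsElem T h g
      + C₁ * C₂ * (C₃ + 1) * (s * h⁻¹ * ω) * jumpSum F h a b := by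
    have h6 : C₁ * h ^ d * rmsElem T h g * (C₂ * ω) ≤
        C₁ * C₂ * (C₃ + 1) * (s * h * ω) * rmsElem T h g := by
      rw [hpow]
      have : 0 ≤ C₁ * C₂ * C₃ * (s * h * ω) * rmsElem T h g := by positivity
      linarith
    linarith
  refine le_of_mul_le_mul_left (?_ : s * h⁻¹ * ω * _ ≤ s * h⁻¹ * ω * _) (by positivity)
  calc s * h⁻¹ * ω * (h ^ 2 * ω) = s * h * ω ^ 2 := by field_simp
    _ ≤ _ := h5
    _ = _ := by field_simp

end LocalBounds

/-! ### Near the centre of a face the boundary of an element is flat -/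

section Geometry

variable {d : ℕ}

/-- A pyramid with a base that contains a disc contains half of a ball. -/
lemma mem_of_pyramid {S : Set (E d)} {n A z : E d} {σ h R r : ℝ} (hσ : 0 < σ) (hh : 0 < h)
    (hS : ∀ x, inner ℝ n (x - z) = 0 → ‖x - z‖ ≤ R → segment ℝ A x ⊆ S) (hn : ‖n‖ = 1)
    (hA : σ * h ≤ inner ℝ n (z - A)) (hzA : ‖z - A‖ ≤ h) (hr : r ≤ h) (hr' : 2 * r ≤ σ * h)
    (hR : r * (1 + 4 / σ) ≤ R) {y : E d} (hy : ‖y - z‖ < r) (hny : inner ℝ n (y - z) ≤ 0) :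
    y ∈ S := by
  set D := inner ℝ n (z - A) with hD
  set p := -inner ℝ n (y - z) with hp
  have hp0 : 0 ≤ p := by linarith
  have hpr : p < r := by
    have h1 := abs_real_inner_le_norm n (y - z)
    rw [hn, one_mul, abs_of_nonpos hny] at h1
    linarith
  have hσh : 0 < σ * h := by positivity
  have hDp : σ * h / 2 ≤ D - p := by linarith
  have hDp0 : 0 < D - p := by linarith
  have hyA : inner ℝ n (y - A) = D - p := by
    rw [hD, hp, ← sub_add_sub_cancel y z A, inner_add_right]; ring
  -- The ray from the apex `A` through `y` meets the plane of the base at `A + t (y - A)`. Here `D -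
  -- p ≥ σ h / 2`, so `t - 1 ≤ 2 r / (σ h)`, and with `‖y - A‖ ≤ 2 h` the hitting point is within `r
  -- (1 + 4 / σ)` of `z`.
  set t := D / (D - p) with ht
  have ht1 : t - 1 = p / (D - p) := by rw [ht]; field_simp; ring
  have hD0 : 0 < D := by linarith
  refine hS (A + t • (y - A)) ?_ ?_ ⟨1 - t⁻¹, t⁻¹, ?_, ?_, by ring, ?_⟩
  · rw [show A + t • (y - A) - z = t • (y - A) - (z - A) by abel, inner_sub_right,
      real_inner_smul_right, hyA, ← hD, ht]
    field_simp
    ring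
  · have h1 : A + t • (y - A) - z = (y - z) + (t - 1) • (y - A) := by module
    have h2 : ‖y - A‖ ≤ 2 * h := by
      have := norm_sub_le_norm_sub_add_norm_sub y z A
      linarith
    have h3 : t - 1 ≤ 2 * r / (σ * h) := by
      rw [ht1, div_le_div_iff₀ hDp0 hσh]
      nlinarith
    have h4 : 0 ≤ t - 1 := by rw [ht1]; positivity
    rw [h1]
    calc ‖(y - z) + (t - 1) • (y - A)‖ ≤ ‖y - z‖ + (t - 1) * ‖y - A‖ := by
          refine (norm_add_le _ _).trans ?_
          rw [norm_smul, Real.norm_of_nonneg h4]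
      _ ≤ r + 2 * r / (σ * h) * (2 * h) := by
          have hr0 : 0 ≤ r := by linarith
          gcongr
      _ = r * (1 + 4 / σ) := by field_simp; ring
      _ ≤ R := hR
  · rw [sub_nonneg]
    refine inv_le_one_of_one_le₀ ?_
    have : 0 ≤ p / (D - p) := by positivity
    linarith
  · positivity
  · have ht0 : t ≠ 0 := by positivity
    rw [smul_add, smul_smul, inv_mul_cancel₀ ht0]
    module

/-- Each convex piece is full-dimensional, hence in the closure of its interior. This lets
disjointness of interiors exclude points of one element from the interior of another. -/
lemma IsPolytope.subset_closure_interior {P : Set (E d)} (hP : IsPolytope d P) :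
    P ⊆ closure (interior P) := by
  obtain ⟨S, hS, hPS⟩ := hP.exists_pieces
  intro x hx
  have hx' := hx
  rw [hPS] at hx'
  simp only [Set.mem_iUnion] at hx'
  obtain ⟨s, hs, hxs⟩ := hx'
  have hsub : convexHull ℝ (s : Set (E d)) ⊆ P := by
    rw [hPS]
    exact Set.subset_biUnion_of_mem (u := fun s : Finset (E d) =>
      (convexHull ℝ (s : Set (E d)) : Set (E d))) hs
  have hne : (interior (convexHull ℝ (s : Set (E d)))).Nonempty := by
    rw [interior_convexHull_nonempty_iff_affineSpan_eq_top]
    have hsne : (s : Set (E d)).Nonempty := convexHull_nonempty_iff.1 ⟨x, hxs⟩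
    rw [← AffineSubspace.direction_eq_top_iff_of_nonempty
      ((affineSpan_nonempty ℝ).2 hsne), direction_affineSpan]
    exact Submodule.eq_top_of_finrank_eq (by rw [hS s hs]; simp)
  refine closure_mono (interior_mono hsub) ?_
  rw [(convex_convexHull ℝ _).closure_interior_eq_closure_of_nonempty_interior hne]
  exact subset_closure hxs

/-- Near a point of a set where it lies below a Lipschitz graph. -/
def HasChartAt (Ω : Set (E d)) (L : NNReal) (ε : ℝ) (z : E d) : Prop :=
  ∃ u c : E d, ‖u‖ = 1 ∧ ∃ γ : E d → ℝ, LipschitzWith L γ ∧ ∀ y ∈ Metric.ball z ε,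
    (y ∈ Ω ↔ inner ℝ u (y - c) < γ (y - c - inner ℝ u (y - c) • u))

/-- The boundary is compact, and a chart about `x` of radius `ε` serves every `z` within `ε / 2`
with radius `ε / 2`. The base point `c` of the chart is therefore kept apart from `z`. -/
lemma IsBoundedLipschitz.exists_uniform_chart {Ω : Set (E d)} (hΩ : IsBoundedLipschitz Ω) :
    ∃ (L : NNReal) (ε : ℝ), 0 < ε ∧ ∀ z ∈ frontier Ω, HasChartAt Ω L ε z := by
  have hcomp : IsCompact (frontier Ω) := Metric.isCompact_of_isClosed_isBounded isClosed_frontier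
    (hΩ.isBounded.closure.subset frontier_subset_closure)
  refine hcomp.induction_on (p := fun S => ∃ (L : NNReal) (ε : ℝ), 0 < ε ∧
    ∀ z ∈ S, HasChartAt Ω L ε z) ⟨0, 1, one_pos, by simp⟩ ?_ ?_ ?_
  · rintro s t hst ⟨L, ε, hε, h⟩
    exact ⟨L, ε, hε, fun z hz => h z (hst hz)⟩
  · rintro s t ⟨L, ε, hε, h⟩ ⟨L', ε', hε', h'⟩
    refine ⟨max L L', min ε ε', lt_min hε hε', fun z hz => ?_⟩
    rcases hz with hz | hz
    · obtain ⟨u, c, hu, γ, hγ, hy⟩ := h z hz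
      exact ⟨u, c, hu, γ, hγ.weaken (le_max_left _ _), fun y hyb =>
        hy y (Metric.ball_subset_ball (min_le_left _ _) hyb)⟩
    · obtain ⟨u, c, hu, γ, hγ, hy⟩ := h' z hz
      exact ⟨u, c, hu, γ, hγ.weaken (le_max_right _ _), fun y hyb =>
        hy y (Metric.ball_subset_ball (min_le_right _ _) hyb)⟩
  · intro x hx
    obtain ⟨u, hu, L, γ, ε, hγ, hε, hy⟩ := hΩ.chart x hx
    refine ⟨_, mem_nhdsWithin_of_mem_nhds (Metric.ball_mem_nhds x (half_pos hε)), L, ε / 2,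
      half_pos hε, fun z hz => ⟨u, x, hu, γ, hγ, fun y hyb => hy y ?_⟩⟩
    rw [Metric.mem_ball] at hz hyb ⊢
    linarith [dist_triangle y z x]

/-- A Lipschitz domain lies on one side of a disc in its boundary, near the centre of the disc. -/
lemma HasChartAt.notMem_of_disc {Ω : Set (E d)} (hΩ : IsOpen Ω) {L : NNReal} {ε : ℝ} {z n : E d}
    (hc : HasChartAt Ω L ε z) (hε : 0 < ε) (hn : ‖n‖ = 1) {R r₀ r : ℝ} (hR : 0 < R) (hr₀ : 0 < r₀)
    (hdisc : ∀ x, inner ℝ n (x - z) = 0 → ‖x - z‖ < R → x ∈ frontier Ω)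
    (hlower : ∀ y, ‖y - z‖ < r₀ → inner ℝ n (y - z) ≤ 0 → y ∈ closure Ω)
    (hrR : r * (2 + L) ≤ R) (hrε : r * (2 + L) ≤ ε) {y : E d} (hy : ‖y - z‖ < r)
    (hny : 0 < inner ℝ n (y - z)) : y ∉ Ω := by
  obtain ⟨u, c, hu, γ, hγ, hch⟩ := hc
  have huu : inner ℝ u u = 1 := by rw [real_inner_self_eq_norm_sq, hu, one_pow]
  have hnn : inner ℝ n n = 1 := by rw [real_inner_self_eq_norm_sq, hn, one_pow]
  -- The signed height above the graph: negative exactly on `Ω` in the chart, zero on the boundary,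
  -- and increasing with slope one in the direction `u`.
  set f : E d → ℝ := fun y => inner ℝ u (y - c) - γ (y - c - inner ℝ u (y - c) • u) with hf
  have hfc : Continuous f := by
    have h1 : Continuous fun y : E d => y - c - inner ℝ u (y - c) • u := by fun_prop
    exact (by fun_prop : Continuous fun y : E d => inner ℝ u (y - c)).sub (hγ.continuous.comp h1)
  have hch' : ∀ y ∈ Metric.ball z ε, (y ∈ Ω ↔ f y < 0) := fun y hy => by
    rw [hch y hy, hf, sub_neg]
  have hadd : ∀ (y : E d) (t : ℝ), f (y + t • u) = f y + t := fun y t => by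
    have h1 : inner ℝ u (y + t • u - c) = inner ℝ u (y - c) + t := by
      rw [add_sub_right_comm, inner_add_right, real_inner_smul_right, huu, mul_one]
    have h2 : y + t • u - c - (inner ℝ u (y - c) + t) • u = y - c - inner ℝ u (y - c) • u := by
      module
    simp only [hf, h1, h2]
    ring
  have hcl : ∀ y ∈ Metric.ball z ε, y ∈ closure Ω → f y ≤ 0 := fun y hy hyc => by
    by_contra! hpos
    have h1 : ∀ᶠ w in 𝓝 y, 0 < f w := hfc.tendsto y (lt_mem_nhds hpos)
    have h2 := mem_closure_iff_frequently.1 hyc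
    obtain ⟨w, hwΩ, hw1, hw2⟩ := (h2.and_eventually (h1.and (Metric.isOpen_ball.mem_nhds hy))).exists
    exact hw1.not_gt ((hch' w hw2).1 hwΩ)
  have hfr : ∀ y ∈ Metric.ball z ε, y ∈ frontier Ω → f y = 0 := fun y hy hyf => by
    refine le_antisymm (hcl y hy hyf.1) (not_lt.1 fun hlt => ?_)
    have h1 : y ∉ Ω := by
      have := hyf.2
      rwa [hΩ.interior_eq] at this
    exact h1 ((hch' y hy).2 hlt)
  have hz0 : f z = 0 := hfr z (Metric.mem_ball_self hε) (hdisc z (by simp) (by simpa using hR))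
  set κ := inner ℝ n u with hκ
  -- the disc is not steep
  have hlip : ∀ w : E d, inner ℝ n w = 0 → |inner ℝ u w| ≤ L * ‖w - inner ℝ u w • u‖ := by
    intro w hw
    obtain ⟨t, ht0, ht⟩ : ∃ t : ℝ, 0 < t ∧ t * ‖w‖ < min R ε := by
      refine ⟨min R ε / (‖w‖ + 1), by positivity, ?_⟩
      rw [div_mul_eq_mul_div, div_lt_iff₀ (by positivity)]
      have : 0 < min R ε := lt_min hR hε
      nlinarith
    have h1 : ‖t • w‖ = t * ‖w‖ := by rw [norm_smul, Real.norm_of_nonneg ht0.le]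
    have h2 : f (z + t • w) = 0 := by
      refine hfr _ ?_ (hdisc _ ?_ ?_)
      · rw [mem_ball_iff_norm, add_sub_cancel_left, h1]; exact ht.trans_le (min_le_right _ _)
      · rw [add_sub_cancel_left, real_inner_smul_right, hw, mul_zero]
      · rw [add_sub_cancel_left, h1]; exact ht.trans_le (min_le_left _ _)
    have h3 : inner ℝ u (z + t • w - c) = inner ℝ u (z - c) + t * inner ℝ u w := by
      rw [add_sub_right_comm, inner_add_right, real_inner_smul_right]
    simp only [hf] at h2 hz0
    rw [h3] at h2
    have h4 := hγ.norm_sub_le (z + t • w - c - (inner ℝ u (z - c) + t * inner ℝ u w) • u)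
      (z - c - inner ℝ u (z - c) • u)
    rw [Real.norm_eq_abs, show z + t • w - c - (inner ℝ u (z - c) + t * inner ℝ u w) • u
      - (z - c - inner ℝ u (z - c) • u) = t • (w - inner ℝ u w • u) by module, norm_smul,
      Real.norm_of_nonneg ht0.le, show γ (z + t • w - c - (inner ℝ u (z - c) + t * inner ℝ u w) • u)
      - γ (z - c - inner ℝ u (z - c) • u) = t * inner ℝ u w by linarith, abs_mul,
      abs_of_pos ht0] at h4
    refine le_of_mul_le_mul_left (?_ : t * _ ≤ t * _) ht0
    linarith
  -- The slope bound is applied to the tangential part `u - κ n` of `u`: it gives `1 - κ² ≤ L² κ²`,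
  -- so `u` is quantitatively transversal to the disc.
  have hκL : 1 ≤ κ ^ 2 * (1 + (L : ℝ) ^ 2) := by
    have h1 := hlip (u - κ • n) (by
      rw [inner_sub_right, real_inner_smul_right, hnn, ← hκ]; ring)
    have h2 : inner ℝ u (u - κ • n) = 1 - κ ^ 2 := by
      rw [inner_sub_right, real_inner_smul_right, huu, real_inner_comm n u, ← hκ]; ring
    have h3 : ‖u - κ • n - (1 - κ ^ 2) • u‖ ^ 2 = κ ^ 2 * (1 - κ ^ 2) := by
      rw [show u - κ • n - (1 - κ ^ 2) • u = κ • (κ • u - n) by module, norm_smul, mul_pow,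
        norm_sub_sq_real, norm_smul, hu, hn, real_inner_smul_left, real_inner_comm n u, ← hκ]
      simp only [Real.norm_eq_abs, sq_abs, mul_pow]
      ring
    rw [h2] at h1
    have h4 : (1 - κ ^ 2) ^ 2 ≤ L ^ 2 * (κ ^ 2 * (1 - κ ^ 2)) := by
      rw [← h3, ← mul_pow, ← sq_abs]
      exact pow_le_pow_left₀ (abs_nonneg _) h1 2
    have hκ1 : κ ^ 2 ≤ 1 := by
      have := abs_real_inner_le_norm n u
      rw [hn, hu, one_mul] at this
      rw [hκ, ← sq_abs]
      exact pow_le_one₀ (abs_nonneg _) this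
    rcases hκ1.eq_or_lt with h5 | h5
    · rw [h5]; nlinarith [sq_nonneg (L : ℝ)]
    · have h6 : (1 - κ ^ 2) * (1 - κ ^ 2) ≤ (1 - κ ^ 2) * (L ^ 2 * κ ^ 2) := by nlinarith
      have h7 := le_of_mul_le_mul_left h6 (by linarith)
      nlinarith
  have hL0 : (0 : ℝ) ≤ L := L.coe_nonneg
  have hκne : κ ≠ 0 := fun h => by rw [h] at hκL; norm_num at hκL
  -- If `κ` were negative, a small step along `u` would go behind the disc, hence into the closure
  -- of `Ω`, where the height cannot be positive.
  have hκpos : 0 < κ := by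
    refine lt_of_le_of_ne (not_lt.1 fun hneg => ?_) hκne.symm
    set t := min r₀ ε / 2 with ht
    have hmin : 0 < min r₀ ε := lt_min hr₀ hε
    have ht0 : 0 < t := half_pos hmin
    have hnorm : ‖z + t • u - z‖ = t := by
      rw [add_sub_cancel_left, norm_smul, hu, mul_one, Real.norm_of_nonneg ht0.le]
    have h1 : z + t • u ∈ closure Ω := by
      refine hlower _ ?_ ?_
      · rw [hnorm]; exact (half_lt_self hmin).trans_le (min_le_left _ _)
      · rw [add_sub_cancel_left, real_inner_smul_right, ← hκ]
        exact (mul_neg_of_pos_of_neg ht0 hneg).le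
    have h2 := hcl _ (by
      rw [mem_ball_iff_norm, hnorm]; exact (half_lt_self hmin).trans_le (min_le_right _ _)) h1
    rw [hadd, hz0] at h2
    linarith
  have hκL' : 1 ≤ κ * (1 + L) := by
    by_contra! hlt
    have : (κ * (1 + L)) ^ 2 < 1 := by
      have h0 : 0 ≤ κ * (1 + (L : ℝ)) := by positivity
      nlinarith
    have h8 : κ ^ 2 * (1 + (L : ℝ) ^ 2) ≤ (κ * (1 + L)) ^ 2 := by
      have : 0 ≤ κ ^ 2 * L := by positivity
      nlinarith
    linarith
  intro hyΩ
  -- Going back from `y` by `t` along `-u` reaches the plane of the disc, within `r (2 + L)` of `z`,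
  -- where the height is zero. So the height at `y` is `t > 0`.
  set t := inner ℝ n (y - z) / κ with ht
  have ht0 : 0 < t := by positivity
  have htr : t ≤ ‖y - z‖ * (1 + L) := by
    have h1 := (le_abs_self _).trans (abs_real_inner_le_norm n (y - z))
    rw [hn, one_mul] at h1
    rw [ht, div_le_iff₀ hκpos]
    calc inner ℝ n (y - z) ≤ ‖y - z‖ * 1 := by linarith
      _ ≤ ‖y - z‖ * (κ * (1 + L)) := by gcongr
      _ = _ := by ring
  have hy' : ‖y - t • u - z‖ < r * (2 + L) := by
    rw [sub_right_comm]
    calc ‖y - z - t • u‖ ≤ ‖y - z‖ + t := by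
          refine (norm_sub_le _ _).trans ?_
          rw [norm_smul, hu, mul_one, Real.norm_of_nonneg ht0.le]
      _ ≤ ‖y - z‖ * (2 + L) := by linarith
      _ < r * (2 + L) := by gcongr
  have hy0 : f (y - t • u) = 0 := by
    refine hfr _ (mem_ball_iff_norm.2 (hy'.trans_le hrε)) (hdisc _ ?_ (hy'.trans_le hrR))
    rw [sub_right_comm, inner_sub_right, real_inner_smul_right, ← hκ, ht]
    field_simp
    ring
  have hyf : f y = t := by
    have := hadd (y - t • u) t
    rwa [sub_add_cancel, hy0, zero_add] at this
  have hr0 : 0 < r := (norm_nonneg _).trans_lt hy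
  have h9 := (hch' y (mem_ball_iff_norm.2 (hy.trans_le (by nlinarith)))).1 hyΩ
  linarith

end Geometry

/-! ### Faces that contain discs: what lies behind and in front of them -/

section MeshGeometry

variable {d : ℕ} {Ω : Set (E d)}

/-- The points of a disc in `e` are limits of points of `e` that have an almost sure property. -/
lemma mem_closure_of_ae_surf {n z : E d} (hd : 0 < d) (hn : ‖n‖ = 1) {e : Set (E d)}
    (he : MeasurableSet e) (hez : ∀ x ∈ e, inner ℝ n (x - z) = 0) {R : ℝ}
    (hdisc : ∀ x, inner ℝ n (x - z) = 0 → ‖x - z‖ ≤ R → x ∈ e) {p : E d → Prop}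
    (hp : ∀ᵐ x ∂(surf e), p x) {x : E d} (hx : inner ℝ n (x - z) = 0) (hxR : ‖x - z‖ < R) :
    x ∈ closure {x | p x} := by
  rw [Metric.mem_closure_iff]
  intro ε hε
  by_contra! hcon
  obtain ⟨J, hJ, hJ'⟩ := exists_hyperplane_isometry hd hn
  obtain ⟨y₀, hy₀⟩ := hJ' _ hx
  have h0 : surf e (Metric.ball x ε) = 0 := by
    refine measure_mono_null (fun y hy => ?_) hp
    intro hpy
    have := hcon y hpy
    rw [Metric.mem_ball, dist_comm] at hy
    linarith
  rw [surfReal_eq hJ' he Metric.isOpen_ball.measurableSet hez] at h0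
  have hδ : 0 < min ε (R - ‖x - z‖) := lt_min hε (by linarith)
  refine (Metric.measure_ball_pos volume y₀ hδ).ne' (measure_mono_null (fun y hy => ?_) h0)
  rw [mem_ball_iff_norm, lt_min_iff] at hy
  have hzx : z + J y - x = J (y - y₀) := by rw [map_sub, hy₀]; abel
  have hzz : z + J y - z = J y := by abel
  refine ⟨?_, hdisc _ ?_ ?_⟩
  · rw [mem_ball_iff_norm, hzx, J.norm_map]; exact hy.1
  · rw [hzz]; exact hJ y
  · have h1 : z + J y - z = (z + J y - x) + (x - z) := by abel
    rw [h1]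
    refine (norm_add_le _ _).trans ?_
    rw [hzx, J.norm_map]
    linarith [hy.2]

namespace PolytopalMesh

variable (M : PolytopalMesh d Ω)

lemma diam_pos (hd : 0 < d) {T : Set (E d)} (hT : T ∈ M.elems) : 0 < Metric.diam T := by
  obtain ⟨x, hx⟩ := (M.elem_polytope T hT).interior_nonempty
  obtain ⟨ε, hε, hball⟩ := Metric.isOpen_iff.1 isOpen_interior x hx
  set u : E d := EuclideanSpace.single ⟨0, hd⟩ 1
  have hu : ‖u‖ = 1 := by simp [u]
  have h1 : x + (ε / 2) • u ∈ T := by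
    refine interior_subset (hball ?_)
    rw [mem_ball_iff_norm, add_sub_cancel_left, norm_smul, hu, mul_one, Real.norm_of_nonneg (by linarith)]
    linarith
  have h2 := Metric.dist_le_diam_of_mem (M.elem_polytope T hT).isCompact.isBounded h1
    (interior_subset hx)
  rw [dist_eq_norm, add_sub_cancel_left, norm_smul, hu, mul_one, Real.norm_of_nonneg (by linarith)] at h2
  linarith

lemma elem_subset {T : Set (E d)} (hT : T ∈ M.elems) : T ⊆ closure Ω := by
  rw [← M.cover]
  exact Set.subset_biUnion_of_mem (u := fun T : Set (E d) => T) hT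

lemma norm_sub_le_diam {T : Set (E d)} (hT : T ∈ M.elems) {x y : E d} (hx : x ∈ T) (hy : y ∈ T) :
    ‖x - y‖ ≤ Metric.diam T := by
  rw [← dist_eq_norm]
  exact Metric.dist_le_diam_of_mem (M.elem_polytope T hT).isCompact.isBounded hx hy

variable {M} {ρv ρe κ σ : ℝ}

lemma ShapeRegular.mem_of_disc (hM : M.ShapeRegular ρv ρe κ σ) (hd : 0 < d) (hσ : 0 < σ)
    {T e : Set (E d)} (hT : T ∈ M.elems) (he : e ∈ M.facesOf T) {z : E d} (hz : z ∈ e) {R r : ℝ}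
    (hdisc : ∀ x, inner ℝ (M.outward T e) (x - z) = 0 → ‖x - z‖ ≤ R → x ∈ e)
    (hr : r ≤ Metric.diam T) (hr' : 2 * r ≤ σ * Metric.diam T) (hR : r * (1 + 4 / σ) ≤ R) {y : E d}
    (hy : ‖y - z‖ < r) (hny : inner ℝ (M.outward T e) (y - z) ≤ 0) : y ∈ T := by
  obtain ⟨A, hAT, hA⟩ := hM.pyramid T hT e he
  refine mem_of_pyramid hσ (M.diam_pos hd hT) (fun x h1 h2 => (hA x (hdisc x h1 h2)).1)
    ((M.isFlatBoundary hT).unit e he) ?_ (M.norm_sub_le_diam hT (M.face_subset hT he hz) hAT)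
    hr hr' hR hy hny
  rw [real_inner_comm]
  exact (hA z hz).2

lemma isOpen_halfBall (z n : E d) (r : ℝ) :
    IsOpen {y : E d | ‖y - z‖ < r ∧ 0 < inner ℝ n (y - z)} := by
  have h1 : Continuous fun y : E d => ‖y - z‖ := by fun_prop
  have h2 : Continuous fun y : E d => inner ℝ n (y - z) := by fun_prop
  exact (isOpen_lt h1 continuous_const).inter (isOpen_lt continuous_const h2)

lemma halfBall_nonempty (z : E d) {n : E d} (hn : ‖n‖ = 1) {r : ℝ} (hr : 0 < r) :
    {y : E d | ‖y - z‖ < r ∧ 0 < inner ℝ n (y - z)}.Nonempty := by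
  refine ⟨z + (r / 2) • n, ?_, ?_⟩
  · rw [add_sub_cancel_left, norm_smul, hn, mul_one, Real.norm_of_nonneg (by linarith)]; linarith
  · rw [add_sub_cancel_left, real_inner_smul_right, real_inner_self_eq_norm_sq, hn]
    simpa using hr

/-- A face of `T` which is a face of no other element lies in the boundary of the domain. -/
lemma mem_frontier_of_disc (hΩ : IsOpen Ω) (hd : 0 < d) {T e : Set (E d)} (hT : T ∈ M.elems)
    (he : e ∈ M.facesOf T) (hother : ∀ T' ∈ M.elems, T' ≠ T → e ∉ M.facesOf T') {z : E d}
    (hz : z ∈ e) {R : ℝ}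
    (hdisc : ∀ x, inner ℝ (M.outward T e) (x - z) = 0 → ‖x - z‖ ≤ R → x ∈ e) {x : E d}
    (hx : inner ℝ (M.outward T e) (x - z) = 0) (hxR : ‖x - z‖ < R) : x ∈ frontier Ω := by
  have hB := M.isFlatBoundary hT
  have hn := hB.unit e he
  have hnn : inner ℝ (M.outward T e) (M.outward T e) = 1 := by
    rw [real_inner_self_eq_norm_sq, hn, one_pow]
  -- Almost every `x` in `e` lies on no other face of the mesh, hence in no other element. So near
  -- `x` the closure of `Ω` coincides with `T`, a half-space, and `x` cannot be interior to `Ω`.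
  have hae : ∀ᵐ x ∂(surf e), x ∈ frontier Ω := by
    have h1 : ∀ᵐ x ∂(surf e), ∀ e' ∈ M.faces, e' ≠ e → x ∉ e' := by
      rw [Finset.eventually_all]
      intro e' he'
      by_cases h : e' = e
      · exact Eventually.of_forall fun x hx => absurd h hx
      · have h2 := M.face_disjoint e (M.mem_facesOf.1 he).1 e' he' (Ne.symm h)
        filter_upwards [measure_eq_zero_iff_ae_notMem.1 h2] with x hx _ using hx
    filter_upwards [hB.ae_regular he, h1] with x hreg hxe'
    obtain ⟨hxe, hhalf, -⟩ := hreg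
    have hxT : x ∈ T := M.face_subset hT he hxe
    have hout : ∀ T' ∈ M.elems, T' ≠ T → x ∉ T' := fun T' hT' hne hxT' => by
      by_cases hfr : x ∈ frontier T'
      · obtain ⟨e'', he'', hsub, hxe''⟩ := M.bdry_faces T' hT' x hfr
        have : e'' = e := by
          by_contra h
          exact hxe' e'' he'' h hxe''
        subst this
        exact hother T' hT' hne (M.mem_facesOf.2 ⟨he'', hsub⟩)
      · have hint : x ∈ interior T' := by
          by_contra h
          exact hfr ⟨subset_closure hxT', h⟩
        obtain ⟨y, hy1, hy2⟩ := mem_closure_iff.1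
          ((M.elem_polytope T hT).subset_closure_interior hxT) _ isOpen_interior hint
        exact Set.disjoint_left.1 (M.elem_disjoint T' hT' T hT hne) hy1 hy2
    refine ⟨M.elem_subset hT hxT, fun hxΩ => ?_⟩
    rw [hΩ.interior_eq] at hxΩ
    have h2 : ∀ᶠ y in 𝓝 x, ∀ T' ∈ M.elems, T' ≠ T → y ∉ T' := by
      rw [Finset.eventually_all]
      intro T' hT'
      by_cases h : T' = T
      · exact Eventually.of_forall fun x hx => absurd h hx
      · filter_upwards [(M.elem_polytope T' hT').isCompact.isClosed.isOpen_compl.mem_nhds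
          (hout T' hT' h)] with y hy _ using hy
    have h3 : ∀ᶠ y in 𝓝 x, inner ℝ (M.outward T e) (y - x) ≤ 0 := by
      filter_upwards [h2, hhalf, hΩ.mem_nhds hxΩ] with y hy1 hy2 hy3
      have hy4 := subset_closure hy3
      rw [← M.cover, Set.mem_iUnion₂] at hy4
      obtain ⟨T', hT', hyT'⟩ := hy4
      have : T' = T := by
        by_contra h
        exact hy1 T' hT' h hyT'
      exact hy2.1 (this ▸ hyT')
    obtain ⟨ε, hε, hball⟩ := Metric.eventually_nhds_iff_ball.1 h3
    obtain ⟨y, hy1, hy2⟩ := halfBall_nonempty x hn hε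
    exact (hball y (mem_ball_iff_norm.2 hy1)).not_gt hy2
  have h4 := mem_closure_of_ae_surf hd hn (hB.isCompact_face e he).measurableSet
    (fun y hy => hB.perp e he y hy z hz) hdisc hae hx hxR
  rwa [Set.ofPred_mem_eq, isClosed_frontier.closure_eq] at h4

/-- In front of a face which is also a face of another element there are no points of `T`. -/
lemma ShapeRegular.notMem_of_neighbour (hM : M.ShapeRegular ρv ρe κ σ) (hd : 0 < d) (hσ : 0 < σ)
    {T T' e : Set (E d)} (hT : T ∈ M.elems) (hT' : T' ∈ M.elems) (hne : T' ≠ T)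
    (he : e ∈ M.facesOf T) (he' : e ∈ M.facesOf T') {z : E d} (hz : z ∈ e) {R r : ℝ} (hr0 : 0 < r)
    (hdisc : ∀ x, inner ℝ (M.outward T e) (x - z) = 0 → ‖x - z‖ ≤ R → x ∈ e)
    (hr : r ≤ Metric.diam T) (hr' : 2 * r ≤ σ * Metric.diam T)
    (hr'' : r ≤ Metric.diam T') (hr''' : 2 * r ≤ σ * Metric.diam T') (hR : r * (1 + 4 / σ) ≤ R)
    {y : E d} (hy : ‖y - z‖ < r) (hny : 0 < inner ℝ (M.outward T e) (y - z)) : y ∉ T := by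
  set n := M.outward T e with hn
  have hn1 : ‖n‖ = 1 := (M.isFlatBoundary hT).unit e he
  have hn' : M.outward T' e = n ∨ M.outward T' e = -n := by
    rcases M.outward_eq T e with h1 | h1 <;> rcases M.outward_eq T' e with h2 | h2 <;>
      simp [hn, h1, h2]
  have hlow : ∀ y, ‖y - z‖ < r → inner ℝ n (y - z) ≤ 0 → y ∈ T := fun y =>
    hM.mem_of_disc hd hσ hT he hz hdisc hr hr' hR
  have hdisj := M.elem_disjoint T hT T' hT' hne.symm
  -- If both elements had the same outward normal on `e`, both would contain the half-ball behind
  -- the disc and their interiors would meet. So the normals are opposite, and the neighbour fills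
  -- the half-ball in front.
  rcases hn' with h | h
  · exfalso
    have hlow' : ∀ y, ‖y - z‖ < r → inner ℝ n (y - z) ≤ 0 → y ∈ T' := fun y hy1 hy2 =>
      hM.mem_of_disc hd hσ hT' he' hz (by rwa [h]) hr'' hr''' hR hy1 (by rwa [h])
    obtain ⟨w, hw⟩ := halfBall_nonempty z (n := -n) (by rwa [norm_neg]) hr0
    have hsub : ∀ S : Set (E d), (∀ y, ‖y - z‖ < r → inner ℝ n (y - z) ≤ 0 → y ∈ S) →
        w ∈ interior S := fun S hS =>
      mem_interior.2 ⟨_, fun y hy => hS y hy.1 (by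
        have := hy.2
        rw [inner_neg_left] at this
        linarith), isOpen_halfBall z (-n) r, hw⟩
    exact Set.disjoint_left.1 hdisj (hsub T hlow) (hsub T' hlow')
  · intro hyT
    have hup : {y : E d | ‖y - z‖ < r ∧ 0 < inner ℝ n (y - z)} ⊆ T' := fun y hy =>
      hM.mem_of_disc hd hσ hT' he' hz (by
        rw [h]
        intro x hx
        rw [inner_neg_left, neg_eq_zero] at hx
        exact hdisc x hx) hr'' hr''' hR hy.1 (by
          rw [h, inner_neg_left]
          linarith [hy.2])
    obtain ⟨w, hw1, hw2⟩ := mem_closure_iff.1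
      ((M.elem_polytope T hT).subset_closure_interior hyT) _ (isOpen_halfBall z n r) ⟨hy, hny⟩
    exact Set.disjoint_left.1 hdisj hw2 (mem_interior.2 ⟨_, hup, isOpen_halfBall z n r, hw1⟩)

end PolytopalMesh

/-- Around some point of a face of `T`, the boundary of `T` is flat on a scale proportional to the
diameter of `T`. -/
theorem exists_flat_radius (hd : 2 ≤ d) (hΩ : IsBoundedLipschitz Ω) {σ τ : ℝ} (hσ : 0 < σ)
    (hτ : 0 < τ) : ∃ s : ℝ, 0 < s ∧ s ≤ 1 ∧ ∀ (M : PolytopalMesh d Ω) (ρv ρe κ : ℝ),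
      M.ShapeRegular ρv ρe κ σ → M.FacesContainBall τ → ∀ T ∈ M.elems, ∀ e ∈ M.facesOf T,
      ∃ z ∈ e, (∀ x, inner ℝ (M.outward T e) (x - z) = 0 → ‖x - z‖ ≤ s * Metric.diam T → x ∈ e) ∧
        ∀ e' ∈ M.facesOf T, e' ≠ e → ∀ᵐ x ∂(surf e'), s * Metric.diam T ≤ ‖x - z‖ := by
  have hd0 : 0 < d := by omega
  obtain ⟨L, ε, hε, hchart⟩ := hΩ.exists_uniform_chart
  have hL0 : (0 : ℝ) ≤ L := L.coe_nonneg
  set D := Metric.diam (closure Ω) + 1 with hD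
  have hD0 : 0 < D := by have := Metric.diam_nonneg (s := closure Ω); linarith
  set τ' := min τ 1 with hτ'
  set σ' := min σ 1 with hσ'
  have hτ'0 : 0 < τ' := lt_min hτ one_pos
  have hσ'0 : 0 < σ' := lt_min hσ one_pos
  have hτ1 : τ' ≤ 1 := min_le_right _ _
  have hσ1 : σ' ≤ 1 := min_le_right _ _
  have hττ : τ' ≤ τ := min_le_left _ _
  have hσσ : σ' ≤ σ := min_le_left _ _
  -- The first term makes the half-ball fit into the pyramids, as `s (1 + 4 / σ) ≤ τ`, also for a
  -- neighbour whose diameter is only `τ h`. The second keeps the points used for the boundary graph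
  -- inside the disc and, since `h ≤ D`, inside the chart.
  set s := min (τ' * σ' / 5) (min τ (ε / D) / (2 + L)) with hs
  have hs0 : 0 < s := by
    have : 0 < min τ (ε / D) := lt_min hτ (by positivity)
    exact lt_min (by positivity) (by positivity)
  have hs1 : s ≤ τ' * σ' / 5 := min_le_left _ _
  have hτσ : τ' * σ' ≤ σ' := by nlinarith
  have hτσ' : τ' * σ' ≤ τ' := by nlinarith
  have hs2 : s * (2 + L) ≤ min τ (ε / D) := by
    rw [← le_div_iff₀ (by positivity)]; exact min_le_right _ _
  have hs3 : s * (2 + L) ≤ τ := hs2.trans (min_le_left _ _)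
  have hs4 : s * (2 + L) * D ≤ ε := by
    rw [← le_div_iff₀ hD0]; exact hs2.trans (min_le_right _ _)
  have hs5 : s * (1 + 4 / σ) ≤ τ := by
    have h1 : 1 + 4 / σ ≤ 5 / σ' := by
      have h2 : 1 ≤ 1 / σ' := by rw [le_div_iff₀ hσ'0]; linarith
      have h3 : 4 / σ ≤ 4 / σ' := div_le_div_of_nonneg_left (by norm_num) hσ'0 hσσ
      calc 1 + 4 / σ ≤ 1 / σ' + 4 / σ' := add_le_add h2 h3
        _ = 5 / σ' := by ring
    calc s * (1 + 4 / σ) ≤ τ' * σ' / 5 * (5 / σ') := by gcongr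
      _ = τ' := by field_simp
      _ ≤ τ := hττ
  clear_value s D
  refine ⟨s, hs0, by linarith, fun M ρv ρe κ hM hball T hT e he => ?_⟩
  obtain ⟨z, hz, hdisc⟩ := hball T hT e he
  have hB := M.isFlatBoundary hT
  set h := Metric.diam T with hh
  have hh0 : 0 < h := M.diam_pos hd0 hT
  have hhD : h ≤ D := by
    have := Metric.diam_mono (M.elem_subset hT) hΩ.isBounded.closure
    linarith
  set n := M.outward T e with hn
  have hn1 : ‖n‖ = 1 := hB.unit e he
  have hdisc' : ∀ x, inner ℝ n (x - z) = 0 → ‖x - z‖ ≤ τ * h → x ∈ e := fun x hx => by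
    refine hdisc x ?_
    rcases M.outward_eq T e with h1 | h1
    · rwa [hn, h1] at hx
    · rwa [hn, h1, inner_neg_left, neg_eq_zero] at hx
  have hr : s * h ≤ h := by nlinarith
  have hr' : 2 * (s * h) ≤ σ * h := by nlinarith
  have hR : s * h * (1 + 4 / σ) ≤ τ * h := by
    rw [mul_right_comm]; exact mul_le_mul_of_nonneg_right hs5 hh0.le
  have hsL : s * h * (2 + L) ≤ τ * h := by
    rw [mul_right_comm]; exact mul_le_mul_of_nonneg_right hs3 hh0.le
  have hsε : s * h * (2 + L) ≤ ε := by
    rw [mul_right_comm]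
    exact (mul_le_mul_of_nonneg_left hhD (by positivity)).trans hs4
  have hlow : ∀ y, ‖y - z‖ < s * h → inner ℝ n (y - z) ≤ 0 → y ∈ T := fun y =>
    hM.mem_of_disc hd0 hσ hT he hz hdisc' hr hr' hR
  have hup : ∀ y, ‖y - z‖ < s * h → 0 < inner ℝ n (y - z) → y ∉ T := by
    intro y hy hny
    by_cases hex : ∃ T' ∈ M.elems, T' ≠ T ∧ e ∈ M.facesOf T'
    · obtain ⟨T', hT', hne, he'⟩ := hex
      -- The neighbour contains the disc, hence a segment of length `τ h`; a direction within the
      -- hyperplane exists because `d ≥ 2`.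
      have hh' : τ * h ≤ Metric.diam T' := by
        obtain ⟨J, hJ, -⟩ := exists_hyperplane_isometry hd0 hn1
        set u := J (EuclideanSpace.single ⟨0, by omega⟩ 1) with hu
        have hu1 : ‖u‖ = 1 := by rw [hu, J.norm_map]; simp
        have hue : z + (τ * h) • u ∈ e := by
          refine hdisc' _ ?_ ?_
          · rw [add_sub_cancel_left, real_inner_smul_right, hu, hJ, mul_zero]
          · rw [add_sub_cancel_left, norm_smul, hu1, mul_one, Real.norm_of_nonneg (by positivity)]
        have := M.norm_sub_le_diam hT' (M.face_subset hT' he' hue) (M.face_subset hT' he' hz)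
        rwa [add_sub_cancel_left, norm_smul, hu1, mul_one,
          Real.norm_of_nonneg (by positivity)] at this
      have hsτ : s ≤ τ := by linarith
      have hsστ : 2 * s ≤ σ * τ := by
        have : τ' * σ' ≤ τ * σ := mul_le_mul hττ hσσ hσ'0.le hτ.le
        nlinarith
      refine hM.notMem_of_neighbour hd0 hσ hT hT' hne he he' hz (by positivity) hdisc' hr hr' ?_ ?_
        hR hy hny
      · exact (mul_le_mul_of_nonneg_right hsτ hh0.le).trans hh'
      · calc 2 * (s * h) = 2 * s * h := by ring
          _ ≤ σ * τ * h := by gcongr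
          _ = σ * (τ * h) := by ring
          _ ≤ σ * Metric.diam T' := by gcongr
    · push Not at hex
      have hfr : ∀ x, inner ℝ n (x - z) = 0 → ‖x - z‖ < τ * h → x ∈ frontier Ω := fun x =>
        M.mem_frontier_of_disc hΩ.isOpen hd0 hT he hex hz hdisc'
      have hτh : 0 < τ * h := by positivity
      have hzfr : z ∈ frontier Ω := hfr z (by simp) (by simpa using hτh)
      have hnot : ∀ y, ‖y - z‖ < s * h → 0 < inner ℝ n (y - z) → y ∉ Ω := fun y =>
        (hchart z hzfr).notMem_of_disc hΩ.isOpen hε hn1 hτh (by positivity : 0 < s * h) hfr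
          (fun y hy1 hy2 => M.elem_subset hT (hlow y hy1 hy2)) hsL hsε
      intro hyT
      obtain ⟨w, hw1, hw2⟩ := mem_closure_iff.1 (M.elem_subset hT hyT) _
        (PolytopalMesh.isOpen_halfBall z n (s * h)) ⟨hy, hny⟩
      exact hnot w hw1.1 hw1.2 hw2
  -- Behind the disc all points are interior to `T`, in front none belongs to `T`. So nearby
  -- frontier points lie in the disc, hence in `e`, which meets every other face in a null set.
  have hflat : ∀ x ∈ frontier T, ‖x - z‖ < s * h → inner ℝ n (x - z) = 0 := by
    intro x hx hxz
    rcases lt_trichotomy (inner ℝ n (x - z)) 0 with h1 | h1 | h1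
    · refine absurd (mem_interior.2 ⟨_, fun y hy => hlow y hy.1 ?_,
        PolytopalMesh.isOpen_halfBall z (-n) (s * h), hxz, ?_⟩) hx.2
      · have := hy.2
        rw [inner_neg_left] at this
        linarith
      · rw [inner_neg_left]; linarith
    · exact h1
    · exact absurd (hB.isCompact.isClosed.frontier_subset hx) (hup x hxz h1)
  have hsτ : s ≤ τ := by linarith
  have hdisc'' : ∀ x, inner ℝ n (x - z) = 0 → ‖x - z‖ ≤ s * h → x ∈ e := fun x h1 h2 =>
    hdisc' x h1 (h2.trans (by gcongr))
  refine ⟨z, hz, hdisc'', fun e' he' hne => ?_⟩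
  have h1 := measure_eq_zero_iff_ae_notMem.1 (hB.disjoint e' he' e he hne)
  have h2 : ∀ᵐ x ∂(surf e'), x ∈ e' := ae_restrict_mem (hB.isCompact_face e' he').measurableSet
  filter_upwards [h1, h2] with x hx1 hx2
  by_contra! hlt
  exact hx1 (hdisc'' x (hflat x ((M.mem_facesOf.1 he').2 hx2) hlt) hlt.le)

end MeshGeometry

/-! ### Localisation by a peaking polynomial -/

section Peak

variable {d : ℕ}

/-- The polynomial `1 + s² / 16 - ‖x - z‖² / (4 h²)`. -/
def peak (s h : ℝ) (z : E d) : Poly d :=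
  MvPolynomial.C (1 + s ^ 2 / 16) - MvPolynomial.C (1 / (4 * h ^ 2)) * distSqPoly z

lemma val_peak (s h : ℝ) (z x : E d) :
    val (peak s h z) x = 1 + s ^ 2 / 16 - ‖x - z‖ ^ 2 / (4 * h ^ 2) := by
  rw [peak, val_sub, val_mul, val_C, val_C, val_distSqPoly]
  ring

lemma grad_peak (s h : ℝ) (z x : E d) :
    grad (peak s h z) x = -(1 / (2 * h ^ 2)) • (x - z) := by
  rw [peak, grad_sub, grad_mul, grad_C, grad_C, val_C, grad_distSqPoly, smul_zero, zero_add,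
    smul_smul, zero_sub, ← neg_smul]
  congr 1
  by_cases h0 : h = 0
  · simp [h0]
  · field_simp; norm_num

lemma totalDegree_peak_pow_le (s h : ℝ) (z : E d) (m : ℕ) :
    (peak s h z ^ m).totalDegree ≤ 2 * m := by
  refine (MvPolynomial.totalDegree_pow _ _).trans ?_
  rw [mul_comm]
  refine Nat.mul_le_mul_right m ((MvPolynomial.totalDegree_sub _ _).trans (max_le ?_ ?_))
  · rw [MvPolynomial.totalDegree_C]; exact Nat.zero_le 2
  · refine (MvPolynomial.totalDegree_mul _ _).trans ?_
    rw [MvPolynomial.totalDegree_C, zero_add]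
    exact totalDegree_distSqPoly_le z

/-- The factor `j + 1` comes from differentiating the power `j + 1` of the peak. -/
lemma exists_pow_le {θ η : ℝ} (hθ₀ : 0 ≤ θ) (hθ₁ : θ < 1) (hη : 0 < η) :
    ∃ j : ℕ, (j + 1) * θ ^ j ≤ η := by
  have h1 : Tendsto (fun j : ℕ => j * θ ^ j + θ ^ j) atTop (𝓝 (0 + 0)) :=
    (tendsto_self_mul_const_pow_of_lt_one hθ₀ hθ₁).add
      (tendsto_pow_atTop_nhds_zero_of_lt_one hθ₀ hθ₁)
  rw [add_zero] at h1
  obtain ⟨j, hj⟩ := (h1.eventually_lt_const hη).exists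
  exact ⟨j, by linarith⟩

/-- A disc of radius comparable with `h` carries a fixed part of the norm of a polynomial. -/
lemma exists_integral_disc_ge (hd : 0 < d) (k N : ℕ) (ρ : ℝ) {s : ℝ} (hs : 0 < s) :
    ∃ c₀ : ℝ, 0 < c₀ ∧ ∀ (T : Set (E d)) (F : Finset (Set (E d))) (ν : Set (E d) → E d) (h : ℝ),
    IsRegularElement T F ν h N ρ → ∀ e ∈ F, ∀ z ∈ e,
    (∀ x, inner ℝ (ν e) (x - z) = 0 → ‖x - z‖ ≤ s * h → x ∈ e) →
    ∀ P : Poly d, P.totalDegree ≤ k →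
      c₀ * ∫ x, val P x ^ 2 ∂(surf e) ≤
        ∫ x in Metric.closedBall z (s * h), val P x ^ 2 ∂(surf e) := by
  set V := volume.real (Metric.ball (0 : E (d - 1)) 1) with hV
  have hV0 : 0 < V := ENNReal.toReal_pos (Metric.measure_ball_pos _ _ one_pos).ne'
    measure_ball_lt_top.ne
  -- The disc of radius `s h` has area `s ^ (d - 1) V h ^ (d - 1)`. This fixed share suffices to
  -- control the value at the maximum point on `e`, which may lie outside the disc.
  obtain ⟨c, hc, hprod⟩ := integral_surf_prod_sq_ge hd k 1
    (by positivity : 0 < s ^ (d - 1) * V)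
  obtain ⟨C, hC, hrms⟩ := exists_rms_le hd (d := d)
  refine ⟨c / C ^ 2, by positivity, fun T F ν h hR e he z hz hdisc P hP => ?_⟩
  have hh := hR.h_pos
  have hn := hR.unit e he
  have hmeas := hR.measurableSet_face he
  set B := Metric.closedBall z (s * h) with hB
  have hBm : MeasurableSet B := Metric.isClosed_closedBall.measurableSet
  have hez : ∀ x ∈ e, inner ℝ (ν e) (x - z) = 0 := fun x hx => hR.perp e he x hx z hz
  have heB : e ⊆ Metric.closedBall z h :=
    (hR.face_subset e he).trans (hR.subset_closedBall (hR.face_subset e he hz))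
  have hsurf : (surf e).restrict B = surf (B ∩ e) := by
    rw [surf, surf, Measure.restrict_restrict hBm]
  rw [hsurf]
  have hezB : ∀ x ∈ B ∩ e, inner ℝ (ν e) (x - z) = 0 := fun x hx => hez x hx.2
  have harea : s ^ (d - 1) * V * h ^ (d - 1) ≤ (surf (B ∩ e)).real Set.univ := by
    obtain ⟨J, hJ, hJ'⟩ := exists_hyperplane_isometry hd hn
    have hpre : (fun y => z + J y) ⁻¹' (B ∩ e) = Metric.closedBall 0 (s * h) := by
      ext y
      have hzz : z + J y - z = J y := by abel
      simp only [Set.mem_preimage, Set.mem_inter_iff, hB, mem_closedBall_iff_norm, hzz,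
        J.norm_map, sub_zero]
      refine ⟨fun h => h.1, fun h => ⟨h, hdisc _ ?_ ?_⟩⟩
      · rw [hzz]; exact hJ y
      · rwa [hzz, J.norm_map]
    rw [Measure.real, surf_univ_eq hJ' (hBm.inter hmeas) hezB, hpre]
    change _ ≤ volume.real (Metric.closedBall (0 : E (d - 1)) (s * h))
    rw [volume_real_closedBall _ _ (by positivity), mul_pow]
    linarith
  obtain ⟨y, hy, hle⟩ := (hrms T F ν h ρ N hR P).2 e he
  have h1 := hprod (ν e) z h hn hh (B ∩ e) (hBm.inter hmeas) hezB
    (Set.inter_subset_right.trans heB) harea ({()} : Finset Unit) (by simp) (fun _ => P)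
    (fun _ _ => hP) (fun _ => y) (fun _ _ => ⟨heB hy, hez y hy⟩)
  simp only [Finset.prod_singleton] at h1
  have hs' : 0 < h ^ (d - 1) := pow_pos hh _
  have h2 : ∫ x, val P x ^ 2 ∂(surf e) ≤ h ^ (d - 1) * (C ^ 2 * val P y ^ 2) := by
    rw [integral_sq_eq (surf e) hs']
    gcongr
    rw [← sq_abs (val P y), ← mul_pow]
    exact pow_le_pow_left₀ (rms_nonneg _ _ _) hle 2
  calc c / C ^ 2 * ∫ x, val P x ^ 2 ∂(surf e)
      ≤ c / C ^ 2 * (h ^ (d - 1) * (C ^ 2 * val P y ^ 2)) := by gcongr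
    _ = c * h ^ (d - 1) * val P y ^ 2 := by field_simp
    _ ≤ _ := h1

/-- The peak is at least `1` within `s h / 2` of `z` and at most `θ = 1 - 3 s² / 16` beyond `s h`. A
high power is therefore still at least `1` on the inner disc, while it and its scaled gradient are
below `η` on the other faces. The constant `c₀` is independent of the power, hence may precede `η`.
-/
lemma exists_peak_localizer (hd : 0 < d) (k N : ℕ) (ρ : ℝ) {s : ℝ} (hs : 0 < s)
    (hs₁ : s ≤ 1) : ∃ c₀ : ℝ, 0 < c₀ ∧ ∀ η : ℝ, 0 < η → ∃ K : ℝ, 0 ≤ K ∧ ∃ m : ℕ,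
    ∀ (T : Set (E d)) (F : Finset (Set (E d))) (ν : Set (E d) → E d) (h : ℝ),
    IsRegularElement T F ν h N ρ → ∀ e ∈ F, ∀ z ∈ e,
    (∀ x, inner ℝ (ν e) (x - z) = 0 → ‖x - z‖ ≤ s * h → x ∈ e) →
    (∀ e' ∈ F, e' ≠ e → ∀ᵐ x ∂(surf e'), s * h ≤ ‖x - z‖) →
    ∃ ψ : Poly d, IsLocalizer T F ν h k c₀ 0 K η e ψ ∧ ψ.totalDegree ≤ 2 * m := by
  obtain ⟨c₀, hc₀, hdiscge⟩ := exists_integral_disc_ge hd k N ρ (half_pos hs)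
  refine ⟨c₀, hc₀, fun η hη => ?_⟩
  set θ := 1 - 3 / 16 * s ^ 2 with hθ
  have hθ₀ : 0 ≤ θ := by nlinarith
  have hθ₁ : θ < 1 := by rw [hθ]; linarith [pow_pos hs 2]
  obtain ⟨j, hj⟩ := exists_pow_le hθ₀ hθ₁ hη
  -- On `T` the peak lies between `0` and `1 + s² / 16 ≤ 2`.
  refine ⟨2 ^ (j + 1), by positivity, j + 1, fun T F ν h hR e he z hz hdisc haway =>
    ?_⟩
  have hh := hR.h_pos
  have hh2 : 0 < 4 * h ^ 2 := by positivity
  have hTz : ∀ x ∈ T, ‖x - z‖ ≤ h := fun x hx =>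
    hR.dist_le x hx z (hR.face_subset e he hz)
  have hpos : ∀ x ∈ T, 0 ≤ val (peak s h z) x := fun x hx => by
    have h1 : ‖x - z‖ ^ 2 / (4 * h ^ 2) ≤ 1 := by
      rw [div_le_one hh2]
      have := pow_le_pow_left₀ (norm_nonneg _) (hTz x hx) 2
      nlinarith
    rw [val_peak]
    linarith [sq_nonneg s]
  refine ⟨peak s h z ^ (j + 1), ⟨fun P hP => ?_, fun x hx => ?_, fun x hx => ?_,
    fun e' he' hne => ?_⟩, totalDegree_peak_pow_le s h z (j + 1)⟩
  · have hc : Continuous fun x => val (peak s h z ^ (j + 1)) x * val P x ^ 2 :=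
      (continuous_val _).mul ((continuous_val P).pow 2)
    have h1 := hdiscge T F ν h hR e he z hz
      (fun x h1 h2 => hdisc x h1 (h2.trans (by nlinarith))) P hP
    refine h1.trans ?_
    have hi1 : Integrable (fun x => val P x ^ 2) (surf e) :=
      hR.integrable_face hd he ((continuous_val P).pow 2)
    have hi2 := hR.integrable_face hd he hc
    refine (setIntegral_mono_on hi1.integrableOn hi2.integrableOn
      Metric.isClosed_closedBall.measurableSet fun x hx => ?_).trans
      (setIntegral_le_integral hi2 ?_)
    · rw [mem_closedBall_iff_norm] at hx
      have h2 : ‖x - z‖ ^ 2 / (4 * h ^ 2) ≤ s ^ 2 / 16 := by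
        rw [div_le_iff₀ hh2]
        have := pow_le_pow_left₀ (norm_nonneg _) hx 2
        nlinarith
      have h3 : 1 ≤ val (peak s h z) x := by rw [val_peak]; linarith
      rw [val_pow]
      nlinarith [one_le_pow₀ h3 (n := j + 1), sq_nonneg (val P x)]
    · filter_upwards [hR.ae_mem_face he] with x hx
      change 0 ≤ val (peak s h z ^ (j + 1)) x * val P x ^ 2
      rw [val_pow]
      have := hpos x (hR.face_subset e he hx)
      positivity
  · rw [val_pow, abs_pow, abs_of_nonneg (hpos x hx)]
    refine pow_le_pow_left₀ (hpos x hx) ?_ _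
    have : 0 ≤ ‖x - z‖ ^ 2 / (4 * h ^ 2) := by positivity
    rw [val_peak]
    nlinarith
  -- The gradient is parallel to `x - z`, which is tangential to `e`; so the normal derivative
  -- vanishes and `K₀ = 0`.
  · rw [grad_pow, grad_peak, smul_smul, real_inner_smul_left, real_inner_comm,
      hR.perp e he x hx z hz]
    simp
  · filter_upwards [haway e' he' hne, hR.ae_mem_face he'] with x hx1 hx2
    have hxT := hR.face_subset e' he' hx2
    have hp0 := hpos x hxT
    have hpθ : val (peak s h z) x ≤ θ := by
      have h2 : s ^ 2 / 4 ≤ ‖x - z‖ ^ 2 / (4 * h ^ 2) := by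
        rw [le_div_iff₀ hh2]
        have := pow_le_pow_left₀ (by positivity) hx1 2
        nlinarith
      rw [val_peak, hθ]
      linarith
    have hθj : 0 ≤ θ ^ j := pow_nonneg hθ₀ j
    constructor
    · rw [val_pow, abs_pow, abs_of_nonneg hp0]
      calc val (peak s h z) x ^ (j + 1) ≤ θ ^ (j + 1) := pow_le_pow_left₀ hp0 hpθ _
        _ ≤ θ ^ j := pow_le_pow_of_le_one hθ₀ hθ₁.le (Nat.le_succ j)
        _ ≤ (j + 1) * θ ^ j := le_mul_of_one_le_left hθj (by linarith [Nat.cast_nonneg (α := ℝ) j])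
        _ ≤ η := hj
    · rw [grad_pow, grad_peak, smul_smul, norm_smul, Nat.add_sub_cancel]
      have h3 : ‖x - z‖ ≤ h := hTz x hxT
      have h4 : ‖((j + 1 : ℕ) : ℝ) * val (peak s h z) x ^ j * -(1 / (2 * h ^ 2))‖ =
          ((j + 1 : ℕ) : ℝ) * val (peak s h z) x ^ j * (1 / (2 * h ^ 2)) := by
        rw [norm_mul, norm_neg, Real.norm_of_nonneg (by positivity),
          Real.norm_of_nonneg (by positivity)]
      rw [h4]
      push_cast
      calc (j + 1) * val (peak s h z) x ^ j * (1 / (2 * h ^ 2)) * ‖x - z‖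
          ≤ (j + 1) * θ ^ j * (1 / (2 * h ^ 2)) * h := by gcongr
        _ = (j + 1) * θ ^ j / h / 2 := by field_simp
        _ ≤ (j + 1) * θ ^ j / h := half_le_self (by positivity)
        _ ≤ η / h := by gcongr

end Peak

/-! ### Equivalence of the norms -/

section Equivalence

variable {d : ℕ} {T : Set (E d)} {F : Finset (Set (E d))} {ν : Set (E d) → E d} {h ρ : ℝ} {N : ℕ}

/-- The square of the discrete `H²` seminorm on one element. -/
def elemSq (T : Set (E d)) (F : Finset (Set (E d))) (h : ℝ) (g : Poly d)
    (a b : Set (E d) → Poly d) : ℝ :=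
  (∫ x in T, val g x ^ 2) + (h ^ 3)⁻¹ * ∑ e ∈ F, ∫ x, val (a e) x ^ 2 ∂(surf e)
    + h⁻¹ * ∑ e ∈ F, ∫ x, val (b e) x ^ 2 ∂(surf e)

lemma integral_elem_sq (T : Set (E d)) (hh : 0 < h) (P : Poly d) :
    ∫ x in T, val P x ^ 2 = h ^ d * rmsElem T h P ^ 2 :=
  integral_sq_eq (volume.restrict T) (pow_pos hh d) (val P)

/-- After multiplication by `h ^ 4` all three terms carry the same power `h ^ d`, and only
normalised norms remain. -/
lemma pow_four_mul_elemSq (hd : 0 < d) (hh : 0 < h) (g : Poly d) (a b : Set (E d) → Poly d) :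
    h ^ 4 * elemSq T F h g a b = h ^ d * ((h ^ 2 * rmsElem T h g) ^ 2
      + ∑ e ∈ F, (rmsFace e h (a e) ^ 2 + (h * rmsFace e h (b e)) ^ 2)) := by
  have hs : 0 < h ^ (d - 1) := pow_pos hh _
  have hpow : h ^ d = h ^ (d - 1) * h := by rw [← pow_succ, Nat.sub_add_cancel hd]
  have hF : ∀ P : Set (E d) → Poly d, ∑ e ∈ F, ∫ x, val (P e) x ^ 2 ∂(surf e) =
      h ^ (d - 1) * ∑ e ∈ F, rmsFace e h (P e) ^ 2 := fun P => by
    rw [Finset.mul_sum]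
    exact Finset.sum_congr rfl fun e _ => integral_sq_eq (surf e) hs _
  rw [elemSq, integral_elem_sq T hh, hF, hF, Finset.sum_add_distrib]
  simp only [mul_pow h]
  rw [← Finset.mul_sum, hpow]
  field_simp
  ring

lemma sum_sq_le_jumpSum_sq (hh : 0 < h) (a b : Set (E d) → Poly d) :
    ∑ e ∈ F, (rmsFace e h (a e) ^ 2 + (h * rmsFace e h (b e)) ^ 2) ≤ jumpSum F h a b ^ 2 := by
  have h0 : ∀ e, 0 ≤ rmsFace e h (a e) := fun e => rmsFace_nonneg _ _ _
  have h1 : ∀ e, 0 ≤ h * rmsFace e h (b e) := fun e => mul_nonneg hh.le (rmsFace_nonneg _ _ _)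
  refine le_trans (Finset.sum_le_sum fun e _ => ?_)
    (Finset.sum_sq_le_sq_sum_of_nonneg fun e _ => add_nonneg (h0 e) (h1 e))
  nlinarith [mul_nonneg (h0 e) (h1 e)]

lemma jumpSum_sq_le (hN : F.card ≤ N) (a b : Set (E d) → Poly d) :
    jumpSum F h a b ^ 2 ≤
      N * (2 * ∑ e ∈ F, (rmsFace e h (a e) ^ 2 + (h * rmsFace e h (b e)) ^ 2)) := by
  refine (sq_sum_le_card_mul_sum_sq (s := F)).trans ?_
  have hN' : (F.card : ℝ) ≤ N := by exact_mod_cast hN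
  refine mul_le_mul hN' ?_ (Finset.sum_nonneg fun e _ => sq_nonneg _) (Nat.cast_nonneg N)
  rw [Finset.mul_sum]
  refine Finset.sum_le_sum fun e _ => ?_
  exact add_sq_le

/-- The volume bound removes `Δv₀` from the right-hand side of the jump bound. The quantifiers keep
the order `c₀, K₀`, then `η`, then `K`, as the construction of the peak requires. -/
lemma exists_elemSq_le (hd : 0 < d) (k N : ℕ) {ρ c₀ K₀ : ℝ} (hρ : 0 < ρ) (hc₀ : 0 < c₀)
    (hK₀ : 0 ≤ K₀) : ∃ η : ℝ, 0 < η ∧ ∀ K : ℝ, 0 ≤ K → ∃ C : ℝ, 0 < C ∧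
    ∀ (T : Set (E d)) (F : Finset (Set (E d))) (ν : Set (E d) → E d) (h : ℝ),
    IsRegularElement T F ν h N ρ → ∀ (D : ℕ) (w g : Poly d) (a b : Set (E d) → Poly d),
    g.totalDegree ≤ k - 2 → (∀ e ∈ F, (a e).totalDegree ≤ k ∧ (b e).totalDegree ≤ k) →
    2 * N + (k - 2) ≤ D →
    (∀ e ∈ F, ∃ ψ : Poly d, IsLocalizer T F ν h k c₀ K₀ K η e ψ ∧ ψ.totalDegree + k + 1 ≤ D) →
    Represents T F ν D w g a b →
    elemSq T F h g a b ≤ C * ∫ x in T, val w x ^ 2 := by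
  obtain ⟨η, hη, hloc⟩ := exists_localizer_bound (d := d) hd k N hρ hc₀ hK₀
  obtain ⟨C', hC', hvol⟩ := exists_volume_bound (d := d) hd (k - 2) N hρ
  refine ⟨η, hη, fun K hK => ?_⟩
  obtain ⟨C, hC, hjump⟩ := hloc K hK
  refine ⟨C' ^ 2 + (C * (1 + C')) ^ 2, by positivity,
    fun T F ν h hR D w g a b hg hab hD hψ hrep => ?_⟩
  have hh := hR.h_pos
  have h1 := hvol T F ν h hR D w g a b hg hD hrep
  have h2 := hjump T F ν h hR D w g a b hab hψ hrep
  set ω := rmsElem T h w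
  set γ := rmsElem T h g
  have hω : 0 ≤ ω := rmsElem_nonneg _ _ _
  have hγ : 0 ≤ γ := rmsElem_nonneg _ _ _
  have hS0 : 0 ≤ jumpSum F h a b := Finset.sum_nonneg fun i _ =>
    add_nonneg (rmsFace_nonneg _ _ _) (mul_nonneg hh.le (rmsFace_nonneg _ _ _))
  have h3 : jumpSum F h a b ≤ C * (1 + C') * (h ^ 2 * ω) := by
    calc jumpSum F h a b ≤ C * (h ^ 2 * (ω + γ)) := h2
      _ ≤ C * (h ^ 2 * (ω + C' * ω)) := by gcongr
      _ = _ := by ring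
  have h4 : h ^ 2 * γ ≤ C' * (h ^ 2 * ω) := by
    calc h ^ 2 * γ ≤ h ^ 2 * (C' * ω) := by gcongr
      _ = _ := by ring
  have hh4 : 0 < h ^ 4 := by positivity
  refine le_of_mul_le_mul_left ?_ hh4
  rw [pow_four_mul_elemSq hd hh, integral_elem_sq T hh]
  calc h ^ d * ((h ^ 2 * γ) ^ 2 + ∑ e ∈ F, (rmsFace e h (a e) ^ 2 + (h * rmsFace e h (b e)) ^ 2))
      ≤ h ^ d * ((h ^ 2 * γ) ^ 2 + jumpSum F h a b ^ 2) := by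
        gcongr
        exact sum_sq_le_jumpSum_sq hh a b
    _ ≤ h ^ d * ((C' * (h ^ 2 * ω)) ^ 2 + (C * (1 + C') * (h ^ 2 * ω)) ^ 2) := by gcongr
    _ = h ^ 4 * ((C' ^ 2 + (C * (1 + C')) ^ 2) * (h ^ d * ω ^ 2)) := by ring

lemma exists_le_elemSq (hd : 0 < d) (r N : ℕ) {ρ : ℝ} (hρ : 0 < ρ) : ∃ C : ℝ, 0 < C ∧
    ∀ (T : Set (E d)) (F : Finset (Set (E d))) (ν : Set (E d) → E d) (h : ℝ),
    IsRegularElement T F ν h N ρ → ∀ (w g : Poly d) (a b : Set (E d) → Poly d),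
    w.totalDegree ≤ r → Represents T F ν r w g a b →
    ∫ x in T, val w x ^ 2 ≤ C * elemSq T F h g a b := by
  obtain ⟨C, hC, hup⟩ := exists_upper_bound (d := d) hd r N hρ
  refine ⟨C ^ 2 * (2 * (1 + 2 * N)), by positivity, fun T F ν h hR w g a b hw hrep => ?_⟩
  have hh := hR.h_pos
  have h1 := hup T F ν h hR w g a b hw hrep
  set ω := rmsElem T h w
  set γ := rmsElem T h g
  have hω : 0 ≤ ω := rmsElem_nonneg _ _ _
  set S := ∑ e ∈ F, (rmsFace e h (a e) ^ 2 + (h * rmsFace e h (b e)) ^ 2) with hS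
  have hS0 : 0 ≤ S := Finset.sum_nonneg fun e _ => by positivity
  have h2 : (h ^ 2 * ω) ^ 2 ≤ C ^ 2 * (2 * (1 + 2 * N)) * ((h ^ 2 * γ) ^ 2 + S) := by
    calc (h ^ 2 * ω) ^ 2 ≤ (C * (h ^ 2 * γ + jumpSum F h a b)) ^ 2 := by gcongr
      _ = C ^ 2 * (h ^ 2 * γ + jumpSum F h a b) ^ 2 := by ring
      _ ≤ C ^ 2 * (2 * ((h ^ 2 * γ) ^ 2 + jumpSum F h a b ^ 2)) := by
          gcongr
          exact add_sq_le
      _ ≤ C ^ 2 * (2 * ((h ^ 2 * γ) ^ 2 + N * (2 * S))) := by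
          gcongr
          exact jumpSum_sq_le hR.card_le a b
      _ ≤ C ^ 2 * (2 * ((1 + 2 * N) * (h ^ 2 * γ) ^ 2 + (1 + 2 * N) * S)) := by
          have h3 : 0 ≤ (N : ℝ) * (h ^ 2 * γ) ^ 2 := by positivity
          refine mul_le_mul_of_nonneg_left ?_ (sq_nonneg C)
          linarith
      _ = _ := by ring
  have hh4 : 0 < h ^ 4 := by positivity
  refine le_of_mul_le_mul_left ?_ hh4
  rw [integral_elem_sq T hh, mul_left_comm (h ^ 4) (C ^ 2 * _), pow_four_mul_elemSq hd hh, ← hS]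
  calc h ^ 4 * (h ^ d * ω ^ 2) = h ^ d * (h ^ 2 * ω) ^ 2 := by ring
    _ ≤ h ^ d * (C ^ 2 * (2 * (1 + 2 * N)) * ((h ^ 2 * γ) ^ 2 + S)) := by gcongr
    _ = _ := by ring

end Equivalence

/-! ### From single elements to the mesh -/

section MeshEquivalence

variable {d k p q : ℕ} {Ω : Set (E d)} {M : PolytopalMesh d Ω}

/-- Measuring the area of a face by the diameter of the element in place of its own costs the factor
`κ ^ (d - 1)`. -/
lemma PolytopalMesh.ShapeRegular.isRegularElement {ρv ρe κ σ : ℝ} {N : ℕ}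
    (hM : M.ShapeRegular ρv ρe κ σ) (hN : M.FacesLE N) (hd : 0 < d) (hρe : 0 < ρe) (hκ : 0 < κ)
    {T : Set (E d)} (hT : T ∈ M.elems) :
    IsRegularElement T (M.facesOf T) (M.outward T) (Metric.diam T) N
      (min ρv (ρe * κ ^ (d - 1))) where
  toIsFlatBoundary := M.isFlatBoundary hT
  h_pos := M.diam_pos hd hT
  dist_le x hx y hy := M.norm_sub_le_diam hT hx hy
  face_subset e he := M.face_subset hT he
  face_nonempty e he := M.face_nonempty he
  card_le := hN T hT
  volume_ge := by
    refine le_trans ?_ (hM.volume_elem T hT)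
    have := Metric.diam_nonneg (s := T)
    gcongr
    exact min_le_left _ _
  surf_ge e he := by
    have h1 := hM.area_face e (M.mem_facesOf.1 he).1
    have h2 := hM.diam_face T hT e he
    have h0 := Metric.diam_nonneg (s := T)
    have h3 : (surf e).real e = (surf e).real Set.univ := by
      rw [Measure.real, Measure.real, surf, Measure.restrict_apply_self,
        Measure.restrict_apply_univ]
    rw [← h3]
    calc min ρv (ρe * κ ^ (d - 1)) * Metric.diam T ^ (d - 1)
        ≤ ρe * κ ^ (d - 1) * Metric.diam T ^ (d - 1) := by
          gcongr
          exact min_le_right _ _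
      _ = ρe * (κ * Metric.diam T) ^ (d - 1) := by rw [mul_pow]; ring
      _ ≤ ρe * Metric.diam e ^ (d - 1) := by gcongr
      _ ≤ _ := h1

namespace WeakSpace

lemma represents (hd : 0 < d) (v : WeakSpace M k p q) (r : ℕ) {T : Set (E d)}
    (hT : T ∈ M.elems) : Represents T (M.facesOf T) (M.outward T) r (v.weakLap r T)
      (lap (v.v0 T)) (v.jump T) (v.fluxJump T) := fun φ hφ => by
  rw [(weakLap_spec v r hT).2 φ hφ, v.lapForm_eq hd hT φ]

lemma h2Norm_eq (v : WeakSpace M k p q) : v.h2Norm = Real.sqrt (∑ T ∈ M.elems,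
    elemSq T (M.facesOf T) (Metric.diam T) (lap (v.v0 T)) (v.jump T) (v.fluxJump T)) := by
  simp only [h2Norm, elemSq, val_jump, val_fluxJump]

lemma totalDegree_lap_v0_le (v : WeakSpace M k p q) {T : Set (E d)} (hT : T ∈ M.elems) :
    (lap (v.v0 T)).totalDegree ≤ k - 2 :=
  (totalDegree_lap_le _).trans (Nat.sub_le_sub_right (v.degree_v0 T hT) 2)

/-- The energy norm and the discrete `H²` seminorm are equivalent if they are equivalent on every
element. -/
lemma norms_equiv {r : ℕ} {C C' : ℝ}
    (hC : 0 < C) (hC' : 0 < C') (v : WeakSpace M k p q)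
    (hlow : ∀ T ∈ M.elems, elemSq T (M.facesOf T) (Metric.diam T) (lap (v.v0 T)) (v.jump T)
      (v.fluxJump T) ≤ C * ∫ x in T, val (v.weakLap r T) x ^ 2)
    (hup : ∀ T ∈ M.elems, ∫ x in T, val (v.weakLap r T) x ^ 2 ≤
      C' * elemSq T (M.facesOf T) (Metric.diam T) (lap (v.v0 T)) (v.jump T) (v.fluxJump T)) :
    (√C)⁻¹ * v.h2Norm ≤ v.energyNorm r ∧ v.energyNorm r ≤ √C' * v.h2Norm := by
  rw [h2Norm_eq, energyNorm]
  constructor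
  · rw [inv_mul_le_iff₀ (Real.sqrt_pos.2 hC), ← Real.sqrt_mul hC.le, Finset.mul_sum]
    exact Real.sqrt_le_sqrt (Finset.sum_le_sum hlow)
  · rw [← Real.sqrt_mul hC'.le, Finset.mul_sum]
    exact Real.sqrt_le_sqrt (Finset.sum_le_sum hup)

end WeakSpace

end MeshEquivalence

end WGBiharmonic

end

/-! ### The main theorem: degree counts and the order of the constants -/

theorem mainTheorem2 (d k p q N : ℕ) (hd : 2 ≤ d) (hk : 2 ≤ k) (hq : 1 ≤ q) (hqp : q ≤ p)
    (hpk : p ≤ k) (ρv ρe κ σ : ℝ) (hρv : 0 < ρv) (hρe : 0 < ρe) (hκ : 0 < κ) (hσ : 0 < σ) :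
    (∃ C : ℝ, 0 < C ∧ ∀ r : ℕ, 2 * N + k - 2 ≤ r → ∀ Ω : Set (E d), IsBoundedLipschitz Ω →
      ∀ M : PolytopalMesh d Ω, M.ShapeRegular ρv ρe κ σ → M.FacesLE N →
      ∀ v : WeakSpace M k p q, ∀ T ∈ M.elems,
        normL2 (volume.restrict T) (val (lap (v.v0 T))) ≤
          C * normL2 (volume.restrict T) (val (v.weakLap r T))) ∧
    (∀ δ : ℝ, 0 < δ → ∀ r : ℕ, 2 * N + k - 1 ≤ r → ∃ C₁ C₂ : ℝ, 0 < C₁ ∧ 0 < C₂ ∧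
      ∀ Ω : Set (E d), IsBoundedLipschitz Ω →
      ∀ M : PolytopalMesh d Ω, M.ShapeRegular ρv ρe κ σ → M.FacesLE N → M.FacesSeparated δ →
      ∀ v : WeakSpace M k p q,
        C₁ * v.h2Norm ≤ v.energyNorm r ∧ v.energyNorm r ≤ C₂ * v.h2Norm) ∧
    (∀ τ : ℝ, 0 < τ → ∀ Ω : Set (E d), IsBoundedLipschitz Ω →
      ∃ r₀ : ℕ, ∀ r : ℕ, r₀ ≤ r → ∃ C₁ C₂ : ℝ, 0 < C₁ ∧ 0 < C₂ ∧
      ∀ M : PolytopalMesh d Ω, M.ShapeRegular ρv ρe κ σ → M.FacesLE N → M.FacesContainBall τ →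
      ∀ v : WeakSpace M k p q,
        C₁ * v.h2Norm ≤ v.energyNorm r ∧ v.energyNorm r ≤ C₂ * v.h2Norm) := by
  have hd0 : 0 < d := by omega
  have hqk : q ≤ k := hqp.trans hpk
  have hρ : 0 < min ρv (ρe * κ ^ (d - 1)) := lt_min hρv (by positivity)
  refine ⟨?_, fun δ hδ r hr => ?_, fun τ hτ Ω hΩ => ?_⟩
  -- The test function has degree at most `2 N + (k - 2)`, which is the threshold for `r`. Numerator
  -- and denominator of the normalised norms share the same factor, which cancels.
  · obtain ⟨C, hC, hvol⟩ := exists_volume_bound (d := d) hd0 (k - 2) N hρ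
    refine ⟨C, hC, fun r hr Ω hΩ M hM hN v T hT => ?_⟩
    have hR := hM.isRegularElement hN hd0 hρe hκ hT
    have h1 := hvol _ _ _ _ hR r _ _ _ _ (v.totalDegree_lap_v0_le hT) (by omega)
      (v.represents hd0 r hT)
    rw [rmsElem, rmsElem, rms, rms, ← mul_div_assoc] at h1
    exact (div_le_div_iff_of_pos_right (Real.sqrt_pos.2 (pow_pos hR.h_pos d))).1 h1
  · obtain ⟨c₀, K₀, K, hc₀, hK₀, hK, hsep⟩ :=
      exists_separated_localizer (d := d) hd0 k N hρ hδ
    obtain ⟨η, hη, hlow⟩ := exists_elemSq_le (d := d) hd0 k N hρ hc₀ hK₀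
    obtain ⟨C, hC, hlow⟩ := hlow K hK
    obtain ⟨C', hC', hup⟩ := exists_le_elemSq (d := d) hd0 r N hρ
    refine ⟨(√C)⁻¹, √C', by positivity, by positivity, fun Ω hΩ M hM hN hδM v => ?_⟩
    refine v.norms_equiv hC hC' (fun T hT => ?_) fun T hT => ?_
    · have hR := hM.isRegularElement hN hd0 hρe hκ hT
      refine hlow _ _ _ _ hR r _ _ _ _ (v.totalDegree_lap_v0_le hT) (fun e he =>
        ⟨v.totalDegree_jump_le hpk hT he, v.totalDegree_fluxJump_le hqk hT he⟩) (by omega)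
        (fun e he => ?_) (v.represents hd0 r hT)
      obtain ⟨ψ, hψ, hdeg⟩ := hsep _ _ _ _ hR (fun e he e' he' hne => by
        obtain ⟨x, hx, hxy⟩ := hδM T hT e he e' he' hne
        refine ⟨x, hx, fun y hy => ?_⟩
        rcases M.outward_eq T e' with h1 | h1 <;> simpa [h1] using hxy y hy) e he η hη.le
      -- There is a face, so `N ≥ 1` and the truncated difference `N - 1` is genuine: the degree
      -- needed is `2 (N - 1) + k + 1 = 2 N + k - 1`.
      have hcard : 0 < (M.facesOf T).card := Finset.card_pos.2 ⟨e, he⟩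
      have := hN T hT
      exact ⟨ψ, hψ, by omega⟩
    · exact hup _ _ _ _ (hM.isRegularElement hN hd0 hρe hκ hT) _ _ _ _
        (weakLap_spec v r hT).1 (v.represents hd0 r hT)
  · obtain ⟨s, hs, hs₁, hflat⟩ := exists_flat_radius hd hΩ hσ hτ
    obtain ⟨c₀, hc₀, hpeak⟩ := exists_peak_localizer hd0 k N (min ρv (ρe * κ ^ (d - 1))) hs hs₁
    -- The order matters: `s` depends on `Ω`, `σ` and `τ`, then `c₀` on `s`, then `η` on `c₀`, and
    -- only then the power `m`, which determines `r₀`.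
    obtain ⟨η, hη, hlow⟩ := exists_elemSq_le (d := d) hd0 k N hρ hc₀ le_rfl
    obtain ⟨K, hK, m, hpeak⟩ := hpeak η hη
    obtain ⟨C, hC, hlow⟩ := hlow K hK
    -- The first term is enough for the volume test function, the second for the peak of degree `2
    -- m` times a polynomial of degree `k + 1`.
    refine ⟨max (2 * N + k) (2 * m + k + 1), fun r hr => ?_⟩
    have hr₁ := (le_max_left _ _).trans hr
    have hr₂ := (le_max_right _ _).trans hr
    obtain ⟨C', hC', hup⟩ := exists_le_elemSq (d := d) hd0 r N hρ
    refine ⟨(√C)⁻¹, √C', by positivity, by positivity, fun M hM hN hball v => ?_⟩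
    refine v.norms_equiv hC hC' (fun T hT => ?_) fun T hT => ?_
    · have hR := hM.isRegularElement hN hd0 hρe hκ hT
      refine hlow _ _ _ _ hR r _ _ _ _ (v.totalDegree_lap_v0_le hT) (fun e he =>
        ⟨v.totalDegree_jump_le hpk hT he, v.totalDegree_fluxJump_le hqk hT he⟩) (by omega)
        (fun e he => ?_) (v.represents hd0 r hT)
      obtain ⟨z, hz, hdisc, haway⟩ := hflat M ρv ρe κ hM hball T hT e he
      obtain ⟨ψ, hψ, hdeg⟩ := hpeak _ _ _ _ hR e he z hz hdisc haway
      exact ⟨ψ, hψ, by omega⟩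
    · exact hup _ _ _ _ (hM.isRegularElement hN hd0 hρe hκ hT) _ _ _ _
        (weakLap_spec v r hT).1 (v.represents hd0 r hT)
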